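/- **Setting.** Let $\mathbb H^2$ be the hyperbolic plane, with metric $g$, Levi-Civita connection $\nabla$ and complex structure $\mathrm J$; in the Poincaré disk model it is the unit disk with $g=\frac{4|dz|^2}{(1-|z|^2)^2}$ and $\mathrm J$ is multiplication by $i$; the Klein disk model is obtained from it by $z\mapsto \frac{2z}{1+|z|^2}$. Splitting tangent vectors of $\mathrm T\mathbb H^2$ into horizontal and vertical parts by $\nabla$, equip $\mathrm T\mathbb H^2$ with the pseudo-Riemannian metric $\mathbb G((X_1,X_2),(Y_1,Y_2))=g(X_1,Y_2)+g(X_2,Y_1)$ and the symplectic form $\Omega((X_1,X_2),(Y_1,Y_2))=g(\mathrm JX_1,Y_2)-g(X_2,\mathrm JY_1)$. A smooth vector field $V$ on $\mathbb H^2$ is *harmonic Lagrangian* if $V:(\mathbb H^2,g)\to(\mathrm T\mathbb H^2,\mathbb G)$ is a harmonic map (its tension field vanishes) and $V^*\Omega=0$. Put $\overline\partial V(Y)=\frac12(\nabla_YV+\mathrm J\nabla_{\mathrm JY}V)$, and let $\|\overline\partial V\|_\infty\in[0,+\infty]$ be the supremum over $\mathbb H^2$ of the operator norms of $\overline\partial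 V$ for $g$. Let $X$ be a continuous vector field on $\mathbb S^1\subset\mathbb C$, and write $X(z)=iz\,\phi_X(z)$ with $\phi_X:\mathbb S^1\to\mathbb R$ continuous. A vector field $V$ on $\mathbb H^2$ *extends continuously to* $X$ if, written as a map from the open unit disk to $\mathbb C$ in a disk model, it tends to $X(\zeta)$ at every $\zeta\in\mathbb S^1$. The model is either the Klein model or the Poincaré model; the theorem holds for each of the two choices. * $X$ is *Zygmund* if $\sup|X[a,b,c,d]|<\infty$, the supremum being over all quadruples of points $a,b,c,d$ of $\mathbb S^1$ in counter-clockwise order with $\frac{(b-a)(d-c)}{(c-b)(d-a)}=1$, where $X[a,b,c,d]=\frac{X(b)-X(a)}{b-a}-\frac{X(c)-X(b)}{c-b}+\frac{X(d)-X(c)}{d-c}-\frac{X(a)-X(d)}{a-d}$. * The *width* of $X$ is $\omega(X)=\sup_{|\eta|<1}\frac{\phi_X^+(\eta)-\phi_X^-(\eta)}{\sqrt{1-|\eta|^2}}\in[0,+\infty]$, where $\phi_X^-(\eta)$ (resp. $\phi_X^+(\eta)$) is the supremum (resp. infimum) of $a(\eta)$ over the real affine functions $a$ on $\mathbb R^2\cong\mathbb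 C$ with $a|_{\mathbb S^1}\le\phi_X$ (resp. $a|_{\mathbb S^1}\ge\phi_X$). * $\mathrm{HL}(X)=\mathrm J\,\mathrm{grad}\,u_X$, where $u_X$ is the unique smooth function on $\mathbb H^2$ with $\Delta u_X-2u_X=0$ such that, in the Klein model, $\overline{u_X}(\eta)=\sqrt{1-|\eta|^2}\,u_X(\eta)$ extends continuously by $\phi_X$ to $\mathbb S^1$. **Theorem.** Let $X$ be a continuous vector field on $\mathbb S^1$. The function $u_X$ exists and is unique, and the following are equivalent: 1. $X$ is Zygmund; 2. there is a harmonic Lagrangian vector field $V$ on $\mathbb H^2$ that extends continuously to $X$ and has $\|\overline\partial V\|_\infty<+\infty$; 3. $\omega(X)<+\infty$; 4. $\|\overline\partial\,\mathrm{HL}(X)\|_\infty<+\infty$. Moreover, (i) every $V$ as in (2) equals $\mathrm{HL}(X)$, so it is unique; (ii) in $[0,+\infty]$, $$\tfrac16\|\overline\partial\,\mathrm{HL}(X)\|_\infty\le\omega(X)\le2\|\overline\partial\,\mathrm{HL}(X)\|_\infty .$$ -/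

import Mathlib

open Set Filter Topology
open scoped ENNReal ContDiff

namespace HarmLag

/-! ### Pseudo-Riemannian geometry in a global chart

`E` is a real vector space with a basis `b`, and a (pseudo-)metric on an open subset of `E` is
a function `g` with `g x v w` the scalar product at `x` of the tangent vectors `v` and `w`. -/

section Chart

variable {E : Type*} [NormedAddCommGroup E] [NormedSpace ℝ E] {ι : Type*} [Fintype ι]
  [DecidableEq ι]

/-- The matrix of the metric at `x` in the basis `b`. -/
noncomputable def gram (b : Module.Basis ι ℝ E) (g : E → E → E → ℝ) (x : E) : Matrix ι ι ℝ :=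
  Matrix.of fun i j => g x (b i) (b j)

/-- The Christoffel term of the Levi-Civita connection: the value at `x` of `∇_v w` for the
vector fields with constant coordinates `v` and `w` (Koszul formula). -/
noncomputable def christoffel (b : Module.Basis ι ℝ E) (g : E → E → E → ℝ) (x v w : E) : E :=
  ∑ k, (∑ l, (gram b g x)⁻¹ k l *
    ((fderiv ℝ (fun y => g y w (b l)) x v + fderiv ℝ (fun y => g y v (b l)) x w
      - fderiv ℝ (fun y => g y v w) x (b l)) / 2)) • b k

/-- The covariant derivative `∇_v V` at `x`. -/
noncomputable def covDeriv (b : Module.Basis ι ℝ E) (g : E → E → E → ℝ) (V : E → E)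
    (x v : E) : E :=
  fderiv ℝ V x v + christoffel b g x v (V x)

/-- The gradient of a function. -/
noncomputable def grad (b : Module.Basis ι ℝ E) (g : E → E → E → ℝ) (u : E → ℝ) (x : E) : E :=
  ∑ k, (∑ l, (gram b g x)⁻¹ k l * fderiv ℝ u x (b l)) • b k

/-- The Laplace-Beltrami operator: the trace of the Hessian `v ↦ ∇_v grad u`. -/
noncomputable def laplacian (b : Module.Basis ι ℝ E) (g : E → E → E → ℝ) (u : E → ℝ)
    (x : E) : ℝ :=
  ∑ i, b.repr (covDeriv b g (grad b g u) x (b i)) i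

variable {E' : Type*} [NormedAddCommGroup E'] [NormedSpace ℝ E'] {κ : Type*} [Fintype κ]
  [DecidableEq κ]

/-- The second covariant derivative of a map `F` between pseudo-Riemannian manifolds:
`∇²F(v, w) = ∇_{dF(v)} dF(w) - dF(∇_v w)`, for `v` and `w` with constant coordinates. -/
noncomputable def secondCovDeriv (b : Module.Basis ι ℝ E) (g : E → E → E → ℝ)
    (b' : Module.Basis κ ℝ E') (g' : E' → E' → E' → ℝ) (F : E → E') (x v w : E) : E' :=
  fderiv ℝ (fun y => fderiv ℝ F y w) x v
    + christoffel b' g' (F x) (fderiv ℝ F x v) (fderiv ℝ F x w)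
    - fderiv ℝ F x (christoffel b g x v w)

/-- The tension field: the trace of `∇²F` with respect to the metric of the source. -/
noncomputable def tension (b : Module.Basis ι ℝ E) (g : E → E → E → ℝ)
    (b' : Module.Basis κ ℝ E') (g' : E' → E' → E' → ℝ) (F : E → E') (x : E) : E' :=
  ∑ i, ∑ j, (gram b g x)⁻¹ i j • secondCovDeriv b g b' g' F x (b i) (b j)

end Chart

/-! ### The hyperbolic plane (Poincaré disk) and its tangent bundle

The hyperbolic plane is the unit disk of `ℂ`; the complex structure `J` is multiplication
by `Complex.I`. Functions and vector fields on it are total functions on `ℂ`, of which only the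
values on the disk matter. Its tangent bundle is `disk × ℂ`. -/

/-- The open unit disk. -/
def disk : Set ℂ := Metric.ball 0 1

/-- The hyperbolic metric `4 |dz|² / (1 - |z|²)²`. -/
noncomputable def hyp (z v w : ℂ) : ℝ := 4 / (1 - ‖z‖ ^ 2) ^ 2 * inner ℝ v w

/-- The vertical part of a tangent vector `ξ` of the tangent bundle at `p`, in the splitting
given by the Levi-Civita connection; the horizontal part is (the lift of) `ξ.1`. -/
noncomputable def vert (p ξ : ℂ × ℂ) : ℂ :=
  ξ.2 + christoffel Complex.basisOneI hyp p.1 ξ.1 p.2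

/-- The metric of signature `(2,2)` on the tangent bundle. -/
noncomputable def bigG (p ξ ζ : ℂ × ℂ) : ℝ :=
  hyp p.1 ξ.1 (vert p ζ) + hyp p.1 (vert p ξ) ζ.1

/-- The symplectic form on the tangent bundle. -/
noncomputable def bigOmega (p ξ ζ : ℂ × ℂ) : ℝ :=
  hyp p.1 (Complex.I * ξ.1) (vert p ζ) - hyp p.1 (vert p ξ) (Complex.I * ζ.1)

/-- A smooth vector field that is a harmonic map into the tangent bundle and whose image is
Lagrangian. -/
def IsHarmonicLagrangian (V : ℂ → ℂ) : Prop :=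
  ContDiffOn ℝ ∞ V disk ∧
  (∀ z ∈ disk, tension Complex.basisOneI hyp
    (Complex.basisOneI.prod Complex.basisOneI) bigG (fun y => (y, V y)) z = 0) ∧
  (∀ z ∈ disk, ∀ v w : ℂ, bigOmega (z, V z)
    (fderiv ℝ (fun y => (y, V y)) z v) (fderiv ℝ (fun y => (y, V y)) z w) = 0)

/-- The tensor `∂̄V(Y) = (∇_Y V + J ∇_{JY} V) / 2`. -/
noncomputable def dbar (V : ℂ → ℂ) (z Y : ℂ) : ℂ :=
  (1 / 2 : ℂ) * (covDeriv Complex.basisOneI hyp V z Y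
    + Complex.I * covDeriv Complex.basisOneI hyp V z (Complex.I * Y))

/-- The supremum over the disk of the operator norms, for the hyperbolic metric, of `∂̄V`. -/
noncomputable def dbarNorm (V : ℂ → ℂ) : ℝ≥0∞ :=
  ⨆ z ∈ disk, ⨆ (Y : ℂ) (_ : Y ≠ 0),
    ENNReal.ofReal (√(hyp z (dbar V z Y) (dbar V z Y)) / √(hyp z Y Y))

/-! ### Boundary behaviour -/

/-- The isometry from the Poincaré disk model to the Klein disk model. -/
noncomputable def toKlein (z : ℂ) : ℂ := ((2 / (1 + ‖z‖ ^ 2) : ℝ) : ℂ) * z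

/-- The isometry from the Klein disk model to the Poincaré disk model. -/
noncomputable def ofKlein (η : ℂ) : ℂ := ((1 / (1 + √(1 - ‖η‖ ^ 2)) : ℝ) : ℂ) * η

/-- The two disk models of the hyperbolic plane that are bounded by the circle at infinity. -/
inductive DiskModel
  | klein
  | poincare

/-- The expression of a vector field of the hyperbolic plane in a disk model. -/
noncomputable def DiskModel.express : DiskModel → (ℂ → ℂ) → ℂ → ℂ
  | .klein, V => fun η => fderiv ℝ toKlein (ofKlein η) (V (ofKlein η))
  | .poincare, V => V

/-- `V`, written in the model `m`, extends continuously to `X` on the circle. -/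
def ExtendsTo (m : DiskModel) (V : ℂ → ℂ) (X : Circle → ℂ) : Prop :=
  ∀ ζ : Circle, Tendsto (m.express V) (𝓝[disk] (ζ : ℂ)) (𝓝 (X ζ))

/-! ### Vector fields on the circle -/

/-- `X` is tangent to the circle. -/
def IsTangent (X : Circle → ℂ) : Prop := ∀ z : Circle, inner ℝ (z : ℂ) (X z) = 0

/-- The support function: `X z = i z φ(z)`. -/
noncomputable def supportFun (X : Circle → ℂ) (z : Circle) : ℝ :=
  (X z / (Complex.I * z)).re

/-- The points `a, b, c, d` of the circle are in counter-clockwise order. -/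
def IsCCW (a b c d : Circle) : Prop :=
  ∃ α β γ δ : ℝ, α < β ∧ β < γ ∧ γ < δ ∧ δ < α + 2 * Real.pi ∧
    a = Circle.exp α ∧ b = Circle.exp β ∧ c = Circle.exp γ ∧ d = Circle.exp δ

noncomputable def crossRatio (a b c d : ℂ) : ℂ := ((b - a) * (d - c)) / ((c - b) * (d - a))

/-- The quantity `X[a, b, c, d]`. -/
noncomputable def distortion (X : Circle → ℂ) (a b c d : Circle) : ℂ :=
  (X b - X a) / ((b : ℂ) - a) - (X c - X b) / ((c : ℂ) - b)
    + (X d - X c) / ((d : ℂ) - c) - (X a - X d) / ((a : ℂ) - d)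

/-- The cross-ratio distortion norm. -/
noncomputable def crNorm (X : Circle → ℂ) : ℝ≥0∞ :=
  ⨆ (a : Circle) (b : Circle) (c : Circle) (d : Circle) (_ : IsCCW a b c d)
    (_ : crossRatio a b c d = 1), ENNReal.ofReal ‖distortion X a b c d‖

/-- A continuous vector field on the circle is Zygmund if its cross-ratio distortion norm is
finite. -/
def IsZygmund (X : Circle → ℂ) : Prop := Continuous X ∧ crNorm X < ⊤

/-! ### Width -/

/-- The lower boundary of the convex hull of the graph of `φ`. -/
noncomputable def lowerHull (φ : Circle → ℝ) (η : ℂ) : ℝ :=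
  sSup {t | ∃ a : ℂ →ᵃ[ℝ] ℝ, (∀ ζ : Circle, a ζ ≤ φ ζ) ∧ t = a η}

/-- The upper boundary of the convex hull of the graph of `φ`. -/
noncomputable def upperHull (φ : Circle → ℝ) (η : ℂ) : ℝ :=
  sInf {t | ∃ a : ℂ →ᵃ[ℝ] ℝ, (∀ ζ : Circle, φ ζ ≤ a ζ) ∧ t = a η}

/-- The width of a vector field on the circle; `η` ranges over the Klein disk. -/
noncomputable def width (X : Circle → ℂ) : ℝ≥0∞ :=
  ⨆ η ∈ disk, ENNReal.ofReal
    ((upperHull (supportFun X) η - lowerHull (supportFun X) η) / √(1 - ‖η‖ ^ 2))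

/-! ### Mean surfaces and the extension `HL` -/

/-- For a function `u` on the hyperbolic plane, `ubar u η = √(1 - |η|²) u` in the Klein model. -/
noncomputable def ubar (u : ℂ → ℝ) (η : ℂ) : ℝ := √(1 - ‖η‖ ^ 2) * u (ofKlein η)

/-- The graph of `u` is a mean surface with boundary at infinity the graph of `φ`. -/
def IsMeanGraph (φ : Circle → ℝ) (u : ℂ → ℝ) : Prop :=
  ContDiffOn ℝ ∞ u disk ∧
  (∀ z ∈ disk, laplacian Complex.basisOneI hyp u z - 2 * u z = 0) ∧
  (∀ ζ : Circle, Tendsto (ubar u) (𝓝[disk] (ζ : ℂ)) (𝓝 (φ ζ)))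

/-- The function whose graph is the mean surface with boundary at infinity the graph of `φ`. -/
noncomputable def meanFun (φ : Circle → ℝ) : ℂ → ℝ := Classical.epsilon (IsMeanGraph φ)

/-- The vector field `HL(X) = J grad u`, with `u` the mean surface bounded by the support function
of `X`. -/
noncomputable def HL (X : Circle → ℂ) (z : ℂ) : ℂ :=
  Complex.I * grad Complex.basisOneI hyp (meanFun (supportFun X)) z

end HarmLag

/-! Everything is computed in the Poincaré disk with Wirtinger derivatives; write D = 1 - |z|². The
operator norm of ∂̄V is |∂V/∂z̄|. A section V is Lagrangian when Q = ∂V/∂z + 2z̄V/D is purely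
imaginary, and harmonic when ∂²V/∂z∂z̄ + (2z̄/D) ∂V/∂z̄ = 0. These two conditions say exactly that V
= J grad u with Δu = 2u, where u = Im Q (`IsHarmonicLagrangian.exists_isSol`,
`IsSol.isHarmonicLagrangian`).

The Poisson kernel for Δu = 2u is D²/|ζ - z|⁴ (`isSol_pois`, `tendsto_pois`). Uniqueness is a
maximum principle for D·u (`IsSol.nonpos`). The boundary values of J grad u control the radial
derivative of u, and integrating it leads back to this principle (`IsHarmonicLagrangian.eqOn_HL`).

Affine functions on the Klein disk correspond to solutions for which J grad u is a Killing field, so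
∂̄ does not see them (`dzb_grad_ell`). Both inequalities rest on this. For a boundary function φ ≥
0, the kernel gives |∂̄| ≤ 3 `pois φ`; applied to φ minus an affine minorant and to an affine
majorant minus φ, this bounds ∂̄ by the width (`dbarNorm_HL_le`). Conversely, if |∂̄| ≤ c, the
affine solution tangent to u + c at a point stays above u + c, because along geodesics the
difference satisfies y'' ≤ y with zero initial data (`IsSol.exists_ell_ge`); doing this also for -φ
gives width at most 2c (`width_le`).

For the Zygmund condition, one point of the quadruple is sent to infinity by a Cayley
parametrization. Cross-ratio 1 then means three equally spaced points, and the distortion becomes a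
second difference quotient. It is compared with the width by crossing two chords
(`secondDiff_lineFun_le`) and, conversely, by approximating with affine functions at each scale
(`hull_gap_le`). -/

namespace HarmLag

open ComplexConjugate

/-! ### Wirtinger calculus -/

section Wirtinger

/-- The real-linear map `v ↦ a v + b v̄`. -/
noncomputable def wirt (a b : ℂ) : ℂ →L[ℝ] ℂ :=
  a • ContinuousLinearMap.id ℝ ℂ + b • (Complex.conjCLE : ℂ →L[ℝ] ℂ)

@[simp] theorem wirt_apply (a b v : ℂ) : wirt a b v = a * v + b * conj v := by
  simp [wirt]

theorem wirt_ext {L : ℂ →L[ℝ] ℂ} {a b : ℂ} (h1 : L 1 = a + b)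
    (hI : L Complex.I = (a - b) * Complex.I) : L = wirt a b := by
  ext v
  have hv : v = v.re • (1 : ℂ) + v.im • Complex.I := by
    apply Complex.ext <;> simp
  have h := congrArg L hv
  rw [map_add, map_smul, map_smul, h1, hI] at h
  rw [h, wirt_apply]
  apply Complex.ext <;> simp <;> ring

/-- The function `f` is real-differentiable at `z` with Wirtinger derivatives `a` and `b`. -/
def HasWirt (f : ℂ → ℂ) (a b z : ℂ) : Prop := HasFDerivAt f (wirt a b) z

/-- The Wirtinger derivative `∂f/∂z`. -/
noncomputable def dz (f : ℂ → ℂ) (z : ℂ) : ℂ :=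
  (fderiv ℝ f z 1 - Complex.I * fderiv ℝ f z Complex.I) / 2

/-- The Wirtinger derivative `∂f/∂z̄`. -/
noncomputable def dzb (f : ℂ → ℂ) (z : ℂ) : ℂ :=
  (fderiv ℝ f z 1 + Complex.I * fderiv ℝ f z Complex.I) / 2

variable {f g : ℂ → ℂ} {a b a' b' z c : ℂ}

theorem fderiv_eq_wirt (f : ℂ → ℂ) (z : ℂ) : fderiv ℝ f z = wirt (dz f z) (dzb f z) := by
  apply wirt_ext
  · simp only [dz, dzb]; ring
  · simp only [dz, dzb]
    linear_combination (fderiv ℝ f z Complex.I) * Complex.I_sq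

theorem fderiv_apply_wirt (f : ℂ → ℂ) (z v : ℂ) :
    fderiv ℝ f z v = dz f z * v + dzb f z * conj v := by
  rw [fderiv_eq_wirt, wirt_apply]

theorem DifferentiableAt.hasWirt (h : DifferentiableAt ℝ f z) :
    HasWirt f (dz f z) (dzb f z) z := by
  rw [HasWirt, ← fderiv_eq_wirt]; exact h.hasFDerivAt

theorem HasWirt.dz_eq (h : HasWirt f a b z) : dz f z = a := by
  rw [dz, HasFDerivAt.fderiv h]; simp
  linear_combination (-(a - b) / 2) * Complex.I_sq

theorem HasWirt.dzb_eq (h : HasWirt f a b z) : dzb f z = b := by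
  rw [dzb, HasFDerivAt.fderiv h]; simp
  linear_combination ((a - b) / 2) * Complex.I_sq

theorem HasWirt.congr_of_eventuallyEq (h : HasWirt f a b z) (e : g =ᶠ[𝓝 z] f) :
    HasWirt g a b z := HasFDerivAt.congr_of_eventuallyEq h e

theorem HasWirt.congr_coeff (h : HasWirt f a b z) (ha : a = a') (hb : b = b') :
    HasWirt f a' b' z := by rwa [← ha, ← hb]

theorem hasWirt_const (c z : ℂ) : HasWirt (fun _ => c) 0 0 z := by
  have : wirt 0 0 = 0 := by ext v; simp
  rw [HasWirt, this]; exact hasFDerivAt_const c z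

theorem _root_.HasDerivAt.hasWirt (h : HasDerivAt f a z) : HasWirt f a 0 z := by
  have h2 := h.hasFDerivAt.restrictScalars ℝ
  have : (ContinuousLinearMap.toSpanSingleton ℂ a).restrictScalars ℝ = wirt a 0 := by
    ext v; simp [mul_comm]
  exact h2.congr_fderiv this

theorem hasWirt_id (z : ℂ) : HasWirt (fun w => w) 1 0 z := (hasDerivAt_id z).hasWirt

theorem HasWirt.conj (h : HasWirt f a b z) :
    HasWirt (fun w => conj (f w)) (conj b) (conj a) z := by
  have h2 := (Complex.conjCLE : ℂ →L[ℝ] ℂ).hasFDerivAt.comp z h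
  refine h2.congr_fderiv ?_
  ext v; simp [add_comm]

theorem hasWirt_conj (z : ℂ) : HasWirt (fun w => starRingEnd ℂ w) 0 1 z :=
  (hasWirt_id z).conj.congr_coeff (by simp) (by simp)

theorem HasWirt.add (hf : HasWirt f a b z) (hg : HasWirt g a' b' z) :
    HasWirt (fun w => f w + g w) (a + a') (b + b') z := by
  refine (HasFDerivAt.add hf hg).congr_fderiv ?_
  ext v; simp; ring

theorem HasWirt.sub (hf : HasWirt f a b z) (hg : HasWirt g a' b' z) :
    HasWirt (fun w => f w - g w) (a - a') (b - b') z := by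
  refine (HasFDerivAt.sub hf hg).congr_fderiv ?_
  ext v; simp; ring

theorem HasWirt.mul (hf : HasWirt f a b z) (hg : HasWirt g a' b' z) :
    HasWirt (fun w => f w * g w) (a * g z + f z * a') (b * g z + f z * b') z := by
  refine (HasFDerivAt.mul hf hg).congr_fderiv ?_
  ext v; simp; ring

theorem HasWirt.const_mul (c : ℂ) (hf : HasWirt f a b z) :
    HasWirt (fun w => c * f w) (c * a) (c * b) z :=
  ((hasWirt_const c z).mul hf).congr_coeff (by ring) (by ring)

theorem HasWirt.inv (hf : HasWirt f a b z) (h0 : f z ≠ 0) :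
    HasWirt (fun w => (f w)⁻¹) (-a / f z ^ 2) (-b / f z ^ 2) z := by
  have h := HasFDerivAt.comp z (hasDerivAt_inv h0).hasWirt hf
  refine h.congr_fderiv ?_
  ext v; simp; field_simp; ring

theorem HasWirt.pow_two (hf : HasWirt f a b z) :
    HasWirt (fun w => f w ^ 2) (2 * f z * a) (2 * f z * b) z := by
  simp only [sq]
  exact (hf.mul hf).congr_coeff (by ring) (by ring)

theorem HasWirt.comp_hasDerivAt {γ : ℝ → ℂ} {γ' : ℂ} {t : ℝ} (hf : HasWirt f a b (γ t))
    (hγ : HasDerivAt γ γ' t) : HasDerivAt (fun s => f (γ s)) (a * γ' + b * conj γ') t := by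
  have h := HasFDerivAt.comp_hasDerivAt t hf hγ
  rwa [wirt_apply] at h

theorem HasWirt.differentiableAt (hf : HasWirt f a b z) : DifferentiableAt ℝ f z :=
  HasFDerivAt.differentiableAt hf

end Wirtinger

/-! ### The disk -/

theorem isOpen_disk : IsOpen disk := Metric.isOpen_ball

theorem mem_disk {z : ℂ} : z ∈ disk ↔ ‖z‖ < 1 := by simp [disk]

theorem disk_mem_nhds {z : ℂ} (hz : z ∈ disk) : disk ∈ 𝓝 z := isOpen_disk.mem_nhds hz

/-- The function `1 - |z|²`, with complex values. -/
noncomputable def defect (z : ℂ) : ℂ := 1 - z * conj z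

theorem defect_eq (z : ℂ) : defect z = ((1 - ‖z‖ ^ 2 : ℝ) : ℂ) := by
  rw [defect, Complex.mul_conj']; push_cast; ring

theorem one_sub_sq_pos {z : ℂ} (hz : z ∈ disk) : 0 < 1 - ‖z‖ ^ 2 := by
  have := mem_disk.1 hz
  nlinarith [norm_nonneg z]

theorem defect_ne_zero {z : ℂ} (hz : z ∈ disk) : defect z ≠ 0 := by
  rw [defect_eq]; exact_mod_cast (one_sub_sq_pos hz).ne'

@[simp] theorem conj_defect (z : ℂ) : conj (defect z) = defect z := by
  rw [defect_eq, Complex.conj_ofReal]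

theorem hasWirt_defect (z : ℂ) : HasWirt defect (-conj z) (-z) z :=
  ((hasWirt_const 1 z).sub ((hasWirt_id z).mul (hasWirt_conj z))).congr_coeff
    (by simp) (by simp)

/-! ### Second Wirtinger derivatives and real-valued functions on the disk. -/

section SmoothOn

variable {f : ℂ → ℂ} {u : ℂ → ℝ} {z : ℂ}

theorem contDiffAt_of_disk {E : Type*} [NormedAddCommGroup E] [NormedSpace ℝ E] {f : ℂ → E}
    (h : ContDiffOn ℝ ∞ f disk) (hz : z ∈ disk) : ContDiffAt ℝ ∞ f z :=
  h.contDiffAt (disk_mem_nhds hz)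

theorem differentiableAt_of_disk {E : Type*} [NormedAddCommGroup E] [NormedSpace ℝ E]
    {f : ℂ → E} (h : ContDiffOn ℝ ∞ f disk) (hz : z ∈ disk) : DifferentiableAt ℝ f z :=
  (contDiffAt_of_disk h hz).differentiableAt (by simp)

theorem contDiffOn_fderiv_disk {E : Type*} [NormedAddCommGroup E] [NormedSpace ℝ E]
    {f : ℂ → E} (h : ContDiffOn ℝ ∞ f disk) : ContDiffOn ℝ ∞ (fderiv ℝ f) disk :=
  h.fderiv_of_isOpen isOpen_disk (by simp)

theorem contDiffOn_dz (h : ContDiffOn ℝ ∞ f disk) : ContDiffOn ℝ ∞ (dz f) disk := by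
  have h' := contDiffOn_fderiv_disk h
  have h1 := h'.clm_apply (contDiffOn_const (c := (1 : ℂ)))
  have h2 := h'.clm_apply (contDiffOn_const (c := Complex.I))
  exact (h1.sub (contDiffOn_const.mul h2)).div_const 2

theorem contDiffOn_dzb (h : ContDiffOn ℝ ∞ f disk) : ContDiffOn ℝ ∞ (dzb f) disk := by
  have h' := contDiffOn_fderiv_disk h
  have h1 := h'.clm_apply (contDiffOn_const (c := (1 : ℂ)))
  have h2 := h'.clm_apply (contDiffOn_const (c := Complex.I))
  exact (h1.add (contDiffOn_const.mul h2)).div_const 2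

theorem hasWirt_of_disk (h : ContDiffOn ℝ ∞ f disk) (hz : z ∈ disk) :
    HasWirt f (dz f z) (dzb f z) z := DifferentiableAt.hasWirt (differentiableAt_of_disk h hz)

/-- The cross terms cancel by symmetry of the second derivative; a quarter of the Euclidean
Laplacian remains. -/
theorem dz_dzb_eq (h : ContDiffOn ℝ ∞ f disk) (hz : z ∈ disk) :
    dz (dzb f) z = (fderiv ℝ (fderiv ℝ f) z 1 1
      + fderiv ℝ (fderiv ℝ f) z Complex.I Complex.I) / 4 ∧
    dzb (dz f) z = (fderiv ℝ (fderiv ℝ f) z 1 1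
      + fderiv ℝ (fderiv ℝ f) z Complex.I Complex.I) / 4 := by
  have h' := differentiableAt_of_disk (contDiffOn_fderiv_disk h) hz
  have hs : fderiv ℝ (fderiv ℝ f) z 1 Complex.I = fderiv ℝ (fderiv ℝ f) z Complex.I 1 :=
    ((contDiffAt_of_disk h hz).isSymmSndFDerivAt
      (by rw [minSmoothness_of_isRCLikeNormedField]; exact ENat.LEInfty.out)).eq 1 Complex.I
  have h1 := h'.hasFDerivAt.clm_apply (hasFDerivAt_const (1 : ℂ) z)
  have h2 := h'.hasFDerivAt.clm_apply (hasFDerivAt_const Complex.I z)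
  have ha : fderiv ℝ (dzb f) z = _ := ((h1.add (h2.const_mul Complex.I)).mul_const (2⁻¹ : ℂ)).fderiv
  have hb : fderiv ℝ (dz f) z = _ := ((h1.sub (h2.const_mul Complex.I)).mul_const (2⁻¹ : ℂ)).fderiv
  rw [dz, dzb, ha, hb]
  simp [hs]
  constructor
  · linear_combination (-fderiv ℝ (fderiv ℝ f) z Complex.I Complex.I / 4) * Complex.I_sq
  · linear_combination (-fderiv ℝ (fderiv ℝ f) z Complex.I Complex.I / 4) * Complex.I_sq

theorem dz_dzb_comm (h : ContDiffOn ℝ ∞ f disk) (hz : z ∈ disk) :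
    dz (dzb f) z = dzb (dz f) z := by
  rw [(dz_dzb_eq h hz).1, (dz_dzb_eq h hz).2]

/-- A real function on the plane, seen as a complex one. -/
noncomputable def cx (u : ℂ → ℝ) (z : ℂ) : ℂ := (u z : ℂ)

theorem contDiffOn_cx (h : ContDiffOn ℝ ∞ u disk) : ContDiffOn ℝ ∞ (cx u) disk :=
  Complex.ofRealCLM.contDiff.comp_contDiffOn h

theorem fderiv_cx (h : DifferentiableAt ℝ u z) (v : ℂ) :
    fderiv ℝ (cx u) z v = (fderiv ℝ u z v : ℂ) := by
  have := Complex.ofRealCLM.hasFDerivAt.comp z h.hasFDerivAt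
  have h2 : fderiv ℝ (cx u) z = _ := this.fderiv
  rw [h2]; simp

theorem conj_dzb_cx (h : DifferentiableAt ℝ u z) : conj (dzb (cx u) z) = dz (cx u) z := by
  simp only [dz, dzb, fderiv_cx h]
  simp only [map_div₀, map_add, map_mul, Complex.conj_ofReal, Complex.conj_I, map_ofNat]
  ring

theorem conj_dz_cx (h : DifferentiableAt ℝ u z) : conj (dz (cx u) z) = dzb (cx u) z := by
  rw [← conj_dzb_cx h, Complex.conj_conj]

theorem fderiv_real_apply (h : DifferentiableAt ℝ u z) (v : ℂ) :
    fderiv ℝ u z v = 2 * (dzb (cx u) z * conj v).re := by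
  have h1 := congrArg Complex.re (fderiv_apply_wirt (cx u) z v)
  rw [fderiv_cx h, ← conj_dzb_cx h] at h1
  simp at h1 ⊢; linarith

end SmoothOn


/-! ### The connection, gradient and Laplacian of the hyperbolic plane -/

/-- Lets a guessed Christoffel term be checked against the Koszul formula without inverting the Gram
matrix. -/
theorem christoffel_eq_of_gram {E : Type*} [NormedAddCommGroup E] [NormedSpace ℝ E] {ι : Type*}
    [Fintype ι] [DecidableEq ι] (b : Module.Basis ι ℝ E) (g : E → E → E → ℝ) (x v w C : E)
    (hdet : IsUnit (gram b g x).det)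
    (h : ∀ l, ∑ k, gram b g x l k * b.repr C k =
      (fderiv ℝ (fun y => g y w (b l)) x v + fderiv ℝ (fun y => g y v (b l)) x w
      - fderiv ℝ (fun y => g y v w) x (b l)) / 2) :
    christoffel b g x v w = C := by
  have h1 : (gram b g x).mulVec (b.repr C) = fun l =>
      (fderiv ℝ (fun y => g y w (b l)) x v + fderiv ℝ (fun y => g y v (b l)) x w
      - fderiv ℝ (fun y => g y v w) x (b l)) / 2 := funext h
  have h2 : (gram b g x)⁻¹.mulVec ((gram b g x).mulVec (b.repr C)) = b.repr C := by
    rw [Matrix.mulVec_mulVec, Matrix.nonsing_inv_mul _ hdet, Matrix.one_mulVec]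
  rw [h1] at h2
  conv_rhs => rw [← b.sum_repr C, ← h2]
  rfl

theorem hasFDerivAt_conf {z : ℂ} (hz : z ∈ disk) :
    HasFDerivAt (fun y : ℂ => 4 / (1 - ‖y‖ ^ 2) ^ 2)
      ((16 / (1 - ‖z‖ ^ 2) ^ 3) • innerSL ℝ z) z := by
  have h0 := (one_sub_sq_pos hz).ne'
  have h1 := ((hasStrictFDerivAt_norm_sq z).hasFDerivAt.const_sub 1).pow 2
  have h2 := (hasDerivAt_inv (pow_ne_zero 2 h0)).comp_hasFDerivAt z h1
  refine (h2.const_mul (4 : ℝ)).congr_fderiv ?_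
  ext v; simp; field_simp; ring

theorem fderiv_hyp {z : ℂ} (hz : z ∈ disk) (v w x : ℂ) :
    fderiv ℝ (fun y => hyp y v w) z x =
      16 / (1 - ‖z‖ ^ 2) ^ 3 * inner ℝ z x * inner ℝ v w := by
  have := (hasFDerivAt_conf hz).mul_const (inner ℝ v w)
  have h2 : fderiv ℝ (fun y => hyp y v w) z = _ := this.fderiv
  rw [h2]; simp; ring

theorem gram_hyp (z : ℂ) : gram Complex.basisOneI hyp z =
    (4 / (1 - ‖z‖ ^ 2) ^ 2) • (1 : Matrix (Fin 2) (Fin 2) ℝ) := by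
  ext i j
  fin_cases i <;> fin_cases j <;> simp [gram, hyp]

theorem isUnit_det_gram_hyp {z : ℂ} (hz : z ∈ disk) :
    IsUnit (gram Complex.basisOneI hyp z).det := by
  rw [gram_hyp]
  have := (one_sub_sq_pos hz).ne'
  simp [this]

theorem inv_gram_hyp {z : ℂ} (hz : z ∈ disk) : (gram Complex.basisOneI hyp z)⁻¹ =
    ((1 - ‖z‖ ^ 2) ^ 2 / 4) • (1 : Matrix (Fin 2) (Fin 2) ℝ) := by
  have := (one_sub_sq_pos hz).ne'
  refine Matrix.inv_eq_right_inv ?_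
  rw [gram_hyp, Matrix.smul_mul, Matrix.one_mul, smul_smul]
  convert one_smul ℝ _
  field_simp

/-- For a conformal metric λ|dz|² the Christoffel term is (∂ log λ/∂z) v w, and here λ = 4/D². -/
theorem christoffel_hyp {z : ℂ} (hz : z ∈ disk) (v w : ℂ) :
    christoffel Complex.basisOneI hyp z v w = 2 * conj z * v * w / defect z := by
  have h0 := (one_sub_sq_pos hz).ne'
  apply christoffel_eq_of_gram _ _ _ _ _ _ (isUnit_det_gram_hyp hz)
  intro l
  simp only [fderiv_hyp hz, gram_hyp, defect_eq]
  simp only [Complex.inner, div_eq_mul_inv, ← inv_pow, ← Complex.ofReal_inv]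
  -- With the inverse of the defect as a free variable, the coordinates on both sides are
  -- polynomials.
  generalize (1 - ‖z‖ ^ 2)⁻¹ = s
  fin_cases l <;>
  · simp [Matrix.one_apply]
    ring

theorem covDeriv_hyp {z : ℂ} (hz : z ∈ disk) (V : ℂ → ℂ) (v : ℂ) :
    covDeriv Complex.basisOneI hyp V z v =
      (dz V z + 2 * conj z * V z / defect z) * v + dzb V z * conj v := by
  rw [covDeriv, christoffel_hyp hz, fderiv_apply_wirt]; ring

theorem grad_hyp {u : ℂ → ℝ} {z : ℂ} (hu : DifferentiableAt ℝ u z) (hz : z ∈ disk) :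
    grad Complex.basisOneI hyp u z = defect z ^ 2 / 2 * dzb (cx u) z := by
  rw [grad, inv_gram_hyp hz, dzb, fderiv_cx hu, fderiv_cx hu, defect_eq]
  simp [Matrix.one_apply]
  ring

/-- The combination with J kills the complex-linear part of ∇V. The Christoffel term is
complex-linear, so the connection drops out. -/
theorem dbar_hyp {z : ℂ} (hz : z ∈ disk) (V : ℂ → ℂ) (Y : ℂ) :
    dbar V z Y = dzb V z * conj Y := by
  rw [dbar, covDeriv_hyp hz, covDeriv_hyp hz]
  simp only [map_mul, Complex.conj_I]
  linear_combination ((1 / 2 : ℂ) * ((dz V z + 2 * conj z * V z / defect z) * Y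
    - dzb V z * conj Y)) * Complex.I_sq

/-- ∂̄V multiplies all lengths by the same factor, and the conformal factor cancels in the quotient,
so every Y gives the same value. -/
theorem dbarNorm_eq (V : ℂ → ℂ) : dbarNorm V = ⨆ z ∈ disk, ENNReal.ofReal ‖dzb V z‖ := by
  rw [dbarNorm]
  refine iSup_congr fun z => iSup_congr fun hz => ?_
  have key : ∀ Y : ℂ, Y ≠ 0 →
      √(hyp z (dbar V z Y) (dbar V z Y)) / √(hyp z Y Y) = ‖dzb V z‖ := by
    intro Y hY
    have h0 := one_sub_sq_pos hz
    have hc : 0 < 4 / (1 - ‖z‖ ^ 2) ^ 2 := by positivity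
    have hY' : 0 < ‖Y‖ := norm_pos_iff.2 hY
    rw [hyp, hyp, real_inner_self_eq_norm_sq, real_inner_self_eq_norm_sq, dbar_hyp hz,
      Real.sqrt_mul hc.le, Real.sqrt_mul hc.le, Real.sqrt_sq (norm_nonneg _),
      Real.sqrt_sq (norm_nonneg _), norm_mul, Complex.norm_conj]
    have := (Real.sqrt_pos.2 hc).ne'
    field_simp
  apply le_antisymm
  · exact iSup₂_le fun Y hY => by rw [key Y hY]
  · refine le_iSup₂_of_le (1 : ℂ) one_ne_zero ?_
    rw [key 1 one_ne_zero]

theorem conj_dz_dzb_cx {u : ℂ → ℝ} {z : ℂ} (hu : ContDiffOn ℝ ∞ u disk) (hz : z ∈ disk) :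
    conj (dz (dzb (cx u)) z) = dz (dzb (cx u)) z := by
  have h1 := (hasWirt_of_disk (contDiffOn_dzb (contDiffOn_cx hu)) hz).conj
  have h2 : HasWirt (dz (cx u)) _ _ z := h1.congr_of_eventuallyEq
    (eventually_of_mem (disk_mem_nhds hz) fun w hw =>
      (conj_dzb_cx (differentiableAt_of_disk hu hw)).symm)
  rw [← h2.dzb_eq, ← dz_dzb_comm (contDiffOn_cx hu) hz]

theorem hasWirt_grad {u : ℂ → ℝ} {z : ℂ} (hu : ContDiffOn ℝ ∞ u disk) (hz : z ∈ disk) :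
    HasWirt (grad Complex.basisOneI hyp u)
      (defect z ^ 2 / 2 * dz (dzb (cx u)) z - defect z * conj z * dzb (cx u) z)
      (defect z ^ 2 / 2 * dzb (dzb (cx u)) z - defect z * z * dzb (cx u) z) z := by
  have h1 := hasWirt_of_disk (contDiffOn_dzb (contDiffOn_cx hu)) hz
  have h2 := ((hasWirt_defect z).pow_two.const_mul (1 / 2)).mul h1
  refine (h2.congr_of_eventuallyEq (eventually_of_mem (disk_mem_nhds hz) fun w hw => ?_)).congr_coeff
    ?_ ?_
  · simp only
    rw [grad_hyp (differentiableAt_of_disk hu hw) hw]; ring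
  · ring
  · ring

theorem laplacian_hyp {u : ℂ → ℝ} {z : ℂ} (hu : ContDiffOn ℝ ∞ u disk) (hz : z ∈ disk) :
    (laplacian Complex.basisOneI hyp u z : ℂ) = defect z ^ 2 * dz (dzb (cx u)) z := by
  have hD := defect_ne_zero hz
  -- The real trace of v ↦ a v + b v̄ is 2 Re a.
  have h1 : laplacian Complex.basisOneI hyp u z =
      2 * (dz (grad Complex.basisOneI hyp u) z
        + 2 * conj z * grad Complex.basisOneI hyp u z / defect z).re := by
    rw [laplacian]
    simp only [Fin.sum_univ_two, covDeriv_hyp hz, Complex.coe_basisOneI_repr,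
      Complex.coe_basisOneI]
    simp
    ring
  have h2 : dz (grad Complex.basisOneI hyp u) z
        + 2 * conj z * grad Complex.basisOneI hyp u z / defect z =
        defect z ^ 2 / 2 * dz (dzb (cx u)) z := by
    rw [(hasWirt_grad hu hz).dz_eq, grad_hyp (differentiableAt_of_disk hu hz) hz]
    field_simp; ring
  have h3 : conj (defect z ^ 2 / 2 * dz (dzb (cx u)) z) =
      defect z ^ 2 / 2 * dz (dzb (cx u)) z := by
    rw [map_mul, conj_dz_dzb_cx hu hz]; simp [map_ofNat]
  rw [h1, h2]
  push_cast
  rw [Complex.conj_eq_iff_re.1 h3]; ring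

/-- Solutions of `Δu = 2u` on the hyperbolic plane. -/
def IsSol (u : ℂ → ℝ) : Prop :=
  ContDiffOn ℝ ∞ u disk ∧ ∀ z ∈ disk, dz (dzb (cx u)) z = 2 * u z / defect z ^ 2

theorem isMeanGraph_iff {φ : Circle → ℝ} {u : ℂ → ℝ} : IsMeanGraph φ u ↔
    IsSol u ∧ ∀ ζ : Circle, Tendsto (ubar u) (𝓝[disk] (ζ : ℂ)) (𝓝 (φ ζ)) := by
  rw [IsMeanGraph, IsSol, and_assoc]
  refine and_congr_right fun hu => and_congr_left fun _ => forall₂_congr fun z hz => ?_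
  have hD := defect_ne_zero hz
  rw [← Complex.ofReal_inj, Complex.ofReal_sub, laplacian_hyp hu hz]
  rw [eq_div_iff (pow_ne_zero 2 hD), sub_eq_iff_eq_add]
  push_cast
  rw [zero_add, mul_comm]

theorem disk_eqOn_eventuallyEq {E : Type*} {f g : ℂ → E} {z : ℂ} (h : EqOn f g disk)
    (hz : z ∈ disk) : f =ᶠ[𝓝 z] g := eventually_of_mem (disk_mem_nhds hz) h

theorem dzb_congr {f g : ℂ → ℂ} (h : EqOn f g disk) {z : ℂ} (hz : z ∈ disk) :
    dzb f z = dzb g z := by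
  rw [dzb, dzb, (disk_eqOn_eventuallyEq h hz).fderiv_eq]

theorem dz_congr {f g : ℂ → ℂ} (h : EqOn f g disk) {z : ℂ} (hz : z ∈ disk) :
    dz f z = dz g z := by
  rw [dz, dz, (disk_eqOn_eventuallyEq h hz).fderiv_eq]

theorem dbarNorm_congr {V W : ℂ → ℂ} (h : EqOn V W disk) : dbarNorm V = dbarNorm W := by
  rw [dbarNorm_eq, dbarNorm_eq]
  exact iSup_congr fun z => iSup_congr fun hz => by rw [dzb_congr h hz]

/-! ### The tangent bundle -/

/-- The two Christoffel contributions combine through ⟨v, cw⟩ + ⟨cv, w⟩ = 2 Re c ⟨v, w⟩. The last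
term is the derivative of the conformal factor in the direction `p.2`. -/
theorem bigG_eq {p : ℂ × ℂ} (hp : p.1 ∈ disk) (ξ ζ : ℂ × ℂ) : bigG p ξ ζ =
    4 / (1 - ‖p.1‖ ^ 2) ^ 2 * (inner ℝ ξ.1 ζ.2 + inner ℝ ξ.2 ζ.1)
      + 16 * inner ℝ p.1 p.2 / (1 - ‖p.1‖ ^ 2) ^ 3 * inner ℝ ξ.1 ζ.1 := by
  have h0 := (one_sub_sq_pos hp).ne'
  rw [bigG, vert, vert, christoffel_hyp hp, christoffel_hyp hp, hyp, hyp, defect_eq]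
  simp only [Complex.inner, div_eq_mul_inv, ← inv_pow, ← Complex.ofReal_inv]
  generalize (1 - ‖p.1‖ ^ 2)⁻¹ = s
  simp [map_ofNat]
  ring

theorem fderiv_bigG {p : ℂ × ℂ} (hp : p.1 ∈ disk) (ξ ζ v : ℂ × ℂ) :
    fderiv ℝ (fun q => bigG q ξ ζ) p v =
      16 / (1 - ‖p.1‖ ^ 2) ^ 3 * inner ℝ p.1 v.1 * (inner ℝ ξ.1 ζ.2 + inner ℝ ξ.2 ζ.1)
      + (16 * (inner ℝ v.1 p.2 + inner ℝ p.1 v.2) / (1 - ‖p.1‖ ^ 2) ^ 3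
        + 96 * inner ℝ p.1 p.2 * inner ℝ p.1 v.1 / (1 - ‖p.1‖ ^ 2) ^ 4) * inner ℝ ξ.1 ζ.1 := by
  have h0 := (one_sub_sq_pos hp).ne'
  have hev : (fun q => bigG q ξ ζ) =ᶠ[𝓝 p] fun q => 4 / (1 - ‖q.1‖ ^ 2) ^ 2 *
      (inner ℝ ξ.1 ζ.2 + inner ℝ ξ.2 ζ.1)
      + 16 * inner ℝ q.1 q.2 * ((1 - ‖q.1‖ ^ 2) ^ 3)⁻¹ * inner ℝ ξ.1 ζ.1 := by
    filter_upwards [continuous_fst.continuousAt.preimage_mem_nhds (disk_mem_nhds hp)] with q hq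
    rw [bigG_eq hq, div_eq_mul_inv (16 * inner ℝ q.1 q.2)]
  have hfst : HasFDerivAt (fun q : ℂ × ℂ => q.1) (ContinuousLinearMap.fst ℝ ℂ ℂ) p :=
    hasFDerivAt_fst
  have hsnd : HasFDerivAt (fun q : ℂ × ℂ => q.2) (ContinuousLinearMap.snd ℝ ℂ ℂ) p :=
    hasFDerivAt_snd
  have h1 := ((hasFDerivAt_conf hp).comp p hfst).mul_const (inner ℝ ξ.1 ζ.2 + inner ℝ ξ.2 ζ.1)
  have h2 := (hfst.inner ℝ hsnd).const_mul (16 : ℝ)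
  have h3 := (((hasStrictFDerivAt_norm_sq p.1).hasFDerivAt.comp p hfst).const_sub 1).pow 3
  have h4 := (hasDerivAt_inv (pow_ne_zero 3 h0)).comp_hasFDerivAt p h3
  have h5 := h1.add ((h2.mul h4).mul_const (inner ℝ ξ.1 ζ.1))
  have h6 := hev.fderiv_eq.trans h5.fderiv
  rw [h6]
  simp
  field_simp
  ring

theorem gram_bigG {p : ℂ × ℂ} (hp : p.1 ∈ disk) :
    gram (Complex.basisOneI.prod Complex.basisOneI) bigG p =
      Matrix.fromBlocks ((16 * inner ℝ p.1 p.2 / (1 - ‖p.1‖ ^ 2) ^ 3) • 1)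
        ((4 / (1 - ‖p.1‖ ^ 2) ^ 2) • 1) ((4 / (1 - ‖p.1‖ ^ 2) ^ 2) • 1)
        (0 : Matrix (Fin 2) (Fin 2) ℝ) := by
  ext i j
  rcases i with i | i <;> rcases j with j | j <;> fin_cases i <;> fin_cases j <;>
    simp [gram, bigG_eq hp]

theorem isUnit_det_gram_bigG {p : ℂ × ℂ} (hp : p.1 ∈ disk) :
    IsUnit (gram (Complex.basisOneI.prod Complex.basisOneI) bigG p).det := by
  have h0 := (one_sub_sq_pos hp).ne'
  rw [gram_bigG hp]
  have hl : (4 / (1 - ‖p.1‖ ^ 2) ^ 2) ≠ 0 := by positivity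
  generalize 4 / (1 - ‖p.1‖ ^ 2) ^ 2 = l at *
  generalize (16 * inner ℝ p.1 p.2 / (1 - ‖p.1‖ ^ 2) ^ 3) = m at *
  apply Matrix.isUnit_det_of_right_inverse
    -- The inverse of the block matrix with rows (m, l) and (l, 0).
    (B := Matrix.fromBlocks 0 (l⁻¹ • 1) (l⁻¹ • 1) ((-m / l ^ 2) • 1))
  rw [Matrix.fromBlocks_multiply, ← Matrix.fromBlocks_one]
  congr 1 <;> simp [smul_smul, hl, ← add_smul]
  field_simp; simp

/-- Differentiating the base term 2z̄x²/D at (z, x) in the direction (w, y) gives the second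
component. Equal arguments suffice, since the inverse Gram matrix of the disk is diagonal. -/
theorem christoffel_bigG {z w : ℂ} (hz : z ∈ disk) (x y : ℂ) :
    christoffel (Complex.basisOneI.prod Complex.basisOneI) bigG (z, w) (x, y) (x, y) =
      (2 * conj z * x ^ 2 / defect z, 4 * conj z * x * y / defect z
        + (2 * conj w / defect z + 4 * conj z * (inner ℝ z w : ℝ) / defect z ^ 2) * x ^ 2) := by
  have h0 := (one_sub_sq_pos hz).ne'
  have hp : ((z, w) : ℂ × ℂ).1 ∈ disk := hz
  apply christoffel_eq_of_gram _ _ _ _ _ _ (isUnit_det_gram_bigG hp)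
  intro l
  simp only [fderiv_bigG hp, gram_bigG hp, defect_eq, ← Complex.ofReal_pow]
  simp only [Complex.inner, div_eq_mul_inv, ← inv_pow, Complex.ofReal_pow, ← Complex.ofReal_inv]
  generalize (1 - ‖z‖ ^ 2)⁻¹ = s
  rcases l with l | l <;> fin_cases l <;>
  · simp [Matrix.one_apply, pow_two]
    ring


/-! ### Harmonic Lagrangian vector fields -/

section HarmonicLagrangian

variable {V : ℂ → ℂ} {z : ℂ}

theorem hasFDerivAt_section (hV : DifferentiableAt ℝ V z) :
    HasFDerivAt (fun y => (y, V y))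
      ((ContinuousLinearMap.id ℝ ℂ).prod (fderiv ℝ V z)) z :=
  (hasFDerivAt_id z).prodMk hV.hasFDerivAt

/-- The first component vanishes because a section projects to the identity, whose second covariant
derivative is zero. -/
theorem secondCovDeriv_section (hV : ContDiffOn ℝ ∞ V disk) (hz : z ∈ disk) (v : ℂ) :
    secondCovDeriv Complex.basisOneI hyp (Complex.basisOneI.prod Complex.basisOneI) bigG
      (fun y => (y, V y)) z v v =
    (0, fderiv ℝ (fderiv ℝ V) z v v + 4 * conj z * v * fderiv ℝ V z v / defect z
        + (2 * conj (V z) / defect z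
          + 4 * conj z * (inner ℝ z (V z) : ℝ) / defect z ^ 2) * v ^ 2
        - fderiv ℝ V z (2 * conj z * v ^ 2 / defect z)) := by
  have hd : ∀ y ∈ disk, ∀ w, fderiv ℝ (fun y => (y, V y)) y w = (w, fderiv ℝ V y w) := by
    intro y hy w
    rw [(hasFDerivAt_section (differentiableAt_of_disk hV hy)).fderiv]; simp
  have h1 : fderiv ℝ (fun y => fderiv ℝ (fun y => (y, V y)) y v) z v =
      (0, fderiv ℝ (fderiv ℝ V) z v v) := by
    have hev : (fun y => fderiv ℝ (fun y => (y, V y)) y v) =ᶠ[𝓝 z]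
        fun y => (v, fderiv ℝ V y v) :=
      eventually_of_mem (disk_mem_nhds hz) fun y hy => hd y hy v
    have h2 := (differentiableAt_of_disk (contDiffOn_fderiv_disk hV) hz).hasFDerivAt.clm_apply
      (hasFDerivAt_const v z)
    rw [hev.fderiv_eq, ((hasFDerivAt_const v z).prodMk h2).fderiv]
    simp
  rw [secondCovDeriv, h1, hd z hz, hd z hz, christoffel_bigG hz, christoffel_hyp hz]
  ext
  · simp; ring
  · simp only [Prod.mk_add_mk, Prod.mk_sub_mk]
    rw [show 2 * conj z * v * v / defect z = 2 * conj z * v ^ 2 / defect z by ring]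
    ring

/-- Terms proportional to v² cancel between v = 1 and v = i; the first-order terms assemble into
∂V/∂z̄ and the second-order ones into ∂²V/∂z∂z̄. -/
theorem tension_section (hV : ContDiffOn ℝ ∞ V disk) (hz : z ∈ disk) :
    tension Complex.basisOneI hyp (Complex.basisOneI.prod Complex.basisOneI) bigG
      (fun y => (y, V y)) z =
    (0, defect z ^ 2 * (dz (dzb V) z + 2 * conj z / defect z * dzb V z)) := by
  have hD := defect_ne_zero hz
  rw [tension, inv_gram_hyp hz]
  simp only [Fin.sum_univ_two, Complex.coe_basisOneI]
  simp only [Matrix.smul_apply, Matrix.one_apply_eq, Fin.isValue, Matrix.cons_val_zero,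
    Matrix.cons_val_one, ne_eq, one_ne_zero, zero_ne_one, not_false_eq_true, Matrix.one_apply_ne,
    smul_zero, zero_smul, add_zero, zero_add, secondCovDeriv_section hV hz,
    (dz_dzb_eq hV hz).1]
  have hI : fderiv ℝ V z (2 * conj z * Complex.I ^ 2 / defect z) =
      -fderiv ℝ V z (2 * conj z * 1 ^ 2 / defect z) := by
    rw [Complex.I_sq, ← map_neg]; congr 1; ring
  rw [hI, dzb]
  simp only [Prod.smul_mk, Prod.mk_add_mk, smul_zero, add_zero, Complex.real_smul, smul_eq_mul,
    mul_one, Complex.I_sq]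
  have hr : (((1 - ‖z‖ ^ 2) ^ 2 / 4 : ℝ) : ℂ) = defect z ^ 2 / 4 := by
    rw [defect_eq]; push_cast; ring
  simp only [Prod.mk.injEq, true_and]
  rw [hr]
  field_simp
  ring

/-- Writing ∇V(v) = a v + b v̄, the contributions of b cancel, leaving Re a, half the divergence of
V. -/
theorem bigOmega_section (hV : DifferentiableAt ℝ V z) (hz : z ∈ disk) (v w : ℂ) :
    bigOmega (z, V z) (fderiv ℝ (fun y => (y, V y)) z v) (fderiv ℝ (fun y => (y, V y)) z w) =
      -(8 / (1 - ‖z‖ ^ 2) ^ 2) * (dz V z + 2 * conj z * V z / defect z).re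
        * (v * conj w).im := by
  have hv : ∀ v, vert (z, V z) (fderiv ℝ (fun y => (y, V y)) z v) =
      (dz V z + 2 * conj z * V z / defect z) * v + dzb V z * conj v := by
    intro v
    rw [← covDeriv_hyp hz, vert, (hasFDerivAt_section hV).fderiv]
    simp [covDeriv]
  rw [bigOmega, hv, hv, (hasFDerivAt_section hV).fderiv]
  generalize dz V z + 2 * conj z * V z / defect z = a
  generalize dzb V z = b
  simp [hyp, Complex.inner]
  ring

theorem isHarmonicLagrangian_iff : IsHarmonicLagrangian V ↔ ContDiffOn ℝ ∞ V disk ∧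
    (∀ z ∈ disk, dz (dzb V) z + 2 * conj z / defect z * dzb V z = 0) ∧
    ∀ z ∈ disk, (dz V z + 2 * conj z * V z / defect z).re = 0 := by
  rw [IsHarmonicLagrangian]
  refine and_congr_right fun hV => and_congr ?_ ?_
  · refine forall₂_congr fun z hz => ?_
    rw [tension_section hV hz, Prod.mk_eq_zero]
    simp [defect_ne_zero hz]
  · refine forall₂_congr fun z hz => ?_
    simp only [bigOmega_section (differentiableAt_of_disk hV hz) hz]
    constructor
    · intro h
      have h0 := (one_sub_sq_pos hz).ne'
      -- For v = i and w = 1 the factor Im(v w̄) is 1.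
      simpa [h0] using h Complex.I 1
    · intro h v w; rw [h]; ring

theorem contDiff_defect : ContDiff ℝ ∞ defect :=
  contDiff_const.sub (contDiff_id.mul Complex.conjCLE.contDiff)

theorem contDiffOn_inv_defect : ContDiffOn ℝ ∞ (fun z => (defect z)⁻¹) disk :=
  contDiff_defect.contDiffOn.inv fun _ hz => defect_ne_zero hz

/-- A harmonic Lagrangian vector field is `J grad u` for a solution of `Δu = 2u`. -/
theorem IsHarmonicLagrangian.exists_isSol (h : IsHarmonicLagrangian V) :
    ∃ u, IsSol u ∧ ∀ z ∈ disk, V z = Complex.I * (defect z ^ 2 / 2 * dzb (cx u) z) := by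
  obtain ⟨hV, hharm, hlag⟩ := isHarmonicLagrangian_iff.1 h
  set Q : ℂ → ℂ := fun z => dz V z + 2 * conj z * V z / defect z with hQ
  -- If V = J grad u with Δu = 2u, the complex-linear part of ∇V is i Δu/2 = i u. This forces u = Im
  -- Q, and the Lagrangian condition says Q = i u.
  set u : ℂ → ℝ := fun z => (Q z).im with hu
  have hQs : ContDiffOn ℝ ∞ Q disk := by
    simp only [hQ, div_eq_mul_inv]
    exact (contDiffOn_dz hV).add (((contDiff_const.mul
      Complex.conjCLE.contDiff).contDiffOn.mul hV).mul contDiffOn_inv_defect)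
  have hus : ContDiffOn ℝ ∞ u disk := Complex.imCLM.contDiff.comp_contDiffOn hQs
  have hcx : EqOn (cx u) (fun z => -Complex.I * Q z) disk := by
    intro z hz
    apply Complex.ext
    · simp [cx, hu]
    · have h := hlag z hz
      change (Q z).re = 0 at h
      simp [cx, hu, h]
  have hdzb : EqOn (dzb (cx u)) (fun z => -2 * Complex.I * (V z * (defect z ^ 2)⁻¹)) disk := by
    intro z hz
    have hD := defect_ne_zero hz
    have hw := hasWirt_of_disk hV hz
    have h1 := (hasWirt_of_disk (contDiffOn_dz hV) hz).add ((((hasWirt_conj z).const_mul 2).mul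
      hw).mul ((hasWirt_defect z).inv hD))
    have h2 := (h1.const_mul (-Complex.I)).dzb_eq
    rw [dzb_congr hcx hz]
    simp only [hQ, div_eq_mul_inv]
    rw [h2, ← dz_dzb_comm hV hz]
    -- Harmonicity eliminates the second derivative of V. The terms in ∂V/∂z̄ then cancel and the
    -- coefficient of V sums to 2/D².
    have h3 := hharm z hz
    have h4 : z * conj z = 1 - defect z := by simp [defect]
    have h5 : dz (dzb V) z = -(2 * conj z / defect z * dzb V z) := by
      linear_combination h3
    rw [h5]
    field_simp
    linear_combination (-V z) * h4
  -- Differentiating -2iV/D² with respect to z reproduces -2iQ/D², which is 2u/D².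
  have hsol : ∀ z ∈ disk, dz (dzb (cx u)) z = 2 * u z / defect z ^ 2 := by
    intro z hz
    have hD := defect_ne_zero hz
    have hw := hasWirt_of_disk hV hz
    have h1 := ((hw.mul ((hasWirt_defect z).pow_two.inv (pow_ne_zero 2 hD))).const_mul
      (-2 * Complex.I)).dz_eq
    rw [dz_congr hdzb hz, h1, show (u z : ℂ) = -Complex.I * Q z from hcx hz]
    simp only [hQ]
    field_simp
  refine ⟨u, ⟨hus, hsol⟩, fun z hz => ?_⟩
  have hD := defect_ne_zero hz
  rw [hdzb hz]
  field_simp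
  linear_combination V z * Complex.I_sq

/-- The same computation backwards: Δu = 2u makes the complex-linear part of ∇V equal to i u. It is
imaginary, which is the Lagrangian condition, and its ∂/∂z̄ derivative is the harmonic map equation.
-/
theorem IsSol.isHarmonicLagrangian {u : ℂ → ℝ} (h : IsSol u) :
    IsHarmonicLagrangian fun z => Complex.I * grad Complex.basisOneI hyp u z := by
  obtain ⟨hu, hsol⟩ := h
  have hcu := contDiffOn_cx hu
  set V : ℂ → ℂ := fun z => Complex.I * grad Complex.basisOneI hyp u z with hVdef
  have hVeq : EqOn V (fun z => Complex.I * (defect z ^ 2 / 2 * dzb (cx u) z)) disk :=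
    fun z hz => by
      simp only [hVdef]; rw [grad_hyp (differentiableAt_of_disk hu hz) hz]
  have hV : ContDiffOn ℝ ∞ V disk :=
    (contDiffOn_const.mul ((((contDiff_defect.pow 2).div_const 2).contDiffOn).mul
      (contDiffOn_dzb hcu))).congr hVeq
  have hw : ∀ z ∈ disk, HasWirt V _ _ z := fun z hz => (hasWirt_grad hu hz).const_mul Complex.I
  have hdz : EqOn (dz V) (fun z => Complex.I * cx u z - 2 * conj z * V z * (defect z)⁻¹) disk := by
    intro z hz
    have hD := defect_ne_zero hz
    simp only [(hw z hz).dz_eq, hsol z hz, hVeq hz, cx]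
    field_simp
  refine isHarmonicLagrangian_iff.2 ⟨hV, fun z hz => ?_, fun z hz => ?_⟩
  · have hD := defect_ne_zero hz
    have h1 := (((hasWirt_of_disk hcu hz).const_mul Complex.I).sub ((((hasWirt_conj z).const_mul
      2).mul (hasWirt_of_disk hV hz)).mul ((hasWirt_defect z).inv hD))).dzb_eq
    have h4 : z * conj z = 1 - defect z := by simp [defect]
    rw [dz_dzb_comm hV hz, dzb_congr hdz hz, h1]
    simp only [hVeq hz]
    field_simp
    linear_combination (-dzb (cx u) z * Complex.I * defect z) * h4
  · have h := hdz hz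
    simp only at h
    rw [h, ← div_eq_mul_inv, sub_add_cancel]
    simp [cx]

end HarmonicLagrangian

open MeasureTheory

/-! ### Averages over the circle -/

/-- The normalized arc length, on the interval `(0, 2π]`. -/
noncomputable def circ : Measure ℝ :=
  (ENNReal.ofReal (2 * Real.pi))⁻¹ • volume.restrict (Ioc 0 (2 * Real.pi))

instance : IsProbabilityMeasure circ where
  measure_univ := by
    rw [circ, Measure.smul_apply, Measure.restrict_apply_univ, Real.volume_Ioc, sub_zero,
      smul_eq_mul, ENNReal.inv_mul_cancel (by simp [Real.pi_pos]) ENNReal.ofReal_ne_top]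

/-- The average of a function on the circle. -/
noncomputable def avg {E : Type*} [NormedAddCommGroup E] [NormedSpace ℝ E] (f : Circle → E) : E :=
  ∫ θ, f (Circle.exp θ) ∂circ

theorem integrable_circ {E : Type*} [NormedAddCommGroup E] {f : Circle → E} (hf : Continuous f) :
    Integrable (fun θ => f (Circle.exp θ)) circ := by
  obtain ⟨C, hC⟩ := (isCompact_range hf).isBounded.exists_norm_le
  exact Integrable.of_bound (hf.comp Circle.exp.continuous).aestronglyMeasurable C
    (Eventually.of_forall fun θ => hC _ (mem_range_self _))

section Avg

variable {E : Type*} [NormedAddCommGroup E] [NormedSpace ℝ E] {f g : Circle → E}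

theorem avg_add (hf : Continuous f) (hg : Continuous g) :
    avg (fun ζ => f ζ + g ζ) = avg f + avg g :=
  integral_add (integrable_circ hf) (integrable_circ hg)

theorem avg_sub (hf : Continuous f) (hg : Continuous g) :
    avg (fun ζ => f ζ - g ζ) = avg f - avg g :=
  integral_sub (integrable_circ hf) (integrable_circ hg)

theorem continuous_circle_coe : Continuous fun ζ : Circle => (ζ : ℂ) := by fun_prop

theorem avg_const (c : ℝ) : avg (fun _ => c) = c := by simp [avg]

theorem avg_const_mul (c : ℂ) (f : Circle → ℂ) : avg (fun ζ => c * f ζ) = c * avg f :=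
  integral_const_mul c _

theorem avg_real_const_mul (c : ℝ) (f : Circle → ℝ) : avg (fun ζ => c * f ζ) = c * avg f :=
  integral_const_mul c _

theorem avg_conj (f : Circle → ℂ) : avg (fun ζ => conj (f ζ)) = conj (avg f) :=
  integral_conj

theorem avg_ofReal (f : Circle → ℝ) : avg (fun ζ => (f ζ : ℂ)) = ((avg f : ℝ) : ℂ) :=
  integral_ofReal

theorem avg_mono {f g : Circle → ℝ} (hf : Continuous f) (hg : Continuous g)
    (h : ∀ ζ, f ζ ≤ g ζ) : avg f ≤ avg g :=
  integral_mono (integrable_circ hf) (integrable_circ hg) fun _ => h _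

theorem norm_avg_le (f : Circle → E) : ‖avg f‖ ≤ avg fun ζ => ‖f ζ‖ :=
  norm_integral_le_integral_norm _

end Avg

/-! ### Cauchy integrals -/

theorem circle_sub_ne_zero {z : ℂ} (hz : z ∈ disk) (ζ : Circle) : (ζ : ℂ) - z ≠ 0 := by
  intro h
  have h1 : ‖z‖ = 1 := by rw [← sub_eq_zero.1 h]; exact Circle.norm_coe ζ
  exact absurd h1 (mem_disk.1 hz).ne

/-- The average of `ψ(ζ) / (ζ - z)ⁿ`. -/
noncomputable def cau (ψ : Circle → ℂ) (n : ℕ) (z : ℂ) : ℂ :=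
  avg fun ζ => ψ ζ / ((ζ : ℂ) - z) ^ n

theorem continuous_cau {ψ : Circle → ℂ} (hψ : Continuous ψ) (n : ℕ) {z : ℂ} (hz : z ∈ disk) :
    Continuous fun ζ : Circle => ψ ζ / ((ζ : ℂ) - z) ^ n :=
  hψ.div₀ ((continuous_circle_coe.sub continuous_const).pow n)
    fun ζ => pow_ne_zero n (circle_sub_ne_zero hz ζ)

theorem hasDerivAt_cau {ψ : Circle → ℂ} (hψ : Continuous ψ) (n : ℕ) {z : ℂ} (hz : z ∈ disk) :
    HasDerivAt (cau ψ n) (n * cau ψ (n + 1) z) z := by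
  obtain ⟨C, hC⟩ := (isCompact_range hψ).isBounded.exists_norm_le
  have hz1 := mem_disk.1 hz
  -- Half the distance to the circle: for |w - z| < r every |ζ - w| is at least r, which dominates
  -- the derivative of the integrand.
  set r := (1 - ‖z‖) / 2 with hr
  have hr0 : 0 < r := by rw [hr]; linarith
  have hsub : Metric.ball z r ⊆ disk := by
    intro w hw
    rw [mem_disk]
    have := norm_sub_norm_le w z
    rw [Metric.mem_ball, dist_eq_norm] at hw
    rw [hr] at hw; linarith
  have hlow : ∀ w ∈ Metric.ball z r, ∀ ζ : Circle, r ≤ ‖(ζ : ℂ) - w‖ := by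
    intro w hw ζ
    rw [Metric.mem_ball, dist_eq_norm] at hw
    have h1 := norm_sub_norm_le (ζ : ℂ) w
    have h2 := norm_sub_norm_le w z
    rw [Circle.norm_coe] at h1
    rw [hr] at hw ⊢; linarith
  have key := hasDerivAt_integral_of_dominated_loc_of_deriv_le (μ := circ)
    (F := fun w θ => ψ (Circle.exp θ) / ((Circle.exp θ : ℂ) - w) ^ n)
    (F' := fun w θ => n * (ψ (Circle.exp θ) / ((Circle.exp θ : ℂ) - w) ^ (n + 1)))
    (bound := fun _ => n * (C / r ^ (n + 1)))
    (Metric.ball_mem_nhds z hr0) ?_ (integrable_circ (continuous_cau hψ n hz)) ?_ ?_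
    (integrable_const _) ?_
  · have := key.2
    rw [integral_const_mul] at this
    exact this
  · filter_upwards [disk_mem_nhds hz] with w hw
    exact (integrable_circ (continuous_cau hψ n hw)).aestronglyMeasurable
  · exact ((integrable_circ (continuous_cau hψ (n + 1) hz)).const_mul _).aestronglyMeasurable
  · refine Eventually.of_forall fun θ w hw => ?_
    rw [norm_mul, norm_div, norm_pow, Complex.norm_natCast]
    gcongr
    · exact (norm_nonneg _).trans (hC _ (mem_range_self 1))
    · exact hC _ (mem_range_self _)
    · exact hlow w hw _
  · refine Eventually.of_forall fun θ w hw => ?_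
    have h0 := circle_sub_ne_zero (hsub hw) (Circle.exp θ)
    have h1 := (((hasDerivAt_id w).const_sub (Circle.exp θ : ℂ)).pow n).inv (pow_ne_zero n h0)
    have h2 := h1.const_mul (ψ (Circle.exp θ))
    simp only [div_eq_mul_inv]
    refine h2.congr_deriv ?_
    simp only [id]
    rcases n with _ | n
    · simp
    · simp only [Nat.add_sub_cancel]
      simp only [Pi.pow_apply]
      field_simp
      ring

/-- Cauchy's formula for the constant 1, since dζ = iζ dθ on the circle. -/
theorem avg_cauchy_one {z : ℂ} (hz : z ∈ disk) :
    cau (fun ζ => (ζ : ℂ)) 1 z = 1 := by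
  have h1 := circleIntegral.integral_sub_inv_of_mem_ball (c := 0) (R := 1) (w := z) hz
  rw [circleIntegral, intervalIntegral.integral_of_le Real.two_pi_pos.le] at h1
  have h2 : ∀ θ : ℝ, deriv (circleMap 0 1) θ • (circleMap 0 1 θ - z)⁻¹ =
      Complex.I * ((Circle.exp θ : ℂ) / ((Circle.exp θ : ℂ) - z) ^ 1) := by
    intro θ
    simp [circleMap, Circle.coe_exp]
    ring
  simp only [h2] at h1
  rw [integral_const_mul] at h1
  rw [cau, avg, circ, integral_smul_measure]
  have h3 : ∫ θ in Ioc 0 (2 * Real.pi), (Circle.exp θ : ℂ) / ((Circle.exp θ : ℂ) - z) ^ 1 =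
      2 * Real.pi := by
    apply mul_left_cancel₀ Complex.I_ne_zero
    rw [h1]; ring
  rw [h3]
  have hp : (0 : ℝ) ≤ 2 * Real.pi := Real.two_pi_pos.le
  rw [ENNReal.toReal_inv, ENNReal.toReal_ofReal hp, Complex.real_smul]
  push_cast
  have : (Real.pi : ℂ) ≠ 0 := by exact_mod_cast Real.pi_ne_zero
  field_simp

/-! ### The Poisson integral for `Δu = 2u` -/

section Poisson

variable {φ : Circle → ℝ} {z : ℂ}

/-- The solution of `Δu = 2u` with boundary function `φ`. -/
noncomputable def pois (φ : Circle → ℝ) (z : ℂ) : ℝ :=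
  avg fun ζ => (1 - ‖z‖ ^ 2) ^ 2 / ‖(ζ : ℂ) - z‖ ^ 4 * φ ζ

/-- The Cauchy integrals `cau (ζ φ(ζ)) n`. -/
noncomputable def cauφ (φ : Circle → ℝ) (n : ℕ) (z : ℂ) : ℂ := cau (fun ζ => (ζ : ℂ) * φ ζ) n z

/-- The holomorphic function whose real part has boundary values `φ`. -/
noncomputable def schw (φ : Circle → ℝ) (z : ℂ) : ℂ := 2 * cauφ φ 1 z - (avg φ : ℝ)

theorem continuous_mul_ofReal (hφ : Continuous φ) :
    Continuous fun ζ : Circle => (ζ : ℂ) * (φ ζ : ℂ) :=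
  continuous_circle_coe.mul (Complex.continuous_ofReal.comp hφ)

theorem hasDerivAt_cauφ (hφ : Continuous φ) (n : ℕ) (hz : z ∈ disk) :
    HasDerivAt (cauφ φ n) (n * cauφ φ (n + 1) z) z :=
  hasDerivAt_cau (continuous_mul_ofReal hφ) n hz

theorem hasDerivAt_schw (hφ : Continuous φ) (hz : z ∈ disk) :
    HasDerivAt (schw φ) (2 * cauφ φ 2 z) z := by
  have := ((hasDerivAt_cauφ hφ 1 hz).const_mul 2).sub_const ((avg φ : ℝ) : ℂ)
  refine this.congr_deriv ?_
  norm_num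

/-- The first Wirtinger derivative of `pois φ`. -/
noncomputable def poisD (φ : Circle → ℝ) (z : ℂ) : ℂ :=
  1 / 2 * (conj (2 * cauφ φ 2 z + z * (4 * cauφ φ 3 z))
    + (2 * (defect z)⁻¹ - 1) * conj (2 * cauφ φ 2 z))
    + z * (defect z ^ 2)⁻¹ * (schw φ z + conj (schw φ z))

theorem normSq_circle_sub (ζ : Circle) (z : ℂ) : ((‖(ζ : ℂ) - z‖ ^ 2 : ℝ) : ℂ) =
    ((ζ : ℂ) - z) * ((ζ : ℂ)⁻¹ - conj z) := by
  rw [← Circle.coe_inv, Circle.coe_inv_eq_conj, ← map_sub, Complex.mul_conj']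
  push_cast; rfl

theorem circle_inv_sub_ne_zero (hz : z ∈ disk) (ζ : Circle) : (ζ : ℂ)⁻¹ - conj z ≠ 0 := by
  rw [← Circle.coe_inv, Circle.coe_inv_eq_conj, ← map_sub]
  exact (map_ne_zero _).2 (circle_sub_ne_zero hz ζ)

theorem conj_circle (ζ : Circle) : conj (ζ : ℂ) = (ζ : ℂ)⁻¹ := by
  rw [← Circle.coe_inv, Circle.coe_inv_eq_conj]

theorem continuous_kernel (hφ : Continuous φ) (c : ℝ) (hz : z ∈ disk) :
    Continuous fun ζ : Circle => c / ‖(ζ : ℂ) - z‖ ^ 4 * φ ζ :=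
  (continuous_const.div₀ ((continuous_circle_coe.sub continuous_const).norm.pow 4)
    fun ζ => pow_ne_zero 4 (norm_ne_zero_iff.2 (circle_sub_ne_zero hz ζ))).mul hφ

theorem schw_eq_avg (hφ : Continuous φ) (hz : z ∈ disk) :
    schw φ z = avg fun ζ => 2 * ((ζ : ℂ) * φ ζ / ((ζ : ℂ) - z) ^ 1) - φ ζ := by
  rw [avg_sub ((continuous_cau (continuous_mul_ofReal hφ) 1 hz).const_mul 2)
    (show Continuous fun ζ => (φ ζ : ℂ) from Complex.continuous_ofReal.comp hφ), avg_const_mul, avg_ofReal]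
  rfl

/-- With F = `schw φ`, the average is the real part of zF' + (2/D - 1)F. Afterwards only holomorphic
functions and the defect have to be differentiated. The identity already holds between the kernels
at each ζ. -/
theorem cx_pois (hφ : Continuous φ) (hz : z ∈ disk) :
    cx (pois φ) z = 1 / 2 * ((z * (2 * cauφ φ 2 z) + (2 * (defect z)⁻¹ - 1) * schw φ z)
      + conj (z * (2 * cauφ φ 2 z) + (2 * (defect z)⁻¹ - 1) * schw φ z)) := by
  have c2 := continuous_cau (continuous_mul_ofReal hφ) 2 hz
  have c1 := continuous_cau (continuous_mul_ofReal hφ) 1 hz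
  have cφ : Continuous fun ζ => (φ ζ : ℂ) := Complex.continuous_ofReal.comp hφ
  have cs : Continuous fun ζ : Circle => 2 * ((ζ : ℂ) * φ ζ / ((ζ : ℂ) - z) ^ 1) - φ ζ :=
    (c1.const_mul 2).sub cφ
  have hA : z * (2 * cauφ φ 2 z) + (2 * (defect z)⁻¹ - 1) * schw φ z = avg fun ζ =>
      (2 * z) * ((ζ : ℂ) * φ ζ / ((ζ : ℂ) - z) ^ 2)
      + (2 * (defect z)⁻¹ - 1) * (2 * ((ζ : ℂ) * φ ζ / ((ζ : ℂ) - z) ^ 1) - φ ζ) := by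
    rw [avg_add (c2.const_mul _) (cs.const_mul _), avg_const_mul, avg_const_mul,
      ← schw_eq_avg hφ hz]
    rw [cauφ, cau]; ring
  have cA : Continuous fun ζ : Circle => (2 * z) * ((ζ : ℂ) * φ ζ / ((ζ : ℂ) - z) ^ 2)
      + (2 * (defect z)⁻¹ - 1) * (2 * ((ζ : ℂ) * φ ζ / ((ζ : ℂ) - z) ^ 1) - φ ζ) :=
    (c2.const_mul (2 * z)).add (cs.const_mul (2 * (defect z)⁻¹ - 1))
  have cA' := Complex.continuous_conj.comp cA
  simp only [Function.comp_def] at cA'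
  rw [hA, ← avg_conj, ← avg_add cA cA', ← avg_const_mul, cx, pois,
    ← avg_ofReal]
  congr 1
  ext ζ
  have hD := defect_ne_zero hz
  have h1 := circle_sub_ne_zero hz ζ
  have h2 := circle_inv_sub_ne_zero hz ζ
  have h3 := Circle.coe_ne_zero ζ
  have h4 : 1 - (ζ : ℂ) * conj z ≠ 0 := by
    intro h; apply h2; field_simp; simpa using h
  have hk : (((1 - ‖z‖ ^ 2) ^ 2 / ‖(ζ : ℂ) - z‖ ^ 4 * φ ζ : ℝ) : ℂ) =
      defect z ^ 2 / (((ζ : ℂ) - z) * ((ζ : ℂ)⁻¹ - conj z)) ^ 2 * φ ζ := by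
    rw [← normSq_circle_sub, defect_eq]; push_cast; ring
  rw [hk]
  simp only [map_add, map_sub, map_mul, map_div₀, map_pow, map_inv₀, conj_circle, conj_defect,
    Complex.conj_ofReal, map_ofNat, map_one]
  have hd : defect z = 1 - z * conj z := rfl
  generalize conj z = w at *
  generalize (φ ζ : ℂ) = p
  generalize (ζ : ℂ) = y at *
  generalize hdd : defect z = d at *
  field_simp
  subst hd
  ring

theorem hasWirt_cx_pois (hφ : Continuous φ) (hz : z ∈ disk) :
    HasWirt (cx (pois φ)) (conj (poisD φ z)) (poisD φ z) z := by
  have hD := defect_ne_zero hz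
  have hA := ((hasWirt_id z).mul ((hasDerivAt_cauφ hφ 2 hz).hasWirt.const_mul 2)).add
    (((((hasWirt_defect z).inv hD).const_mul 2).sub (hasWirt_const 1 z)).mul
      (hasDerivAt_schw hφ hz).hasWirt)
  have hB := ((hA.add hA.conj).const_mul (1 / 2)).congr_of_eventuallyEq
    (eventually_of_mem (disk_mem_nhds hz) fun w hw => cx_pois hφ hw)
  refine hB.congr_coeff ?_ ?_
  · simp [poisD, map_ofNat]; ring
  · simp [poisD, map_ofNat]; ring

/-- The Wirtinger derivatives of `poisD φ`. -/
theorem hasWirt_poisD (hφ : Continuous φ) (hz : z ∈ disk) :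
    HasWirt (poisD φ) (2 * pois φ z / defect z ^ 2)
      (2 * z / defect z * poisD φ z
        + 1 / 2 * conj (3 * (4 * cauφ φ 3 z) + z * (12 * cauφ φ 4 z))) z := by
  have hD := defect_ne_zero hz
  have w2 := (hasDerivAt_cauφ hφ 2 hz).hasWirt.const_mul 2
  have w3 := (hasDerivAt_cauφ hφ 3 hz).hasWirt.const_mul 4
  have ws := (hasDerivAt_schw hφ hz).hasWirt
  have hA := (((w2.add ((hasWirt_id z).mul w3)).conj.add
    (((((hasWirt_defect z).inv hD).const_mul 2).sub (hasWirt_const 1 z)).mul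
      w2.conj)).const_mul (1 / 2)).add (((hasWirt_id z).mul
        ((hasWirt_defect z).pow_two.inv (pow_ne_zero 2 hD))).mul (ws.add ws.conj))
  have hB : HasWirt (poisD φ) _ _ z := hA
  have hzz : z * conj z = 1 - defect z := by simp [defect]
  have hu : (pois φ z : ℂ) = _ := cx_pois hφ hz
  refine hB.congr_coeff ?_ ?_
  · rw [hu]
    simp [map_ofNat]
    field_simp
    linear_combination (2 * (schw φ z + conj (schw φ z))) * hzz
  · simp [poisD, map_ofNat]
    field_simp
    linear_combination (-8 * conj (cauφ φ 3 z) * defect z ^ 2) * hzz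

end Poisson


/-! ### Poisson integrals as solutions, and estimates of their kernels. -/

section PoissonSolution

variable {φ : Circle → ℝ} {z : ℂ}

theorem contDiffOn_of_hasDerivAt {f f' : ℂ → ℂ} (h : ∀ z ∈ disk, HasDerivAt f (f' z) z) :
    ContDiffOn ℝ ∞ f disk := by
  have hd : DifferentiableOn ℂ f disk := fun z hz =>
    (h z hz).differentiableAt.differentiableWithinAt
  exact (hd.contDiffOn isOpen_disk).restrict_scalars ℝ

theorem isSol_pois (hφ : Continuous φ) : IsSol (pois φ) := by
  constructor
  · have h1 : ContDiffOn ℝ ∞ (cauφ φ 2) disk :=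
      contDiffOn_of_hasDerivAt fun z hz => hasDerivAt_cauφ hφ 2 hz
    have h2 : ContDiffOn ℝ ∞ (schw φ) disk :=
      contDiffOn_of_hasDerivAt fun z hz => hasDerivAt_schw hφ hz
    have hA : ContDiffOn ℝ ∞ (fun z =>
        z * (2 * cauφ φ 2 z) + (2 * (defect z)⁻¹ - 1) * schw φ z) disk :=
      (contDiffOn_id.mul (contDiffOn_const.mul h1)).add
        (((contDiffOn_const.mul contDiffOn_inv_defect).sub contDiffOn_const).mul h2)
    refine (Complex.reCLM.contDiff.comp_contDiffOn hA).congr fun z hz => ?_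
    have h := congrArg Complex.re (cx_pois hφ hz)
    rw [Complex.add_conj, cx, Complex.ofReal_re] at h
    rw [h, ← Complex.ofReal_one, ← Complex.ofReal_ofNat, ← Complex.ofReal_div,
      ← Complex.ofReal_mul, Complex.ofReal_re]
    simp
  · intro z hz
    have heq : EqOn (dzb (cx (pois φ))) (poisD φ) disk := fun w hw =>
      (hasWirt_cx_pois hφ hw).dzb_eq
    rw [dz_congr heq hz, (hasWirt_poisD hφ hz).dz_eq]

theorem cauφ_one_one (hz : z ∈ disk) : cauφ (fun _ => 1) 1 z = 1 := by
  simp only [cauφ, Complex.ofReal_one, mul_one]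
  exact avg_cauchy_one hz

theorem cauφ_one_two (hz : z ∈ disk) : cauφ (fun _ => 1) 2 z = 0 := by
  have h1 := hasDerivAt_cauφ (φ := fun _ => 1) continuous_const 1 hz
  have h2 : HasDerivAt (cauφ (fun _ => 1) 1) 0 z := (hasDerivAt_const z (1 : ℂ)).congr_of_eventuallyEq
    (eventually_of_mem (disk_mem_nhds hz) fun w hw => cauφ_one_one hw)
  simpa using h1.unique h2

theorem cauφ_one_three (hz : z ∈ disk) : cauφ (fun _ => 1) 3 z = 0 := by
  have h1 := hasDerivAt_cauφ (φ := fun _ => 1) continuous_const 2 hz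
  have h2 : HasDerivAt (cauφ (fun _ => 1) 2) 0 z := (hasDerivAt_const z (0 : ℂ)).congr_of_eventuallyEq
    (eventually_of_mem (disk_mem_nhds hz) fun w hw => cauφ_one_two hw)
  simpa using h1.unique h2

theorem schw_one (hz : z ∈ disk) : schw (fun _ => 1) z = 1 := by
  rw [schw, cauφ_one_one hz, avg_const]; norm_num

theorem pois_one (hz : z ∈ disk) : pois (fun _ => 1) z = (1 + ‖z‖ ^ 2) / (1 - ‖z‖ ^ 2) := by
  have h := cx_pois (φ := fun _ => 1) continuous_const hz
  rw [schw_one hz, cauφ_one_two hz] at h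
  have h0 := (one_sub_sq_pos hz).ne'
  rw [← Complex.ofReal_inj]
  refine h.trans ?_
  have hd : ((1 - ‖z‖ ^ 2 : ℝ) : ℂ) ≠ 0 := by exact_mod_cast h0
  simp only [mul_zero, mul_one, zero_add, map_sub, map_mul, map_inv₀, conj_defect, map_ofNat,
    map_one]
  rw [defect_eq, Complex.ofReal_div]
  field_simp
  push_cast
  ring

theorem poisD_one (hz : z ∈ disk) : poisD (fun _ => 1) z = 2 * z / defect z ^ 2 := by
  rw [poisD, schw_one hz, cauφ_one_two hz, cauφ_one_three hz]
  simp
  ring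

/-- The kernel of `J grad u`. -/
noncomputable def vecKernel (z : ℂ) (ζ : Circle) : ℂ :=
  defect z ^ 3 * (ζ : ℂ)⁻¹ / ((z - (ζ : ℂ)) * (conj z - (ζ : ℂ)⁻¹) ^ 3)

theorem continuous_vecKernel (hz : z ∈ disk) : Continuous (vecKernel z) := by
  have h3 : Continuous fun ζ : Circle => (ζ : ℂ)⁻¹ :=
    continuous_circle_coe.inv₀ fun ζ => Circle.coe_ne_zero ζ
  refine (continuous_const.mul h3).div₀ ((continuous_const.sub continuous_circle_coe).mul
    ((continuous_const.sub h3).pow 3)) fun ζ => ?_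
  refine mul_ne_zero (sub_ne_zero.2 (sub_ne_zero.1 (circle_sub_ne_zero hz ζ)).symm)
    (pow_ne_zero 3 (sub_ne_zero.2 (sub_ne_zero.1 (circle_inv_sub_ne_zero hz ζ)).symm))

/-- The modulus is D times the scalar Poisson kernel, so a single estimate, `tendsto_avg_kernel`,
serves both the function and its gradient at the boundary. -/
theorem norm_vecKernel (hz : z ∈ disk) (ζ : Circle) :
    ‖vecKernel z ζ‖ = (1 - ‖z‖ ^ 2) ^ 3 / ‖(ζ : ℂ) - z‖ ^ 4 := by
  have h1 : ‖conj z - (ζ : ℂ)⁻¹‖ = ‖(ζ : ℂ) - z‖ := by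
    rw [← conj_circle, ← map_sub, Complex.norm_conj, norm_sub_rev]
  rw [vecKernel, norm_div, norm_mul, norm_mul, norm_pow, norm_pow, h1, norm_inv, Circle.norm_coe,
    defect_eq, Complex.norm_real, Real.norm_of_nonneg (one_sub_sq_pos hz).le, norm_sub_rev]
  ring

/-- Gathers the gradient into one average, which exposes the modulus of its kernel; the sum of
Cauchy integrals hides it. -/
theorem poisD_eq_avg (hφ : Continuous φ) (hz : z ∈ disk) :
    defect z ^ 2 / 2 * poisD φ z = avg fun ζ => vecKernel z ζ * φ ζ := by
  have cψ := continuous_mul_ofReal hφ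
  have cφ : Continuous fun ζ => (φ ζ : ℂ) := Complex.continuous_ofReal.comp hφ
  have c1 := continuous_cau cψ 1 hz
  have c2 := continuous_cau cψ 2 hz
  have c3 := continuous_cau cψ 3 hz
  have cs : Continuous fun ζ : Circle => 2 * ((ζ : ℂ) * φ ζ / ((ζ : ℂ) - z) ^ 1) - φ ζ :=
    (c1.const_mul 2).sub cφ
  have c2' : Continuous fun ζ : Circle => conj ((ζ : ℂ) * φ ζ / ((ζ : ℂ) - z) ^ 2) :=
    Complex.continuous_conj.comp c2
  have c3' : Continuous fun ζ : Circle => conj ((ζ : ℂ) * φ ζ / ((ζ : ℂ) - z) ^ 3) :=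
    Complex.continuous_conj.comp c3
  have cs' : Continuous fun ζ : Circle => conj (2 * ((ζ : ℂ) * φ ζ / ((ζ : ℂ) - z) ^ 1) - φ ζ) :=
    Complex.continuous_conj.comp cs
  have hA : poisD φ z = 2 * (defect z)⁻¹ * conj (cauφ φ 2 z) + 2 * conj z * conj (cauφ φ 3 z)
      + z * (defect z ^ 2)⁻¹ * schw φ z + z * (defect z ^ 2)⁻¹ * conj (schw φ z) := by
    simp [poisD, map_ofNat]; ring
  rw [hA, schw_eq_avg hφ hz, cauφ, cauφ, cau, cau, ← avg_conj, ← avg_conj, ← avg_conj,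
    ← avg_const_mul, ← avg_const_mul, ← avg_const_mul, ← avg_const_mul,
    ← avg_add (c2'.const_mul _) (c3'.const_mul _),
    ← avg_add ((c2'.const_mul _).fun_add (c3'.const_mul _)) (cs.const_mul _),
    ← avg_add (((c2'.const_mul _).fun_add (c3'.const_mul _)).fun_add (cs.const_mul _))
      (cs'.const_mul _),
    ← avg_const_mul]
  congr 1
  ext ζ
  have hD := defect_ne_zero hz
  have h1 := circle_sub_ne_zero hz ζ
  have h1' : z - (ζ : ℂ) ≠ 0 := sub_ne_zero.2 (sub_ne_zero.1 h1).symm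
  have h2 := circle_inv_sub_ne_zero hz ζ
  have h3 := Circle.coe_ne_zero ζ
  have h4 : 1 - (ζ : ℂ) * conj z ≠ 0 := by
    intro h; apply h2; field_simp; simpa using h
  have h4' : (ζ : ℂ) * conj z - 1 ≠ 0 := by
    intro h; apply h4; linear_combination -h
  simp only [map_sub, map_mul, map_div₀, map_pow, conj_circle, Complex.conj_ofReal, map_ofNat,
    vecKernel]
  have hd : defect z = 1 - z * conj z := rfl
  generalize conj z = w at *
  generalize (φ ζ : ℂ) = p
  generalize (ζ : ℂ) = y at *
  generalize hdd : defect z = d at *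
  have e1 : z - y = -(y - z) := by ring
  have e2 : w - y⁻¹ = -((1 - y * w) / y) := by field_simp; ring
  have e3 : y⁻¹ - w = (1 - y * w) / y := by field_simp
  rw [e1, e2, e3]
  field_simp
  subst hd
  ring

/-- The Wirtinger derivative `∂/∂z̄` of the gradient of `pois φ` is dominated by `pois |φ|`. -/
theorem norm_dzb_grad_pois_le (hφ : Continuous φ) (h0 : ∀ ζ, 0 ≤ φ ζ) (hz : z ∈ disk) :
    ‖dzb (grad Complex.basisOneI hyp (pois φ)) z‖ ≤ 3 * pois φ z := by
  have hD := defect_ne_zero hz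
  have heq : EqOn (dzb (cx (pois φ))) (poisD φ) disk := fun w hw =>
      (hasWirt_cx_pois hφ hw).dzb_eq
  -- The terms in `poisD φ` cancel, leaving conjugates of holomorphic functions.
  have hg : dzb (grad Complex.basisOneI hyp (pois φ)) z =
      3 * defect z ^ 2 * conj (cauφ φ 3 z + z * cauφ φ 4 z) := by
    rw [(hasWirt_grad (isSol_pois hφ).1 hz).dzb_eq, dzb_congr heq hz, heq hz,
      (hasWirt_poisD hφ hz).dzb_eq]
    simp [map_ofNat]
    field_simp
    ring
  have cψ := continuous_mul_ofReal hφ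
  have c3 := continuous_cau cψ 3 hz
  have c4 := continuous_cau cψ 4 hz
  have ha : cauφ φ 3 z + z * cauφ φ 4 z =
      avg fun ζ => (ζ : ℂ) ^ 2 / ((ζ : ℂ) - z) ^ 4 * φ ζ := by
    rw [cauφ, cauφ, cau, cau, ← avg_const_mul, ← avg_add c3 (c4.const_mul z)]
    congr 1
    ext ζ
    have h1 := circle_sub_ne_zero hz ζ
    field_simp
    ring
  -- Since |ζ| = 1, the kernel of ∂̄ has modulus exactly three times the Poisson kernel; positivity
  -- of φ lets the absolute value pass inside.
  have hn : ∀ ζ : Circle, ‖(ζ : ℂ) ^ 2 / ((ζ : ℂ) - z) ^ 4 * φ ζ‖ =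
      1 / ‖(ζ : ℂ) - z‖ ^ 4 * φ ζ := by
    intro ζ
    rw [norm_mul, norm_div, norm_pow, norm_pow, Circle.norm_coe, Complex.norm_real,
      Real.norm_of_nonneg (h0 ζ)]
    norm_num
  have h2 := norm_avg_le fun ζ : Circle => (ζ : ℂ) ^ 2 / ((ζ : ℂ) - z) ^ 4 * φ ζ
  simp only [hn] at h2
  rw [hg, norm_mul, norm_mul, Complex.norm_conj, ha, norm_pow, defect_eq, Complex.norm_real,
    Real.norm_of_nonneg (one_sub_sq_pos hz).le]
  have h3 : pois φ z = (1 - ‖z‖ ^ 2) ^ 2 * avg fun ζ : Circle => 1 / ‖(ζ : ℂ) - z‖ ^ 4 * φ ζ := by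
    rw [pois, ← avg_real_const_mul]
    congr 1; ext ζ; ring
  rw [h3]
  have h4 : ‖(3 : ℂ)‖ = 3 := by norm_num
  rw [h4, mul_assoc]
  gcongr

/-! ### Boundary behaviour of Poisson integrals -/

/-- Continuity handles ζ near ζ₀ and boundedness the rest. The exponent 4 is that of |ζ - z| in the
kernel, so the two will cancel. -/
theorem exists_le_add_mul_pow (hφ : Continuous φ) (ζ₀ : Circle) {ε : ℝ} (hε : 0 < ε) :
    ∃ C, 0 ≤ C ∧ ∀ ζ : Circle, |φ ζ - φ ζ₀| ≤ ε + C * ‖(ζ : ℂ) - ζ₀‖ ^ 4 := by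
  obtain ⟨M, hM⟩ := (isCompact_range hφ).isBounded.exists_norm_le
  obtain ⟨δ, hδ, h⟩ := Metric.continuousAt_iff.1 (hφ.continuousAt (x := ζ₀)) ε hε
  have hM0 : 0 ≤ M := (norm_nonneg _).trans (hM _ (mem_range_self ζ₀))
  refine ⟨2 * M / δ ^ 4, by positivity, fun ζ => ?_⟩
  by_cases hd : dist ζ ζ₀ < δ
  · have := h hd
    rw [Real.dist_eq] at this
    have h3 : 0 ≤ 2 * M / δ ^ 4 * ‖(ζ : ℂ) - ζ₀‖ ^ 4 := by positivity
    linarith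
  · push Not at hd
    have h1 : δ ≤ ‖(ζ : ℂ) - ζ₀‖ := by rw [← dist_eq_norm]; exact hd
    have h2 : |φ ζ - φ ζ₀| ≤ 2 * M := by
      have a := hM _ (mem_range_self ζ)
      have b := hM _ (mem_range_self ζ₀)
      have := norm_sub_le (φ ζ) (φ ζ₀)
      rw [← Real.norm_eq_abs]; linarith
    have h3 : 2 * M ≤ 2 * M / δ ^ 4 * ‖(ζ : ℂ) - ζ₀‖ ^ 4 := by
      rw [div_mul_eq_mul_div, le_div_iff₀ (by positivity)]
      gcongr
    linarith

theorem avg_kernel (hz : z ∈ disk) :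
    avg (fun ζ : Circle => (1 - ‖z‖ ^ 2) ^ 3 / ‖(ζ : ℂ) - z‖ ^ 4) = 1 + ‖z‖ ^ 2 := by
  have h := pois_one hz
  have h0 := (one_sub_sq_pos hz).ne'
  rw [eq_div_iff h0, mul_comm, pois, ← avg_real_const_mul] at h
  rw [← h]
  congr 1; ext ζ; ring

/-- From |ζ - ζ₀|⁴ ≤ 8(|ζ - z|⁴ + |z - ζ₀|⁴), the first part cancels the denominator and leaves a
multiple of D³, while the second is a factor tending to 0 against a kernel of bounded mass. -/
theorem tendsto_avg_kernel (hφ : Continuous φ) (ζ₀ : Circle) :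
    Tendsto (fun z => avg fun ζ : Circle =>
      (1 - ‖z‖ ^ 2) ^ 3 / ‖(ζ : ℂ) - z‖ ^ 4 * |φ ζ - φ ζ₀|) (𝓝[disk] (ζ₀ : ℂ)) (𝓝 0) := by
  rw [Metric.tendsto_nhds]
  intro ε hε
  -- The kernel has mass 1 + |z|² ≤ 2, so ε/4 contributes at most ε/2.
  obtain ⟨C, hC0, hC⟩ := exists_le_add_mul_pow hφ ζ₀ (ε := ε / 4) (by positivity)
  have hlim : Tendsto (fun z : ℂ => ε / 4 * 2 + C * 8 * ((1 - ‖z‖ ^ 2) ^ 3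
      + ‖z - ζ₀‖ ^ 4 * 2)) (𝓝[disk] (ζ₀ : ℂ)) (𝓝 (ε / 2)) := by
    have hc : Continuous (fun z : ℂ => ε / 4 * 2 + C * 8 * ((1 - ‖z‖ ^ 2) ^ 3
      + ‖z - ζ₀‖ ^ 4 * 2)) := by fun_prop
    have := (hc.tendsto (ζ₀ : ℂ)).mono_left (nhdsWithin_le_nhds (s := disk))
    convert this using 2
    rw [Circle.norm_coe]; simp; ring
  filter_upwards [hlim.eventually_lt_const (half_lt_self hε), self_mem_nhdsWithin] with z hlt hz
  have hD := one_sub_sq_pos hz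
  have c1 : Continuous fun ζ : Circle => |φ ζ - φ ζ₀| := (hφ.sub continuous_const).abs
  have cφ := continuous_kernel c1 ((1 - ‖z‖ ^ 2) ^ 3) hz
  have hpos : 0 ≤ avg fun ζ : Circle =>
      (1 - ‖z‖ ^ 2) ^ 3 / ‖(ζ : ℂ) - z‖ ^ 4 * |φ ζ - φ ζ₀| :=
    integral_nonneg fun θ => by positivity
  rw [Real.dist_eq, sub_zero, abs_of_nonneg hpos]
  refine lt_of_le_of_lt ?_ hlt
  have hk1 : Continuous fun ζ : Circle => (1 - ‖z‖ ^ 2) ^ 3 / ‖(ζ : ℂ) - z‖ ^ 4 := by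
    simpa using continuous_kernel (φ := fun _ => 1) continuous_const ((1 - ‖z‖ ^ 2) ^ 3) hz
  have hb : ∀ ζ : Circle, (1 - ‖z‖ ^ 2) ^ 3 / ‖(ζ : ℂ) - z‖ ^ 4 * |φ ζ - φ ζ₀| ≤
      (ε / 4 + C * 8 * ‖z - ζ₀‖ ^ 4) * ((1 - ‖z‖ ^ 2) ^ 3 / ‖(ζ : ℂ) - z‖ ^ 4)
        + C * 8 * (1 - ‖z‖ ^ 2) ^ 3 := by
    intro ζ
    have hn : 0 < ‖(ζ : ℂ) - z‖ := norm_pos_iff.2 (circle_sub_ne_zero hz ζ)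
    have ht : ‖(ζ : ℂ) - ζ₀‖ ≤ ‖(ζ : ℂ) - z‖ + ‖z - ζ₀‖ := norm_sub_le_norm_sub_add_norm_sub _ _ _
    have h4 : ‖(ζ : ℂ) - ζ₀‖ ^ 4 ≤ 8 * (‖(ζ : ℂ) - z‖ ^ 4 + ‖z - ζ₀‖ ^ 4) := by
      calc ‖(ζ : ℂ) - ζ₀‖ ^ 4 ≤ (‖(ζ : ℂ) - z‖ + ‖z - ζ₀‖) ^ 4 := by gcongr
        _ ≤ 2 ^ (4 - 1) * (‖(ζ : ℂ) - z‖ ^ 4 + ‖z - ζ₀‖ ^ 4) :=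
          add_pow_le (norm_nonneg _) (norm_nonneg _) 4
        _ = _ := by norm_num
    have h5 : |φ ζ - φ ζ₀| ≤ ε / 4 + C * (8 * (‖(ζ : ℂ) - z‖ ^ 4 + ‖z - ζ₀‖ ^ 4)) :=
      (hC ζ).trans (by gcongr)
    calc _ ≤ (1 - ‖z‖ ^ 2) ^ 3 / ‖(ζ : ℂ) - z‖ ^ 4 *
          (ε / 4 + C * (8 * (‖(ζ : ℂ) - z‖ ^ 4 + ‖z - ζ₀‖ ^ 4))) := by gcongr
      _ = _ := by field_simp; ring
  refine (avg_mono cφ ((hk1.const_mul _).fun_add continuous_const) hb).trans ?_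
  rw [avg_add (hk1.const_mul _) continuous_const, avg_real_const_mul, avg_kernel hz, avg_const]
  have hz2 : 1 + ‖z‖ ^ 2 ≤ 2 := by linarith
  have : (ε / 4 + C * 8 * ‖z - ζ₀‖ ^ 4) * (1 + ‖z‖ ^ 2) ≤
      (ε / 4 + C * 8 * ‖z - ζ₀‖ ^ 4) * 2 := by gcongr
  linarith

theorem tendsto_pois (hφ : Continuous φ) (ζ₀ : Circle) :
    Tendsto (fun z => (1 - ‖z‖ ^ 2) / (1 + ‖z‖ ^ 2) * pois φ z) (𝓝[disk] (ζ₀ : ℂ))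
      (𝓝 (φ ζ₀)) := by
  rw [tendsto_iff_norm_sub_tendsto_zero]
  refine squeeze_zero' (Eventually.of_forall fun _ => norm_nonneg _) ?_ (tendsto_avg_kernel hφ ζ₀)
  filter_upwards [self_mem_nhdsWithin] with z hz
  have hD := one_sub_sq_pos hz
  have hp : 1 ≤ 1 + ‖z‖ ^ 2 := by nlinarith [sq_nonneg ‖z‖]
  have h1 : (1 - ‖z‖ ^ 2) / (1 + ‖z‖ ^ 2) * pois φ z - φ ζ₀ = (1 + ‖z‖ ^ 2)⁻¹ * avg fun ζ : Circle =>
      (1 - ‖z‖ ^ 2) ^ 3 / ‖(ζ : ℂ) - z‖ ^ 4 * (φ ζ - φ ζ₀) := by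
    have e1 : (fun ζ : Circle => (1 - ‖z‖ ^ 2) ^ 3 / ‖(ζ : ℂ) - z‖ ^ 4 * (φ ζ - φ ζ₀)) =
      fun ζ : Circle => (1 - ‖z‖ ^ 2) * ((1 - ‖z‖ ^ 2) ^ 2 / ‖(ζ : ℂ) - z‖ ^ 4 * φ ζ)
        - φ ζ₀ * ((1 - ‖z‖ ^ 2) ^ 3 / ‖(ζ : ℂ) - z‖ ^ 4) := by ext ζ; ring
    have hk1 : Continuous fun ζ : Circle => (1 - ‖z‖ ^ 2) ^ 3 / ‖(ζ : ℂ) - z‖ ^ 4 := by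
      simpa using continuous_kernel (φ := fun _ => 1) continuous_const ((1 - ‖z‖ ^ 2) ^ 3) hz
    rw [e1, avg_sub ((continuous_kernel hφ _ hz).const_mul _) (hk1.const_mul _),
      avg_real_const_mul, avg_real_const_mul, avg_kernel hz, ← pois]
    field_simp
  rw [h1, norm_mul, norm_inv, Real.norm_of_nonneg (by linarith : 0 ≤ 1 + ‖z‖ ^ 2)]
  have h2 := norm_avg_le fun ζ : Circle =>
      (1 - ‖z‖ ^ 2) ^ 3 / ‖(ζ : ℂ) - z‖ ^ 4 * (φ ζ - φ ζ₀)
  have h3 : (fun ζ : Circle => ‖(1 - ‖z‖ ^ 2) ^ 3 / ‖(ζ : ℂ) - z‖ ^ 4 * (φ ζ - φ ζ₀)‖) =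
      fun ζ : Circle => (1 - ‖z‖ ^ 2) ^ 3 / ‖(ζ : ℂ) - z‖ ^ 4 * |φ ζ - φ ζ₀| := by
    ext ζ
    rw [norm_mul, Real.norm_of_nonneg (by positivity), Real.norm_eq_abs]
  rw [h3] at h2
  calc _ ≤ 1 * _ := mul_le_mul (inv_le_one_of_one_le₀ hp) h2 (norm_nonneg _) zero_le_one
    _ = _ := one_mul _

/-- The vector kernel has average z, as the case φ = 1 shows. The difference from i z φ(ζ₀) is thus
an average of the kernel against φ - φ(ζ₀). -/
theorem tendsto_grad_pois (hφ : Continuous φ) (ζ₀ : Circle) :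
    Tendsto (fun z => Complex.I * grad Complex.basisOneI hyp (pois φ) z) (𝓝[disk] (ζ₀ : ℂ))
      (𝓝 (Complex.I * (ζ₀ : ℂ) * φ ζ₀)) := by
  have hid : Tendsto (fun z : ℂ => Complex.I * z * φ ζ₀) (𝓝[disk] (ζ₀ : ℂ))
      (𝓝 (Complex.I * (ζ₀ : ℂ) * φ ζ₀)) :=
    ((continuous_const.mul continuous_id).mul continuous_const).continuousWithinAt
  have hdiff : Tendsto (fun z => Complex.I * grad Complex.basisOneI hyp (pois φ) z
      - Complex.I * z * φ ζ₀) (𝓝[disk] (ζ₀ : ℂ)) (𝓝 0) := by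
    rw [tendsto_zero_iff_norm_tendsto_zero]
    refine squeeze_zero' (Eventually.of_forall fun _ => norm_nonneg _) ?_
      (tendsto_avg_kernel hφ ζ₀)
    filter_upwards [self_mem_nhdsWithin] with z hz
    have hD := defect_ne_zero hz
    have ck := continuous_vecKernel hz
    have cφ : Continuous fun ζ => (φ ζ : ℂ) := Complex.continuous_ofReal.comp hφ
    have h1 : avg (vecKernel z) = z := by
      have := poisD_eq_avg (φ := fun _ => 1) continuous_const hz
      rw [poisD_one hz] at this
      simp only [Complex.ofReal_one, mul_one] at this
      rw [← this]; field_simp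
    have h2 : Complex.I * grad Complex.basisOneI hyp (pois φ) z - Complex.I * z * φ ζ₀ =
        Complex.I * avg fun ζ => vecKernel z ζ * (φ ζ - φ ζ₀ : ℝ) := by
      have e1 : (fun ζ => vecKernel z ζ * (φ ζ - φ ζ₀ : ℝ)) =
          fun ζ => vecKernel z ζ * φ ζ - φ ζ₀ * vecKernel z ζ := by
        ext ζ; push_cast; ring
      rw [e1, avg_sub (ck.fun_mul cφ) (ck.const_mul _), avg_const_mul, h1, ← poisD_eq_avg hφ hz,
        grad_hyp (differentiableAt_of_disk (isSol_pois hφ).1 hz) hz,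
        (hasWirt_cx_pois hφ hz).dzb_eq]
      ring
    rw [h2, norm_mul, Complex.norm_I, one_mul]
    refine (norm_avg_le _).trans (le_of_eq ?_)
    congr 1
    ext ζ
    rw [norm_mul, norm_vecKernel hz, Complex.norm_real, Real.norm_eq_abs]
  simpa using hdiff.add hid

end PoissonSolution


/-! ### Second derivatives along curves -/

section Curves

variable {u : ℂ → ℝ} {γ : ℝ → ℂ} {t : ℝ}

theorem hasDerivAt_curve (hu : ContDiffOn ℝ ∞ u disk) (ht : γ t ∈ disk) {γ' : ℂ}
    (hγ : HasDerivAt γ γ' t) :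
    HasDerivAt (fun s => u (γ s)) (2 * (dz (cx u) (γ t) * γ').re) t := by
  have hd := differentiableAt_of_disk hu ht
  have h := hd.hasFDerivAt.comp_hasDerivAt t hγ
  refine h.congr_deriv ?_
  rw [fderiv_real_apply hd, ← conj_dz_cx hd]
  simp

theorem hasDerivAt_deriv_curve (hu : ContDiffOn ℝ ∞ u disk) (ht : γ t ∈ disk) {γ' : ℝ → ℂ}
    {γ'' : ℂ} (hγ : HasDerivAt γ (γ' t) t) (hγ' : HasDerivAt γ' γ'' t) :
    HasDerivAt (fun s => 2 * (dz (cx u) (γ s) * γ' s).re)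
      (2 * ((dz (dz (cx u)) (γ t) * γ' t + dzb (dz (cx u)) (γ t) * conj (γ' t)) * γ' t
        + dz (cx u) (γ t) * γ'').re) t := by
  have h1 := (hasWirt_of_disk (contDiffOn_dz (contDiffOn_cx hu)) ht).comp_hasDerivAt hγ
  have h2 := Complex.reCLM.hasFDerivAt.comp_hasDerivAt t (h1.mul hγ')
  exact h2.const_mul 2

/-- If c were positive, the point would also be a local minimum, so f would be locally constant and
c zero. -/
theorem deriv_deriv_nonpos_of_isLocalMax {f f' : ℝ → ℝ} {c : ℝ} (hmax : IsLocalMax f t)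
    (hf : ∀ᶠ s in 𝓝 t, HasDerivAt f (f' s) s) (hf' : HasDerivAt f' c t) : c ≤ 0 := by
  by_contra! hc
  have he : deriv f =ᶠ[𝓝 t] f' := hf.mono fun s hs => hs.deriv
  have h2 : deriv (deriv f) t = c := by rw [he.deriv_eq, hf'.deriv]
  have hmin := isLocalMin_of_deriv_deriv_pos (by rw [h2]; exact hc) hmax.deriv_eq_zero
    hf.self_of_nhds.continuousAt
  have hconst : f =ᶠ[𝓝 t] fun _ => f t := by
    filter_upwards [hmin, hmax] with s h1 h2 using le_antisymm h2 h1
  have h3 : deriv f =ᶠ[𝓝 t] fun _ => 0 := by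
    filter_upwards [hconst.eventuallyEq_nhds] with s hs
    rw [hs.deriv_eq, deriv_const]
  have h4 : deriv (deriv f) t = 0 := by rw [h3.deriv_eq, deriv_const]
  linarith

/-- Adding the second derivatives in the directions 1 and i cancels the pure ∂²/∂z² terms. -/
theorem re_dzb_dz_nonpos_of_isLocalMax {z : ℂ} (hu : ContDiffOn ℝ ∞ u disk) (hz : z ∈ disk)
    (hmax : IsLocalMax u z) : (dzb (dz (cx u)) z).re ≤ 0 := by
  have key : ∀ v : ℂ, 2 * ((dz (dz (cx u)) z * v + dzb (dz (cx u)) z * conj v) * v).re ≤ 0 := by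
    intro v
    have hl : ∀ s : ℝ, HasDerivAt (fun s : ℝ => z + s * v) v s := fun s => by
      simpa using ((Complex.ofRealCLM.hasDerivAt (x := s)).mul_const v).const_add z
    have hc : ContinuousAt (fun s : ℝ => z + s * v) 0 := (hl 0).continuousAt
    have h0 : z + ((0 : ℝ) : ℂ) * v = z := by simp
    have hmem : ∀ᶠ s : ℝ in 𝓝 0, z + s * v ∈ disk :=
      hc.eventually_mem (by rw [h0]; exact disk_mem_nhds hz)
    have h1 : IsLocalMax (fun s : ℝ => u (z + s * v)) 0 := by
      have := hc.tendsto.eventually (p := fun y => u y ≤ u z) (by rw [h0]; exact hmax)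
      simpa [IsLocalMax, IsMaxFilter] using this
    have h2 := hasDerivAt_deriv_curve hu (γ := fun s : ℝ => z + s * v) (t := 0)
      (γ' := fun _ => v) (γ'' := 0) (by rw [h0]; exact hz) (hl 0) (hasDerivAt_const 0 v)
    have h3 := deriv_deriv_nonpos_of_isLocalMax h1
      (hmem.mono fun s hs => hasDerivAt_curve hu (γ := fun s : ℝ => z + s * v) hs (hl s)) h2
    simpa using h3
  have h1 := key 1
  have hI := key Complex.I
  simp at h1 hI
  linarith

end Curves

/-! ### The maximum principle -/

theorem IsSol.sub {u v : ℂ → ℝ} (hu : IsSol u) (hv : IsSol v) : IsSol fun z => u z - v z := by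
  refine ⟨hu.1.sub hv.1, fun z hz => ?_⟩
  have hcu := contDiffOn_cx hu.1
  have hcv := contDiffOn_cx hv.1
  have he : EqOn (dzb (cx fun z => u z - v z)) (fun z => dzb (cx u) z - dzb (cx v) z) disk := by
    intro w hw
    have h := ((hasWirt_of_disk hcu hw).sub (hasWirt_of_disk hcv hw)).dzb_eq
    simp only [← h]; congr 1; ext y; simp [cx]
  rw [dz_congr he hz, ((hasWirt_of_disk (contDiffOn_dzb hcu) hz).sub
    (hasWirt_of_disk (contDiffOn_dzb hcv) hz)).dz_eq, hu.2 z hz, hv.2 z hz]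
  push_cast; ring

/-- The closure of {|F| ≥ ε} is compact and meets no boundary point, so it lies in a smaller disk.
-/
theorem uniform_of_tendsto {F : ℂ → ℝ} (h : ∀ ζ : Circle, Tendsto F (𝓝[disk] (ζ : ℂ)) (𝓝 0))
    {ε : ℝ} (hε : 0 < ε) : ∃ ρ, 0 ≤ ρ ∧ ρ < 1 ∧ ∀ z ∈ disk, ρ < ‖z‖ → |F z| < ε := by
  set S := {z | z ∈ disk ∧ ε ≤ |F z|} with hS
  have hsub : closure S ⊆ Metric.closedBall 0 1 :=
    closure_minimal (fun z hz => Metric.ball_subset_closedBall hz.1) Metric.isClosed_closedBall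
  have hin : ∀ z ∈ closure S, ‖z‖ < 1 := by
    intro z hz
    have h1 : ‖z‖ ≤ 1 := by simpa using hsub hz
    refine lt_of_le_of_ne h1 fun he => ?_
    have h2 := h ⟨z, mem_sphere_zero_iff_norm.2 he⟩
    have h3 := h2.eventually (Metric.ball_mem_nhds 0 hε)
    rw [mem_closure_iff_frequently] at hz
    obtain ⟨w, hw, hw2⟩ := (hz.and_eventually (eventually_nhdsWithin_iff.1 h3)).exists
    have h4 := hw2 hw.1
    simp only [Real.dist_eq, sub_zero] at h4
    exact absurd hw.2 (not_le.2 h4)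
  have hcomp : IsCompact (closure S) :=
    (isCompact_closedBall (0 : ℂ) 1).of_isClosed_subset isClosed_closure hsub
  rcases (closure S).eq_empty_or_nonempty with he | hne
  · refine ⟨0, le_rfl, one_pos, fun z hz _ => ?_⟩
    by_contra! hc
    have : z ∈ closure S := subset_closure ⟨hz, hc⟩
    simp [he] at this
  · obtain ⟨z₀, hz₀, hmax⟩ := hcomp.exists_isMaxOn hne continuous_norm.continuousOn
    refine ⟨‖z₀‖, norm_nonneg _, hin z₀ hz₀, fun z hz hlt => ?_⟩
    by_contra! hc
    exact absurd (hmax (subset_closure ⟨hz, hc⟩)) (not_le.2 hlt)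

/-- The comparison function M/D is a strict supersolution. If D·w had a positive maximum M at an
interior point, w - M/D would have a maximum there, yet its ∂²/∂z∂z̄ at that point is M/D² > 0. -/
theorem IsSol.nonpos {w : ℂ → ℝ} (hw : IsSol w)
    (h : ∀ ε > 0, ∃ ρ < 1, ∀ z ∈ disk, ρ < ‖z‖ → (1 - ‖z‖ ^ 2) * w z ≤ ε) {z : ℂ}
    (hz : z ∈ disk) : w z ≤ 0 := by
  by_contra! hpos
  set F : ℂ → ℝ := fun z => (1 - ‖z‖ ^ 2) * w z with hF
  have hFz : 0 < F z := mul_pos (one_sub_sq_pos hz) hpos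
  obtain ⟨ρ, hρ, hbd⟩ := h (F z / 2) (by positivity)
  have hzρ : ‖z‖ ≤ ρ := by
    by_contra! hc
    have := hbd z hz hc
    change F z ≤ F z / 2 at this
    linarith
  have hball : Metric.closedBall (0 : ℂ) ρ ⊆ disk := Metric.closedBall_subset_ball hρ
  have hcont : ContinuousOn F (Metric.closedBall 0 ρ) :=
    (by fun_prop : Continuous fun z : ℂ => 1 - ‖z‖ ^ 2).continuousOn.mul
      (hw.1.continuousOn.mono hball)
  obtain ⟨z₀, hz₀, hmax⟩ := (isCompact_closedBall (0 : ℂ) ρ).exists_isMaxOn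
    ⟨z, by simpa using hzρ⟩ hcont
  have hz₀d := hball hz₀
  set M := F z₀ with hM
  have hMz : F z ≤ M := hmax (by simpa using hzρ : z ∈ Metric.closedBall (0 : ℂ) ρ)
  have hglob : ∀ y ∈ disk, F y ≤ M := by
    intro y hy
    by_cases hyρ : ‖y‖ ≤ ρ
    · exact hmax (by simpa using hyρ : y ∈ Metric.closedBall (0 : ℂ) ρ)
    · have := hbd y hy (not_le.1 hyρ)
      change F y ≤ _ at this
      linarith
  set f : ℂ → ℝ := fun y => w y - M * (1 - ‖y‖ ^ 2)⁻¹ with hf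
  have hinv : ContDiffOn ℝ ∞ (fun y : ℂ => (1 - ‖y‖ ^ 2)⁻¹) disk :=
    (contDiff_const.sub (contDiff_norm_sq ℝ)).contDiffOn.inv fun y hy => (one_sub_sq_pos hy).ne'
  have hfs : ContDiffOn ℝ ∞ f disk := hw.1.sub (contDiffOn_const.mul hinv)
  have hfneg : ∀ y ∈ disk, f y ≤ 0 := by
    intro y hy
    have h1 := hglob y hy
    have h2 := one_sub_sq_pos hy
    simp only [hf, hF] at h1 ⊢
    rw [← div_eq_mul_inv, sub_nonpos, le_div_iff₀ h2]; linarith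
  have hf0 : f z₀ = 0 := by
    have h2 := (one_sub_sq_pos hz₀d).ne'
    simp only [hf, hM, hF]
    field_simp; ring
  have hloc : IsLocalMax f z₀ := eventually_of_mem (disk_mem_nhds hz₀d) fun y hy => by
    rw [hf0]; exact hfneg y hy
  have hle := re_dzb_dz_nonpos_of_isLocalMax hfs hz₀d hloc
  have hcw := contDiffOn_cx hw.1
  have hcx : cx f = fun y => cx w y - M * (defect y)⁻¹ := by
    ext y; simp [cx, hf, defect_eq]
  have he : EqOn (dz (cx f)) (fun y => dz (cx w) y - M * (conj y * (defect y ^ 2)⁻¹)) disk := by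
    intro y hy
    rw [hcx, ((hasWirt_of_disk hcw hy).sub
      (((hasWirt_defect y).inv (defect_ne_zero hy)).const_mul (M : ℂ))).dz_eq]
    ring
  have hD := defect_ne_zero hz₀d
  have hval : dzb (dz (cx f)) z₀ = ((M / (1 - ‖z₀‖ ^ 2) ^ 2 : ℝ) : ℂ) := by
    rw [dzb_congr he hz₀d, ((hasWirt_of_disk (contDiffOn_dz hcw) hz₀d).sub
      (((hasWirt_conj z₀).mul ((hasWirt_defect z₀).pow_two.inv
        (pow_ne_zero 2 hD))).const_mul (M : ℂ))).dzb_eq, ← dz_dzb_comm hcw hz₀d, hw.2 z₀ hz₀d]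
    have hwM : (w z₀ : ℂ) = M * (defect z₀)⁻¹ := by
      have h2 := (one_sub_sq_pos hz₀d).ne'
      rw [defect_eq, ← Complex.ofReal_inv, ← Complex.ofReal_mul]
      congr 1
      simp only [hM, hF]; field_simp
    have hzz : z₀ * conj z₀ = 1 - defect z₀ := by simp [defect]
    rw [hwM, Complex.ofReal_div, Complex.ofReal_pow, ← defect_eq]
    field_simp
    linear_combination (-2 * M : ℂ) * hzz
  rw [hval, Complex.ofReal_re] at hle
  have hMpos : 0 < M := lt_of_lt_of_le hFz hMz
  have := one_sub_sq_pos hz₀d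
  have : 0 < M / (1 - ‖z₀‖ ^ 2) ^ 2 := by positivity
  linarith

theorem IsSol.eqOn {u v : ℂ → ℝ} (hu : IsSol u) (hv : IsSol v)
    (h : ∀ ζ : Circle, Tendsto (fun z => (1 - ‖z‖ ^ 2) * (u z - v z)) (𝓝[disk] (ζ : ℂ)) (𝓝 0)) :
    EqOn u v disk := by
  intro z hz
  have h1 : ∀ ε > 0, ∃ ρ < 1, ∀ z ∈ disk, ρ < ‖z‖ → |(1 - ‖z‖ ^ 2) * (u z - v z)| < ε :=
    fun ε hε => by
      obtain ⟨ρ, -, h1, h2⟩ := uniform_of_tendsto h hε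
      exact ⟨ρ, h1, h2⟩
  apply le_antisymm
  · refine sub_nonpos.1 ((hu.sub hv).nonpos (fun ε hε => ?_) hz)
    obtain ⟨ρ, h2, h3⟩ := h1 ε hε
    exact ⟨ρ, h2, fun y hy hlt => (le_abs_self _).trans (h3 y hy hlt).le⟩
  · refine sub_nonpos.1 ((hv.sub hu).nonpos (fun ε hε => ?_) hz)
    obtain ⟨ρ, h2, h3⟩ := h1 ε hε
    refine ⟨ρ, h2, fun y hy hlt => ?_⟩
    have := (neg_le_abs _).trans (h3 y hy hlt).le
    linarith

/-- If the radial derivative of a function is `o((1 - |z|²)⁻²)` at the circle, then the function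
is `o((1 - |z|²)⁻¹)`. -/
theorem tendsto_of_radial {w : ℂ → ℝ} (hw : ContDiffOn ℝ ∞ w disk)
    (h : ∀ ζ : Circle, Tendsto (fun z => (1 - ‖z‖ ^ 2) ^ 2 * fderiv ℝ w z z)
      (𝓝[disk] (ζ : ℂ)) (𝓝 0)) (ζ : Circle) :
    Tendsto (fun z => (1 - ‖z‖ ^ 2) * w z) (𝓝[disk] (ζ : ℂ)) (𝓝 0) := by
  rw [Metric.tendsto_nhds]
  intro ε hε
  -- Dividing by a radius s ≥ 1/2 turns ε/8 into ε/4; integrating ε/4 · (1 - s)⁻² and multiplying by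
  -- 1 - r² leaves at most ε/2.
  obtain ⟨ρ, hρ0, hρ1, hρ⟩ := uniform_of_tendsto h (ε := ε / 8) (by positivity)
  set r₁ := max ρ (1 / 2) with hr₁
  have hr₁lt : r₁ < 1 := max_lt hρ1 (by norm_num)
  have hr₁ge : 1 / 2 ≤ r₁ := le_max_right _ _
  set r₂ := (r₁ + 1) / 2 with hr₂
  have hball : Metric.closedBall (0 : ℂ) r₂ ⊆ disk :=
    Metric.closedBall_subset_ball (by linarith)
  obtain ⟨C, hC⟩ := (isCompact_closedBall (0 : ℂ) r₂).exists_bound_of_continuousOn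
    (hw.continuousOn.mono hball)
  have hlim : Tendsto (fun z : ℂ => (1 - ‖z‖ ^ 2) * C + ε / 2) (𝓝[disk] (ζ : ℂ)) (𝓝 (ε / 2)) := by
    have hc : Continuous fun z : ℂ => (1 - ‖z‖ ^ 2) * C + ε / 2 := by fun_prop
    have := (hc.tendsto (ζ : ℂ)).mono_left (nhdsWithin_le_nhds (s := disk))
    rw [Circle.norm_coe] at this
    simpa using this
  have hnorm : ∀ᶠ z : ℂ in 𝓝[disk] (ζ : ℂ), r₂ < ‖z‖ := by
    have := (continuous_norm.tendsto (ζ : ℂ)).mono_left (nhdsWithin_le_nhds (s := disk))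
    rw [Circle.norm_coe] at this
    exact this.eventually_const_lt (by linarith)
  filter_upwards [hlim.eventually_lt_const (half_lt_self hε), hnorm, self_mem_nhdsWithin]
    with z hz1 hz2 hz
  rw [Real.dist_eq, sub_zero, abs_mul, abs_of_pos (one_sub_sq_pos hz)]
  refine lt_of_le_of_lt ?_ hz1
  set r := ‖z‖ with hr
  have hrlt : r < 1 := mem_disk.1 hz
  have hr0 : 0 < r := by linarith
  set e : ℂ := z / r with he
  have hen : ‖e‖ = 1 := by
    rw [he, norm_div, Complex.norm_real, Real.norm_of_nonneg hr0.le, ← hr, div_self hr0.ne']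
  have hze : z = r * e := by
    have : (r : ℂ) ≠ 0 := by exact_mod_cast hr0.ne'
    rw [he]; field_simp
  have hline : ∀ s : ℝ, HasDerivAt (fun s : ℝ => (s : ℂ) * e) e s := fun s => by
    simpa using (Complex.ofRealCLM.hasDerivAt (x := s)).mul_const e
  have hmem : ∀ s : ℝ, 0 ≤ s → s < 1 → (s : ℂ) * e ∈ disk := fun s h0 h1 => by
    rw [mem_disk, norm_mul, hen, mul_one, Complex.norm_real, Real.norm_of_nonneg h0]; exact h1
  have hder : ∀ s : ℝ, 0 ≤ s → s < 1 →
      HasDerivAt (fun s : ℝ => w (s * e)) (fderiv ℝ w (s * e) e) s := fun s h0 h1 =>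
    (differentiableAt_of_disk hw (hmem s h0 h1)).hasFDerivAt.comp_hasDerivAt s (hline s)
  have hbound : ∀ s : ℝ, r₁ < s → s < 1 → |fderiv ℝ w (s * e) e| ≤ ε / 4 / (1 - s) ^ 2 := by
    intro s h1 h2
    have hs0 : 0 < s := by linarith
    have hns : ‖(s : ℂ) * e‖ = s := by
      rw [norm_mul, hen, mul_one, Complex.norm_real, Real.norm_of_nonneg hs0.le]
    have h3 := hρ (s * e) (hmem s hs0.le h2) (by rw [hns]; exact (le_max_left _ _).trans_lt h1)
    rw [hns, abs_mul, abs_of_nonneg (sq_nonneg _)] at h3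
    have h4 : fderiv ℝ w (s * e) (s * e) = s * fderiv ℝ w (s * e) e := by
      rw [← Complex.real_smul, map_smul, smul_eq_mul]
    rw [h4, abs_mul, abs_of_pos hs0] at h3
    rw [le_div_iff₀ (by nlinarith)]
    have h5 : (1 - s) ^ 2 ≤ (1 - s ^ 2) ^ 2 := by
      have : 1 - s ≤ 1 - s ^ 2 := by nlinarith
      have h6 : 0 ≤ 1 - s := by linarith
      gcongr
    have h7 := abs_nonneg (fderiv ℝ w (s * e) e)
    have h8 : (1 - s) ^ 2 * (1 / 2 * |fderiv ℝ w (s * e) e|) ≤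
        (1 - s ^ 2) ^ 2 * (s * |fderiv ℝ w (s * e) e|) := by
      gcongr; linarith
    linarith
  have hG : ∀ s : ℝ, s < 1 → HasDerivAt (fun s : ℝ => ε / 4 * (1 - s)⁻¹)
      (ε / 4 / (1 - s) ^ 2) s := fun s hs => by
    have := (((hasDerivAt_id s).const_sub 1).inv (by simp; linarith)).const_mul (ε / 4)
    refine this.congr_deriv ?_
    simp; ring
  have hwb : |w z - w (r₂ * e)| ≤ ε / 4 * (1 - r)⁻¹ - ε / 4 * (1 - r₂)⁻¹ := by
    have hI : ∀ s ∈ Icc r₂ r, r₁ < s ∧ s < 1 ∧ 0 ≤ s := fun s hs =>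
      ⟨by linarith [hs.1], by linarith [hs.2], by linarith [hs.1]⟩
    have hin := interior_subset (s := Icc r₂ r)
    -- The derivative bound makes σw minus the primitive nonincreasing along the ray; the signs σ =
    -- ±1 give the two sides of the absolute value.
    have mono : ∀ σ : ℝ, |σ| = 1 → σ * w (r₂ * e) - ε / 4 * (1 - r₂)⁻¹ ≥
        σ * w (r * e) - ε / 4 * (1 - r)⁻¹ := by
      intro σ hσ
      have hd : ∀ s ∈ Icc r₂ r, HasDerivAt (fun s : ℝ => σ * w (s * e) - ε / 4 * (1 - s)⁻¹)
          (σ * fderiv ℝ w (s * e) e - ε / 4 / (1 - s) ^ 2) s := fun s hs =>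
        ((hder s (hI s hs).2.2 (hI s hs).2.1).const_mul σ).sub (hG s (hI s hs).2.1)
      refine antitoneOn_of_deriv_nonpos (convex_Icc r₂ r)
        (fun s hs => (hd s hs).continuousAt.continuousWithinAt)
        (fun s hs => (hd s (hin hs)).differentiableAt.differentiableWithinAt)
        (fun s hs => ?_) (left_mem_Icc.2 hz2.le) (right_mem_Icc.2 hz2.le) hz2.le
      rw [(hd s (hin hs)).deriv, sub_nonpos]
      refine le_trans ?_ (hbound s (hI s (hin hs)).1 (hI s (hin hs)).2.1)
      refine (le_abs_self _).trans ?_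
      rw [abs_mul, hσ, one_mul]
    have m1 := mono 1 (by simp)
    have m2 := mono (-1) (by simp)
    rw [← hze] at m1 m2
    rw [abs_le]
    constructor <;> linarith
  have hCr : |w (r₂ * e)| ≤ C := by
    refine hC _ ?_
    rw [mem_closedBall_zero_iff, norm_mul, hen, mul_one, Complex.norm_real,
      Real.norm_of_nonneg (by linarith)]
  have hw1 : |w z| ≤ C + ε / 4 * (1 - r)⁻¹ := by
    have h1 : |w z| ≤ |w z - w (r₂ * e)| + |w (r₂ * e)| := by
      simpa using abs_add_le (w z - w (r₂ * e)) (w (r₂ * e))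
    have h2 : 0 ≤ ε / 4 * (1 - r₂)⁻¹ := by
      have : 0 < 1 - r₂ := by linarith
      positivity
    linarith
  have hr1 : 0 < 1 - r := by linarith
  calc (1 - r ^ 2) * |w z| ≤ (1 - r ^ 2) * (C + ε / 4 * (1 - r)⁻¹) := by
        gcongr
        nlinarith
    _ = (1 - r ^ 2) * C + ε / 4 * (1 + r) := by field_simp; ring
    _ ≤ (1 - r ^ 2) * C + ε / 2 := by nlinarith


/-! ### The Klein model -/

section Klein

variable {z η : ℂ}

theorem norm_toKlein (z : ℂ) : ‖toKlein z‖ = 2 * ‖z‖ / (1 + ‖z‖ ^ 2) := by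
  rw [toKlein, norm_mul, Complex.norm_real, Real.norm_of_nonneg (by positivity)]; ring

theorem one_sub_norm_toKlein_sq (z : ℂ) :
    1 - ‖toKlein z‖ ^ 2 = ((1 - ‖z‖ ^ 2) / (1 + ‖z‖ ^ 2)) ^ 2 := by
  rw [norm_toKlein]
  have : 1 + ‖z‖ ^ 2 ≠ 0 := by positivity
  field_simp; ring

theorem sqrt_toKlein (hz : z ∈ disk) :
    √(1 - ‖toKlein z‖ ^ 2) = (1 - ‖z‖ ^ 2) / (1 + ‖z‖ ^ 2) := by
  rw [one_sub_norm_toKlein_sq, Real.sqrt_sq]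
  exact div_nonneg (one_sub_sq_pos hz).le (by positivity)

theorem toKlein_mem_disk (hz : z ∈ disk) : toKlein z ∈ disk := by
  have h1 := one_sub_norm_toKlein_sq z
  have h2 : 0 < ((1 - ‖z‖ ^ 2) / (1 + ‖z‖ ^ 2)) ^ 2 :=
    pow_pos (div_pos (one_sub_sq_pos hz) (by positivity)) 2
  rw [mem_disk]
  nlinarith [norm_nonneg (toKlein z)]

theorem norm_ofKlein (η : ℂ) : ‖ofKlein η‖ = ‖η‖ / (1 + √(1 - ‖η‖ ^ 2)) := by
  rw [ofKlein, norm_mul, Complex.norm_real, Real.norm_of_nonneg (by positivity)]; ring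

theorem ofKlein_mem_disk (hη : η ∈ disk) : ofKlein η ∈ disk := by
  have h1 := Real.sqrt_pos.2 (one_sub_sq_pos hη)
  rw [mem_disk] at *
  rw [norm_ofKlein, div_lt_one (by positivity)]
  linarith

theorem one_add_norm_ofKlein_sq (hη : η ∈ disk) :
    1 + ‖ofKlein η‖ ^ 2 = 2 / (1 + √(1 - ‖η‖ ^ 2)) := by
  have h1 := Real.sqrt_pos.2 (one_sub_sq_pos hη)
  have h2 := Real.sq_sqrt (one_sub_sq_pos hη).le
  have h3 : ‖η‖ ^ 2 = 1 - √(1 - ‖η‖ ^ 2) ^ 2 := by rw [h2]; ring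
  rw [norm_ofKlein]
  generalize √(1 - ‖η‖ ^ 2) = s at *
  rw [div_pow, h3]
  field_simp; ring

theorem toKlein_ofKlein (hη : η ∈ disk) : toKlein (ofKlein η) = η := by
  have h1 := Real.sqrt_pos.2 (one_sub_sq_pos hη)
  rw [toKlein, one_add_norm_ofKlein_sq hη, ofKlein, ← mul_assoc, ← Complex.ofReal_mul]
  have : 2 / (2 / (1 + √(1 - ‖η‖ ^ 2))) * (1 / (1 + √(1 - ‖η‖ ^ 2))) = 1 := by field_simp
  rw [this, Complex.ofReal_one, one_mul]

theorem ofKlein_toKlein (hz : z ∈ disk) : ofKlein (toKlein z) = z := by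
  have h0 : 1 + ‖z‖ ^ 2 ≠ 0 := by positivity
  rw [ofKlein, sqrt_toKlein hz, toKlein, ← mul_assoc, ← Complex.ofReal_mul]
  have : 1 / (1 + (1 - ‖z‖ ^ 2) / (1 + ‖z‖ ^ 2)) * (2 / (1 + ‖z‖ ^ 2)) = 1 := by
    have : 1 + (1 - ‖z‖ ^ 2) / (1 + ‖z‖ ^ 2) = 2 / (1 + ‖z‖ ^ 2) := by field_simp; ring
    rw [this]; field_simp
  rw [this, Complex.ofReal_one, one_mul]

theorem tendsto_toKlein (ζ : Circle) :
    Tendsto toKlein (𝓝[disk] (ζ : ℂ)) (𝓝[disk] (ζ : ℂ)) := by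
  refine tendsto_nhdsWithin_of_tendsto_nhds_of_eventually_within _ ?_
    (eventually_of_mem self_mem_nhdsWithin fun z hz => toKlein_mem_disk hz)
  have hc : Continuous toKlein :=
    (Complex.continuous_ofReal.comp (continuous_const.div₀ (by fun_prop)
      fun z => (by positivity : (1 + ‖z‖ ^ 2 : ℝ) ≠ 0))).mul continuous_id
  have h1 : toKlein (ζ : ℂ) = ζ := by rw [toKlein, Circle.norm_coe]; norm_num
  have := (hc.tendsto (ζ : ℂ)).mono_left (nhdsWithin_le_nhds (s := disk))
  rwa [h1] at this

theorem tendsto_ofKlein (ζ : Circle) :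
    Tendsto ofKlein (𝓝[disk] (ζ : ℂ)) (𝓝[disk] (ζ : ℂ)) := by
  refine tendsto_nhdsWithin_of_tendsto_nhds_of_eventually_within _ ?_
    (eventually_of_mem self_mem_nhdsWithin fun z hz => ofKlein_mem_disk hz)
  have hc : Continuous ofKlein :=
    (Complex.continuous_ofReal.comp (continuous_const.div₀ (by fun_prop)
      fun z => (by positivity : (1 + √(1 - ‖z‖ ^ 2) : ℝ) ≠ 0))).mul continuous_id
  have h1 : ofKlein (ζ : ℂ) = ζ := by rw [ofKlein, Circle.norm_coe]; norm_num
  have := (hc.tendsto (ζ : ℂ)).mono_left (nhdsWithin_le_nhds (s := disk))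
  rwa [h1] at this

theorem ubar_toKlein (u : ℂ → ℝ) (hz : z ∈ disk) :
    ubar u (toKlein z) = (1 - ‖z‖ ^ 2) / (1 + ‖z‖ ^ 2) * u z := by
  rw [ubar, sqrt_toKlein hz, ofKlein_toKlein hz]

theorem tendsto_ubar_iff {u : ℂ → ℝ} {ζ : Circle} {c : ℝ} :
    Tendsto (ubar u) (𝓝[disk] (ζ : ℂ)) (𝓝 c) ↔
      Tendsto (fun z => (1 - ‖z‖ ^ 2) / (1 + ‖z‖ ^ 2) * u z) (𝓝[disk] (ζ : ℂ)) (𝓝 c) := by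
  constructor
  · intro h
    refine (h.comp (tendsto_toKlein ζ)).congr' ?_
    filter_upwards [self_mem_nhdsWithin] with z hz using ubar_toKlein u hz
  · intro h
    refine (h.comp (tendsto_ofKlein ζ)).congr' ?_
    filter_upwards [self_mem_nhdsWithin] with η hη
    simp only [Function.comp]
    rw [← ubar_toKlein u (ofKlein_mem_disk hη), toKlein_ofKlein hη]

theorem fderiv_toKlein (z v : ℂ) : fderiv ℝ toKlein z v =
    ((2 / (1 + ‖z‖ ^ 2) : ℝ) : ℂ) * v
      - ((4 * inner ℝ z v / (1 + ‖z‖ ^ 2) ^ 2 : ℝ) : ℂ) * z := by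
  have h0 : 1 + ‖z‖ ^ 2 ≠ 0 := by positivity
  have h1 := (hasStrictFDerivAt_norm_sq z).hasFDerivAt.const_add 1
  have h2 := ((hasDerivAt_inv h0).comp_hasFDerivAt z h1).const_mul (2 : ℝ)
  have h3 := (Complex.ofRealCLM.hasFDerivAt.comp z h2).mul (hasFDerivAt_id z)
  have h4 : fderiv ℝ toKlein z = _ := HasFDerivAt.fderiv h3
  rw [h4]
  simp
  field_simp
  ring

end Klein

/-! ### Existence and uniqueness of the mean surface -/

theorem isMeanGraph_pois {φ : Circle → ℝ} (hφ : Continuous φ) : IsMeanGraph φ (pois φ) :=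
  isMeanGraph_iff.2 ⟨isSol_pois hφ, fun ζ => tendsto_ubar_iff.2 (tendsto_pois hφ ζ)⟩

theorem IsMeanGraph.eqOn {φ : Circle → ℝ} {u v : ℂ → ℝ} (hu : IsMeanGraph φ u)
    (hv : IsMeanGraph φ v) : EqOn u v disk := by
  rw [isMeanGraph_iff] at hu hv
  refine hu.1.eqOn hv.1 fun ζ => ?_
  have h1 := (tendsto_ubar_iff.1 (hu.2 ζ)).sub (tendsto_ubar_iff.1 (hv.2 ζ))
  have hc : Continuous fun z : ℂ => 1 + ‖z‖ ^ 2 := by fun_prop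
  have h2 := ((hc.tendsto (ζ : ℂ)).mono_left (nhdsWithin_le_nhds (s := disk))).mul h1
  simp only [sub_self, mul_zero] at h2
  refine h2.congr fun z => ?_
  have : 1 + ‖z‖ ^ 2 ≠ 0 := by positivity
  field_simp

/-- The chosen function is some mean graph, and uniqueness identifies it with the Poisson integral
on the disk. -/
theorem meanFun_eqOn {φ : Circle → ℝ} (hφ : Continuous φ) : EqOn (meanFun φ) (pois φ) disk :=
  (Classical.epsilon_spec (p := IsMeanGraph φ) ⟨_, isMeanGraph_pois hφ⟩).eqOn (isMeanGraph_pois hφ)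

theorem grad_congr {u v : ℂ → ℝ} (h : EqOn u v disk) :
    EqOn (grad Complex.basisOneI hyp u) (grad Complex.basisOneI hyp v) disk := by
  intro z hz
  rw [grad, grad, (disk_eqOn_eventuallyEq h hz).fderiv_eq]

/-! ### Boundary values of vector fields -/

section Boundary

variable {X : Circle → ℂ}

theorem eq_mul_supportFun (hXt : IsTangent X) (ζ : Circle) :
    X ζ = Complex.I * ζ * supportFun X ζ := by
  have h0 : Complex.I * (ζ : ℂ) ≠ 0 := mul_ne_zero Complex.I_ne_zero (Circle.coe_ne_zero ζ)
  have h1 : (X ζ / (Complex.I * ζ)).im = 0 := by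
    have h := hXt ζ
    rw [Complex.inner, conj_circle] at h
    have : X ζ / (Complex.I * ζ) = -Complex.I * ((ζ : ℂ)⁻¹ * X ζ) := by
      have := Circle.coe_ne_zero ζ
      field_simp
      linear_combination X ζ * Complex.I_sq
    rw [this]
    simp at h ⊢
    linarith
  have h2 : ((supportFun X ζ : ℝ) : ℂ) = X ζ / (Complex.I * ζ) := by
    apply Complex.ext
    · simp [supportFun]
    · simpa using h1.symm
  rw [h2]; field_simp

theorem continuous_supportFun (hX : Continuous X) : Continuous (supportFun X) :=
  Complex.continuous_re.comp (hX.div₀ (continuous_const.mul continuous_circle_coe)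
    fun ζ => mul_ne_zero Complex.I_ne_zero (Circle.coe_ne_zero ζ))

theorem HL_eqOn (hX : Continuous X) : EqOn (HL X)
    (fun z => Complex.I * grad Complex.basisOneI hyp (pois (supportFun X)) z) disk :=
  fun z hz => by rw [HL, grad_congr (meanFun_eqOn (continuous_supportFun hX)) hz]

/-- A vector field with tangent boundary values in the Poincaré model has the same boundary
values in the Klein model. -/
theorem extendsTo_of_tendsto {V : ℂ → ℂ} (hXt : IsTangent X)
    (h : ∀ ζ : Circle, Tendsto V (𝓝[disk] (ζ : ℂ)) (𝓝 (X ζ))) (m : DiskModel) :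
    ExtendsTo m V X := by
  intro ζ
  cases m with
  | poincare => exact h ζ
  | klein =>
    have hz : Tendsto (fun z : ℂ => z) (𝓝[disk] (ζ : ℂ)) (𝓝 (ζ : ℂ)) :=
      tendsto_id.mono_left nhdsWithin_le_nhds
    have hr : Continuous fun z : ℂ => ((2 / (1 + ‖z‖ ^ 2) : ℝ) : ℂ) :=
      Complex.continuous_ofReal.comp (continuous_const.div₀ (by fun_prop)
        fun z => (by positivity : (1 + ‖z‖ ^ 2 : ℝ) ≠ 0))
    have h1 := ((hr.tendsto (ζ : ℂ)).mono_left (nhdsWithin_le_nhds (s := disk))).mul (h ζ)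
    have h2 : Tendsto (fun z => ((4 * inner ℝ z (V z) / (1 + ‖z‖ ^ 2) ^ 2 : ℝ) : ℂ) * z)
        (𝓝[disk] (ζ : ℂ)) (𝓝 (((4 * inner ℝ (ζ : ℂ) (X ζ) / (1 + ‖(ζ : ℂ)‖ ^ 2) ^ 2 : ℝ) : ℂ)
          * (ζ : ℂ))) :=
      ((Complex.continuous_ofReal.tendsto _).comp (((hz.inner (h ζ)).const_mul 4).div
        (((hz.norm.pow 2).const_add 1).pow 2) (by positivity))).mul hz
    have h3 := h1.sub h2
    -- Tangency removes the radial correction in the limit, and the factor 2/(1 + |ζ|²) becomes 1.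
    rw [hXt ζ, Circle.norm_coe] at h3
    norm_num at h3
    refine (h3.comp (tendsto_ofKlein ζ)).congr fun η => ?_
    simp [DiskModel.express, fderiv_toKlein]

/-- The tangential part of a vector field that extends to `X` tends to the support function. -/
theorem ExtendsTo.tendsto_tangential {V : ℂ → ℂ} {m : DiskModel} (hXt : IsTangent X)
    (h : ExtendsTo m V X) (ζ : Circle) :
    Tendsto (fun z => (V z * conj (Complex.I * z)).re) (𝓝[disk] (ζ : ℂ))
      (𝓝 (supportFun X ζ)) := by
  have hz : Tendsto (fun z : ℂ => conj (Complex.I * z)) (𝓝[disk] (ζ : ℂ))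
      (𝓝 (conj (Complex.I * (ζ : ℂ)))) :=
    ((Complex.continuous_conj.comp (continuous_const.mul continuous_id)).tendsto
      (ζ : ℂ)).mono_left nhdsWithin_le_nhds
  have hval : (X ζ * conj (Complex.I * (ζ : ℂ))).re = supportFun X ζ := by
    have h3 := Circle.coe_ne_zero ζ
    have : X ζ * conj (Complex.I * (ζ : ℂ)) = supportFun X ζ := by
      rw [eq_mul_supportFun hXt ζ, map_mul, conj_circle, Complex.conj_I]
      field_simp
      linear_combination (-(supportFun X ζ : ℂ)) * Complex.I_sq
    rw [this, Complex.ofReal_re]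
  cases m with
  | poincare =>
    have := (Complex.continuous_re.tendsto _).comp ((h ζ).mul hz)
    rw [hval] at this
    exact this
  | klein =>
    have h1 : Tendsto (fun z => fderiv ℝ toKlein z (V z)) (𝓝[disk] (ζ : ℂ)) (𝓝 (X ζ)) := by
      refine ((h ζ).comp (tendsto_toKlein ζ)).congr' ?_
      filter_upwards [self_mem_nhdsWithin] with z hz
      simp [DiskModel.express, ofKlein_toKlein hz]
    have h2 := (Complex.continuous_re.tendsto _).comp (h1.mul hz)
    rw [hval] at h2
    -- The correction term in the differential of `toKlein` is a real multiple of z, hence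
    -- orthogonal to iz. The tangential part is only scaled by 2/(1 + |z|²), which this factor
    -- undoes.
    have hc : Continuous fun z : ℂ => (1 + ‖z‖ ^ 2) / 2 := by fun_prop
    have h3 := ((hc.tendsto (ζ : ℂ)).mono_left (nhdsWithin_le_nhds (s := disk))).mul h2
    rw [Circle.norm_coe] at h3
    norm_num at h3
    refine h3.congr fun z => ?_
    have : 1 + ‖z‖ ^ 2 ≠ 0 := by positivity
    simp only [fderiv_toKlein]
    generalize 4 * inner ℝ z (V z) / (1 + ‖z‖ ^ 2) ^ 2 = c
    generalize 1 + ‖z‖ ^ 2 = n at *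
    simp only [map_mul, Complex.conj_I, Complex.mul_re, Complex.sub_re, Complex.sub_im,
      Complex.mul_im, Complex.ofReal_re, Complex.ofReal_im, Complex.conj_re, Complex.conj_im,
      Complex.neg_re, Complex.neg_im, Complex.I_re, Complex.I_im]
    field_simp
    ring

theorem extendsTo_HL (hX : Continuous X) (hXt : IsTangent X) (m : DiskModel) :
    ExtendsTo m (HL X) X := by
  refine extendsTo_of_tendsto hXt (fun ζ => ?_) m
  rw [eq_mul_supportFun hXt ζ]
  refine (tendsto_grad_pois (continuous_supportFun hX) ζ).congr' ?_
  filter_upwards [self_mem_nhdsWithin] with z hz using (HL_eqOn hX hz).symm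

theorem isHarmonicLagrangian_HL (hX : Continuous X) : IsHarmonicLagrangian (HL X) := by
  have hu : IsSol (meanFun (supportFun X)) :=
    (isMeanGraph_iff.1 (Classical.epsilon_spec (p := IsMeanGraph (supportFun X))
      ⟨_, isMeanGraph_pois (continuous_supportFun hX)⟩)).1
  exact hu.isHarmonicLagrangian

/-- The tangential part of J grad u is the radial part of grad u: this is how boundary values of the
field reach u. -/
theorem IsSol.tangential {u : ℂ → ℝ} (hu : IsSol u) {z : ℂ} (hz : z ∈ disk) :
    4 * (Complex.I * (defect z ^ 2 / 2 * dzb (cx u) z) * conj (Complex.I * z)).re =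
      (1 - ‖z‖ ^ 2) ^ 2 * fderiv ℝ u z z := by
  rw [fderiv_real_apply (differentiableAt_of_disk hu.1 hz)]
  have : Complex.I * (defect z ^ 2 / 2 * dzb (cx u) z) * conj (Complex.I * z) =
      (((1 - ‖z‖ ^ 2) ^ 2 / 2 : ℝ) : ℂ) * (dzb (cx u) z * conj z) := by
    rw [map_mul, Complex.conj_I, defect_eq]
    push_cast
    linear_combination (-((1 - (‖z‖ : ℂ) ^ 2) ^ 2 / 2) * (dzb (cx u) z * conj z)) * Complex.I_sq
  rw [this, Complex.re_ofReal_mul]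
  ring

/-- A harmonic Lagrangian vector field is determined by its boundary values. -/
theorem IsHarmonicLagrangian.eqOn_HL {V : ℂ → ℂ} {m : DiskModel} (hV : IsHarmonicLagrangian V)
    (hX : Continuous X) (hXt : IsTangent X) (hVX : ExtendsTo m V X) : EqOn V (HL X) disk := by
  obtain ⟨u, hu, hVu⟩ := hV.exists_isSol
  have hφ := continuous_supportFun hX
  have hp := isSol_pois hφ
  have hH : ∀ z ∈ disk, HL X z =
      Complex.I * (defect z ^ 2 / 2 * dzb (cx (pois (supportFun X))) z) := fun z hz => by
    rw [HL_eqOn hX hz]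
    simp only
    rw [grad_hyp (differentiableAt_of_disk hp.1 hz) hz]
  have hw := hu.sub hp
  have htan : ∀ ζ : Circle, Tendsto (fun z => (1 - ‖z‖ ^ 2) ^ 2 *
      fderiv ℝ (fun z => u z - pois (supportFun X) z) z z) (𝓝[disk] (ζ : ℂ)) (𝓝 0) := by
    intro ζ
    have h1 := ((hVX.tendsto_tangential hXt ζ).sub
      ((extendsTo_HL hX hXt m).tendsto_tangential hXt ζ)).const_mul 4
    rw [sub_self, mul_zero] at h1
    refine h1.congr' ?_
    filter_upwards [self_mem_nhdsWithin] with z hz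
    rw [mul_sub, hVu z hz, hH z hz, hu.tangential hz, hp.tangential hz,
      fderiv_fun_sub (differentiableAt_of_disk hu.1 hz) (differentiableAt_of_disk hp.1 hz)]
    simp; ring
  -- Equal tangential limits make the radial derivative of the difference o(D⁻²), so the difference
  -- is o(D⁻¹) and the maximum principle applies.
  have heq := hu.eqOn hp (tendsto_of_radial hw.1 htan)
  intro z hz
  have hcx : EqOn (cx u) (cx (pois (supportFun X))) disk := fun w hw => by
    simp only [cx, heq hw]
  rw [hVu z hz, hH z hz, dzb_congr hcx hz]

end Boundary


/-! ### Affine functions -/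

/-- The affine function `η ↦ α + ⟪β, η⟫`. -/
noncomputable def aff (α : ℝ) (β : ℂ) : ℂ →ᵃ[ℝ] ℝ :=
  (innerSL ℝ β).toLinearMap.toAffineMap + AffineMap.const ℝ ℂ α

@[simp] theorem aff_apply (α : ℝ) (β η : ℂ) : aff α β η = inner ℝ β η + α := rfl

theorem exists_eq_aff (a : ℂ →ᵃ[ℝ] ℝ) : ∃ α β, a = aff α β := by
  refine ⟨a 0, ⟨a.linear 1, a.linear Complex.I⟩, ?_⟩
  ext η
  have h1 : a η = a.linear η + a 0 := by
    have := a.map_vadd 0 η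
    simpa using this
  have h2 : a.linear η = η.re * a.linear 1 + η.im * a.linear Complex.I := by
    have : η = η.re • (1 : ℂ) + η.im • Complex.I := by apply Complex.ext <;> simp
    conv_lhs => rw [this, map_add, map_smul, map_smul]
    simp
  rw [h1, h2, aff_apply, Complex.inner]
  simp

/-- The solution of `Δu = 2u` with boundary values the affine function `aff α β`. -/
noncomputable def ell (α : ℝ) (β z : ℂ) : ℝ :=
  (α * (1 + ‖z‖ ^ 2) + 2 * inner ℝ β z) / (1 - ‖z‖ ^ 2)

section Ell

variable {α : ℝ} {β z : ℂ}

theorem ell_eq_aff (α : ℝ) (β : ℂ) (hz : z ∈ disk) :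
    (1 - ‖z‖ ^ 2) / (1 + ‖z‖ ^ 2) * ell α β z = aff α β (toKlein z) := by
  have h1 := (one_sub_sq_pos hz).ne'
  have h2 : 1 + ‖z‖ ^ 2 ≠ 0 := by positivity
  rw [ell, aff_apply, toKlein, ← Complex.real_smul, real_inner_smul_right]
  field_simp
  ring

theorem cx_ell (α : ℝ) (β z : ℂ) :
    cx (ell α β) z = (α * (1 + z * conj z) + (conj β * z + β * conj z)) * (defect z)⁻¹ := by
  have h : ((2 * inner ℝ β z : ℝ) : ℂ) = conj β * z + β * conj z := by
    rw [Complex.inner, ← Complex.add_conj]; simp; ring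
  rw [cx, ell, Complex.ofReal_div, Complex.ofReal_add, h, defect_eq, Complex.mul_conj']
  push_cast
  ring

theorem contDiffOn_ell (α : ℝ) (β : ℂ) : ContDiffOn ℝ ∞ (ell α β) disk := by
  have h1 : ContDiff ℝ ∞ fun z : ℂ => α * (1 + ‖z‖ ^ 2) + 2 * inner ℝ β z :=
    (contDiff_const.mul (contDiff_const.add (contDiff_norm_sq ℝ))).add
      (contDiff_const.mul (innerSL ℝ β).contDiff)
  exact h1.contDiffOn.div (contDiff_const.sub (contDiff_norm_sq ℝ)).contDiffOn
    fun z hz => (one_sub_sq_pos hz).ne'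

theorem dzb_ell (α : ℝ) (β : ℂ) (hz : z ∈ disk) :
    dzb (cx (ell α β)) z = (α * z + β + z * ell α β z) * (defect z)⁻¹ := by
  have hD := defect_ne_zero hz
  have hw := ((((hasWirt_const 1 z).add ((hasWirt_id z).mul (hasWirt_conj z))).const_mul
    (α : ℂ)).add (((hasWirt_id z).const_mul (conj β)).add
      ((hasWirt_conj z).const_mul β))).mul ((hasWirt_defect z).inv hD)
  have h1 : cx (ell α β) = fun z => (α * (1 + z * conj z) + (conj β * z + β * conj z))
      * (defect z)⁻¹ := funext (cx_ell α β)
  have h2 : (ell α β z : ℂ) = _ := cx_ell α β z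
  rw [h1, hw.dzb_eq, h2]
  field_simp
  ring

theorem dzb_ell_eq (α : ℝ) (β : ℂ) (hz : z ∈ disk) :
    dzb (cx (ell α β)) z = (β + (2 * α * z + conj β * (z * z))) * (defect z ^ 2)⁻¹ := by
  have hD := defect_ne_zero hz
  have h2 : (ell α β z : ℂ) = _ := cx_ell α β z
  have hzz : z * conj z = 1 - defect z := by simp [defect]
  rw [dzb_ell α β hz, h2]
  field_simp
  linear_combination (α * z + β) * hzz

theorem isSol_ell (α : ℝ) (β : ℂ) : IsSol (ell α β) := by
  refine ⟨contDiffOn_ell α β, fun z hz => ?_⟩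
  have hD := defect_ne_zero hz
  have he : EqOn (dzb (cx (ell α β)))
    (fun z => (β + (2 * α * z + conj β * (z * z))) * (defect z ^ 2)⁻¹) disk :=
    fun w hw => dzb_ell_eq α β hw
  have hw := ((hasWirt_const β z).add (((hasWirt_id z).const_mul (2 * (α : ℂ))).add
    (((hasWirt_id z).mul (hasWirt_id z)).const_mul (conj β)))).mul
      ((hasWirt_defect z).pow_two.inv (pow_ne_zero 2 hD))
  have h2 : (ell α β z : ℂ) = _ := cx_ell α β z
  have hzz : z * conj z = 1 - defect z := by simp [defect]
  rw [dz_congr he hz, hw.dz_eq, h2]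
  field_simp
  linear_combination (2 * α + 2 * conj β * z) * hzz

/-- The gradient is the holomorphic polynomial (β + 2αz + β̄z²)/2; its image under J is a Killing
field. -/
theorem dzb_grad_ell (α : ℝ) (β : ℂ) (hz : z ∈ disk) :
    dzb (grad Complex.basisOneI hyp (ell α β)) z = 0 := by
  have he : EqOn (grad Complex.basisOneI hyp (ell α β))
      (fun z => 1 / 2 * (β + (2 * α * z + conj β * (z * z)))) disk := fun w hw => by
    have hD := defect_ne_zero hw
    rw [grad_hyp (differentiableAt_of_disk (contDiffOn_ell α β) hw) hw, dzb_ell_eq α β hw]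
    field_simp
  have hw := (((hasWirt_const β z).add (((hasWirt_id z).const_mul (2 * (α : ℂ))).add
    (((hasWirt_id z).mul (hasWirt_id z)).const_mul (conj β)))).const_mul (1 / 2))
  rw [dzb_congr he hz, hw.dzb_eq]
  ring

theorem isMeanGraph_ell (α : ℝ) (β : ℂ) : IsMeanGraph (fun ζ => aff α β ζ) (ell α β) := by
  refine isMeanGraph_iff.2 ⟨isSol_ell α β, fun ζ => tendsto_ubar_iff.2 ?_⟩
  have hc : Continuous (aff α β) := by
    have : Continuous fun η : ℂ => inner ℝ β η + α := by fun_prop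
    exact this
  have h1 := ((hc.tendsto (ζ : ℂ)).mono_left nhdsWithin_le_nhds).comp (tendsto_toKlein ζ)
  refine h1.congr' ?_
  filter_upwards [self_mem_nhdsWithin] with z hz using (ell_eq_aff α β hz).symm

theorem continuous_aff_circle (α : ℝ) (β : ℂ) : Continuous fun ζ : Circle => aff α β ζ := by
  have : Continuous fun ζ : Circle => inner ℝ β (ζ : ℂ) + α :=
    (continuous_const.inner continuous_circle_coe).add continuous_const
  exact this

/-- Uniqueness of the mean graph replaces the evaluation of the integral. -/
theorem pois_aff (α : ℝ) (β : ℂ) (hz : z ∈ disk) :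
    pois (fun ζ => aff α β ζ) z = ell α β z :=
  (isMeanGraph_pois (continuous_aff_circle α β)).eqOn (isMeanGraph_ell α β) hz

end Ell

/-! ### The norm of `∂̄ HL(X)` is bounded by the width -/

section Width

variable {φ : Circle → ℝ} {z : ℂ}

theorem pois_sub {ψ : Circle → ℝ} (hφ : Continuous φ) (hψ : Continuous ψ) (hz : z ∈ disk) :
    pois (fun ζ => φ ζ - ψ ζ) z = pois φ z - pois ψ z := by
  rw [pois, pois, pois, ← avg_sub (continuous_kernel hφ _ hz) (continuous_kernel hψ _ hz)]
  congr 1; ext ζ; ring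

theorem dzb_grad_sub {u v : ℂ → ℝ} (hu : ContDiffOn ℝ ∞ u disk) (hv : ContDiffOn ℝ ∞ v disk)
    (hz : z ∈ disk) : dzb (grad Complex.basisOneI hyp fun z => u z - v z) z =
      dzb (grad Complex.basisOneI hyp u) z - dzb (grad Complex.basisOneI hyp v) z := by
  have he : EqOn (grad Complex.basisOneI hyp fun z => u z - v z)
      (fun z => grad Complex.basisOneI hyp u z - grad Complex.basisOneI hyp v z) disk := by
    intro w hw
    have h1 : fderiv ℝ (fun z => u z - v z) w = fderiv ℝ u w - fderiv ℝ v w :=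
      fderiv_fun_sub (differentiableAt_of_disk hu hw) (differentiableAt_of_disk hv hw)
    simp only [grad, h1, _root_.sub_apply, mul_sub, Finset.sum_sub_distrib, sub_smul]
  rw [dzb_congr he hz, ((DifferentiableAt.hasWirt (hasWirt_grad hu hz).differentiableAt).sub
    (DifferentiableAt.hasWirt (hasWirt_grad hv hz).differentiableAt)).dzb_eq]

theorem dzb_grad_congr {u v : ℂ → ℝ} (h : EqOn u v disk) (hz : z ∈ disk) :
    dzb (grad Complex.basisOneI hyp u) z = dzb (grad Complex.basisOneI hyp v) z :=
  dzb_congr (grad_congr h) hz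

/-- φ - a is nonnegative and has the same ∂̄ as φ, so the kernel estimate applies to it. -/
theorem norm_dzb_grad_le_of_le (hφ : Continuous φ) {a : ℂ →ᵃ[ℝ] ℝ} (ha : ∀ ζ : Circle, a ζ ≤ φ ζ)
    (hz : z ∈ disk) : (1 - ‖z‖ ^ 2) / (1 + ‖z‖ ^ 2) *
      ‖dzb (grad Complex.basisOneI hyp (pois φ)) z‖ ≤
      3 * ((1 - ‖z‖ ^ 2) / (1 + ‖z‖ ^ 2) * pois φ z - a (toKlein z)) := by
  obtain ⟨α, β, rfl⟩ := exists_eq_aff a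
  have ca := continuous_aff_circle α β
  have h1 := norm_dzb_grad_pois_le (hφ.sub ca) (fun ζ => sub_nonneg.2 (ha ζ)) hz
  have he : EqOn (pois fun ζ => φ ζ - aff α β ζ) (fun z => pois φ z - ell α β z) disk :=
    fun w hw => by simp only [pois_sub hφ ca hw, pois_aff α β hw]
  have h1' : ‖dzb (grad Complex.basisOneI hyp (pois fun ζ => φ ζ - aff α β ζ)) z‖ ≤
      3 * pois (fun ζ => φ ζ - aff α β ζ) z := h1
  rw [dzb_grad_congr he hz, dzb_grad_sub (isSol_pois hφ).1 (contDiffOn_ell α β) hz,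
    dzb_grad_ell α β hz, sub_zero, he hz] at h1'
  rw [← ell_eq_aff α β hz, ← mul_sub, mul_left_comm]
  exact mul_le_mul_of_nonneg_left h1' (div_nonneg (one_sub_sq_pos hz).le (by positivity))

theorem norm_dzb_grad_le_of_ge (hφ : Continuous φ) {a : ℂ →ᵃ[ℝ] ℝ} (ha : ∀ ζ : Circle, φ ζ ≤ a ζ)
    (hz : z ∈ disk) : (1 - ‖z‖ ^ 2) / (1 + ‖z‖ ^ 2) *
      ‖dzb (grad Complex.basisOneI hyp (pois φ)) z‖ ≤
      3 * (a (toKlein z) - (1 - ‖z‖ ^ 2) / (1 + ‖z‖ ^ 2) * pois φ z) := by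
  obtain ⟨α, β, rfl⟩ := exists_eq_aff a
  have ca := continuous_aff_circle α β
  have h1 := norm_dzb_grad_pois_le (ca.sub hφ) (fun ζ => sub_nonneg.2 (ha ζ)) hz
  have he : EqOn (pois fun ζ => aff α β ζ - φ ζ) (fun z => ell α β z - pois φ z) disk :=
    fun w hw => by simp only [pois_sub ca hφ hw, pois_aff α β hw]
  have h1' : ‖dzb (grad Complex.basisOneI hyp (pois fun ζ => aff α β ζ - φ ζ)) z‖ ≤
      3 * pois (fun ζ => aff α β ζ - φ ζ) z := h1
  rw [dzb_grad_congr he hz, dzb_grad_sub (contDiffOn_ell α β) (isSol_pois hφ).1 hz,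
    dzb_grad_ell α β hz, zero_sub, norm_neg, he hz] at h1'
  rw [← ell_eq_aff α β hz, ← mul_sub, mul_left_comm]
  exact mul_le_mul_of_nonneg_left h1' (div_nonneg (one_sub_sq_pos hz).le (by positivity))

theorem exists_const_bounds (hφ : Continuous φ) :
    ∃ C : ℝ, (∀ ζ, aff (-C) 0 (ζ : Circle) ≤ φ ζ) ∧ ∀ ζ, φ ζ ≤ aff C 0 (ζ : Circle) := by
  obtain ⟨C, hC⟩ := (isCompact_range hφ).isBounded.exists_norm_le
  refine ⟨C, fun ζ => ?_, fun ζ => ?_⟩ <;>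
  · have := abs_le.1 (hC _ (mem_range_self ζ))
    simp [aff_apply]; linarith

/-- If `t` bounds the gap between any affine majorant and any affine minorant from below, then it
bounds the gap between the hulls. -/
theorem le_upperHull_sub_lowerHull (hφ : Continuous φ) {η : ℂ} {t : ℝ}
    (h : ∀ a b : ℂ →ᵃ[ℝ] ℝ, (∀ ζ : Circle, a ζ ≤ φ ζ) → (∀ ζ : Circle, φ ζ ≤ b ζ) →
      a η + t ≤ b η) : t ≤ upperHull φ η - lowerHull φ η := by
  obtain ⟨C, hC1, hC2⟩ := exists_const_bounds hφ
  have h1 : lowerHull φ η + t ≤ upperHull φ η := by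
    refine le_csInf ⟨_, aff C 0, hC2, rfl⟩ ?_
    rintro _ ⟨b, hb, rfl⟩
    rw [← le_sub_iff_add_le]
    refine csSup_le ⟨_, aff (-C) 0, hC1, rfl⟩ ?_
    rintro _ ⟨a, ha, rfl⟩
    rw [le_sub_iff_add_le]
    exact h a b ha hb
  linarith

/-- Affine functions are reproduced by `pois`, so positivity of the Poisson kernel carries the
inequality inside. -/
theorem affine_le_of_circle {a b : ℂ →ᵃ[ℝ] ℝ} (h : ∀ ζ : Circle, a ζ ≤ b ζ) {η : ℂ}
    (hη : η ∈ disk) : a η ≤ b η := by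
  obtain ⟨α, β, rfl⟩ := exists_eq_aff a
  obtain ⟨α', β', rfl⟩ := exists_eq_aff b
  have hz := ofKlein_mem_disk hη
  have hD := one_sub_sq_pos hz
  have h1 : pois (fun ζ => aff α β ζ) (ofKlein η) ≤ pois (fun ζ => aff α' β' ζ) (ofKlein η) := by
    refine avg_mono (continuous_kernel (continuous_aff_circle α β) _ hz)
      (continuous_kernel (continuous_aff_circle α' β') _ hz) fun ζ => ?_
    exact mul_le_mul_of_nonneg_left (h ζ) (by positivity)
  rw [pois_aff α β hz, pois_aff α' β' hz] at h1
  have h2 := mul_le_mul_of_nonneg_left h1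
    (div_nonneg hD.le (by positivity) : 0 ≤ (1 - ‖ofKlein η‖ ^ 2) / (1 + ‖ofKlein η‖ ^ 2))
  rwa [ell_eq_aff α β hz, ell_eq_aff α' β' hz, toKlein_ofKlein hη] at h2

theorem le_lowerHull (hφ : Continuous φ) {a : ℂ →ᵃ[ℝ] ℝ} (ha : ∀ ζ : Circle, a ζ ≤ φ ζ) {η : ℂ}
    (hη : η ∈ disk) : a η ≤ lowerHull φ η := by
  obtain ⟨C, hC1, hC2⟩ := exists_const_bounds hφ
  refine le_csSup ⟨aff C 0 η, ?_⟩ ⟨a, ha, rfl⟩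
  rintro _ ⟨b, hb, rfl⟩
  exact affine_le_of_circle (fun ζ => (hb ζ).trans (hC2 ζ)) hη

theorem upperHull_le (hφ : Continuous φ) {a : ℂ →ᵃ[ℝ] ℝ} (ha : ∀ ζ : Circle, φ ζ ≤ a ζ) {η : ℂ}
    (hη : η ∈ disk) : upperHull φ η ≤ a η := by
  obtain ⟨C, hC1, hC2⟩ := exists_const_bounds hφ
  refine csInf_le ⟨aff (-C) 0 η, ?_⟩ ⟨a, ha, rfl⟩
  rintro _ ⟨b, hb, rfl⟩
  exact affine_le_of_circle (fun ζ => (hC1 ζ).trans (hb ζ)) hη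

theorem lowerHull_le_upperHull (hφ : Continuous φ) {η : ℂ} (hη : η ∈ disk) :
    0 ≤ upperHull φ η - lowerHull φ η :=
  le_upperHull_sub_lowerHull hφ fun a b ha hb => by
    rw [add_zero]; exact affine_le_of_circle (fun ζ => (ha ζ).trans (hb ζ)) hη

theorem norm_dzb_HL {X : Circle → ℂ} (hX : Continuous X) (hz : z ∈ disk) : ‖dzb (HL X) z‖ =
    ‖dzb (grad Complex.basisOneI hyp (pois (supportFun X))) z‖ := by
  have hp := (isSol_pois (continuous_supportFun hX)).1
  rw [dzb_congr (HL_eqOn hX) hz, ((DifferentiableAt.hasWirt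
    (hasWirt_grad hp hz).differentiableAt).const_mul Complex.I).dzb_eq, norm_mul, Complex.norm_I,
    one_mul]

/-- Adding the estimates for a minorant a and a majorant b cancels `pois φ` and leaves 2s|∂̄| ≤ 3(b
- a), with s = √(1 - |η|²). This is already stronger than the factor 6. -/
theorem dbarNorm_HL_le {X : Circle → ℂ} (hX : Continuous X) : dbarNorm (HL X) ≤ 6 * width X := by
  have hφ := continuous_supportFun hX
  rw [dbarNorm_eq]
  refine iSup₂_le fun z hz => ?_
  have hη := toKlein_mem_disk hz
  have hs : 0 < √(1 - ‖toKlein z‖ ^ 2) := Real.sqrt_pos.2 (one_sub_sq_pos hη)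
  have hq := lowerHull_le_upperHull hφ hη
  have key : 2 / 3 * (√(1 - ‖toKlein z‖ ^ 2) * ‖dzb (HL X) z‖) ≤
      upperHull (supportFun X) (toKlein z) - lowerHull (supportFun X) (toKlein z) := by
    refine le_upperHull_sub_lowerHull hφ fun a b ha hb => ?_
    have h1 := norm_dzb_grad_le_of_le hφ ha hz
    have h2 := norm_dzb_grad_le_of_ge hφ hb hz
    rw [norm_dzb_HL hX hz, sqrt_toKlein hz]
    linarith
  have h3 : ‖dzb (HL X) z‖ ≤ 6 * ((upperHull (supportFun X) (toKlein z)
      - lowerHull (supportFun X) (toKlein z)) / √(1 - ‖toKlein z‖ ^ 2)) := by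
    rw [← mul_div_assoc, le_div_iff₀ hs]
    linarith
  calc ENNReal.ofReal ‖dzb (HL X) z‖ ≤ ENNReal.ofReal _ := ENNReal.ofReal_le_ofReal h3
    _ = 6 * ENNReal.ofReal ((upperHull (supportFun X) (toKlein z)
      - lowerHull (supportFun X) (toKlein z)) / √(1 - ‖toKlein z‖ ^ 2)) := by
        rw [ENNReal.ofReal_mul (by norm_num)]; norm_num
    _ ≤ 6 * width X := by
        gcongr
        exact le_iSup₂_of_le (toKlein z) hη le_rfl

end Width


/-! ### The width is bounded by the norm of `∂̄ HL(X)` -/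

/-- A function with `y'' ≤ y` and vanishing initial data is nonpositive. -/
theorem nonpos_of_deriv_deriv_le {y y' y'' : ℝ → ℝ} (h1 : ∀ t, HasDerivAt y (y' t) t)
    (h2 : ∀ t, HasDerivAt y' (y'' t) t) (hle : ∀ t, y'' t ≤ y t) (h0 : y 0 = 0) (h0' : y' 0 = 0)
    {t : ℝ} (ht : 0 ≤ t) : y t ≤ 0 := by
  have hexp : ∀ t : ℝ, HasDerivAt (fun s : ℝ => Real.exp (-s)) (-Real.exp (-t)) t := fun t => by
    simpa using (hasDerivAt_neg t).exp
  have hp : ∀ t, HasDerivAt (fun s => Real.exp (-s) * (y' s + y s))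
      (-Real.exp (-t) * (y' t + y t) + Real.exp (-t) * (y'' t + y' t)) t := fun t =>
    (hexp t).mul ((h2 t).add (h1 t))
  -- The operator y'' - y factors into two first-order ones: e⁻ˢ(y' + y) decreases from 0, and
  -- therefore so does eˢy for s ≥ 0.
  have hanti : Antitone fun s => Real.exp (-s) * (y' s + y s) := by
    refine antitone_of_deriv_nonpos (fun t => (hp t).differentiableAt) fun t => ?_
    rw [(hp t).deriv]
    nlinarith [Real.exp_pos (-t), hle t]
  have hpn : ∀ t, 0 ≤ t → y' t + y t ≤ 0 := fun t ht => by
    have h := hanti ht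
    simp only [h0, h0', add_zero, mul_zero] at h
    by_contra! hc
    exact absurd h (not_le.2 (mul_pos (Real.exp_pos _) hc))
  have hq : ∀ t, HasDerivAt (fun s => Real.exp s * y s)
      (Real.exp t * y t + Real.exp t * y' t) t := fun t => (Real.hasDerivAt_exp t).mul (h1 t)
  have hanti2 : AntitoneOn (fun s => Real.exp s * y s) (Ici 0) := by
    refine antitoneOn_of_deriv_nonpos (convex_Ici 0)
      (fun t _ => (hq t).continuousAt.continuousWithinAt)
      (fun t _ => (hq t).differentiableAt.differentiableWithinAt) fun t ht => ?_
    rw [(hq t).deriv]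
    have := hpn t (interior_subset ht)
    nlinarith [Real.exp_pos t]
  have h := hanti2 self_mem_Ici ht ht
  simp only [h0, mul_zero] at h
  by_contra! hc
  exact absurd h (not_le.2 (mul_pos (Real.exp_pos _) hc))

/-- The function `tanh (t / 2)`. -/
noncomputable def tanhHalf (t : ℝ) : ℝ := 1 - 2 * (Real.exp t + 1)⁻¹

theorem tanhHalf_lt_one (t : ℝ) : tanhHalf t < 1 := by
  have : 0 < (Real.exp t + 1)⁻¹ := by positivity
  rw [tanhHalf]; linarith

theorem neg_one_lt_tanhHalf (t : ℝ) : -1 < tanhHalf t := by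
  have h : (Real.exp t + 1)⁻¹ < 1 := inv_lt_one_of_one_lt₀ (by linarith [Real.exp_pos t])
  rw [tanhHalf]; linarith

theorem hasDerivAt_tanhHalf (t : ℝ) : HasDerivAt tanhHalf ((1 - tanhHalf t ^ 2) / 2) t := by
  have h0 : Real.exp t + 1 ≠ 0 := by positivity
  have h := ((((Real.hasDerivAt_exp t).add_const 1).inv h0).const_mul 2).const_sub 1
  refine HasDerivAt.congr_deriv h ?_
  rw [tanhHalf]
  field_simp
  ring

theorem exists_tanhHalf_eq {s : ℝ} (h0 : 0 ≤ s) (h1 : s < 1) : ∃ t, 0 ≤ t ∧ tanhHalf t = s := by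
  have h2 : 0 < 1 - s := by linarith
  refine ⟨Real.log ((1 + s) / (1 - s)), Real.log_nonneg ?_, ?_⟩
  · rw [le_div_iff₀ h2]; linarith
  · rw [tanhHalf, Real.exp_log (by positivity)]
    field_simp
    ring

/-! ### Geodesics of the Poincaré disk. -/

section Geodesic

variable {z₀ ζ : ℂ}

/-- The unit speed geodesic of the hyperbolic plane from `z₀`, in the direction of `ζ`. -/
noncomputable def geod (z₀ ζ : ℂ) (t : ℝ) : ℂ :=
  (tanhHalf t * ζ + z₀) / (1 + conj z₀ * (tanhHalf t * ζ))

/-- The velocity of `geod`. -/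
noncomputable def geod' (z₀ ζ : ℂ) (t : ℝ) : ℂ :=
  defect z₀ * ζ * ((1 - tanhHalf t ^ 2) / 2) / (1 + conj z₀ * (tanhHalf t * ζ)) ^ 2

theorem geod_denom_ne_zero (hz : z₀ ∈ disk) (hζ : ‖ζ‖ = 1) (t : ℝ) :
    1 + conj z₀ * (tanhHalf t * ζ) ≠ 0 := by
  intro h
  have h1 : ‖conj z₀ * (tanhHalf t * ζ)‖ = 1 := by
    have : conj z₀ * (tanhHalf t * ζ) = -1 := by linear_combination h
    rw [this]; simp
  rw [norm_mul, norm_mul, hζ, Complex.norm_conj, mul_one, Complex.norm_real, Real.norm_eq_abs] at h1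
  have h2 : |tanhHalf t| < 1 := abs_lt.2 ⟨neg_one_lt_tanhHalf t, tanhHalf_lt_one t⟩
  have h3 := mem_disk.1 hz
  nlinarith [norm_nonneg z₀, abs_nonneg (tanhHalf t)]

theorem hasDerivAt_ofReal_tanhHalf (t : ℝ) :
    HasDerivAt (fun s => (tanhHalf s : ℂ)) ((1 - tanhHalf t ^ 2) / 2) t := by
  have := (hasDerivAt_tanhHalf t).ofReal_comp
  refine this.congr_deriv ?_
  push_cast; rfl

theorem hasDerivAt_geod (hz : z₀ ∈ disk) (hζ : ‖ζ‖ = 1) (t : ℝ) :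
    HasDerivAt (geod z₀ ζ) (geod' z₀ ζ t) t := by
  have h0 := geod_denom_ne_zero hz hζ t
  have hw := (hasDerivAt_ofReal_tanhHalf t).mul_const ζ
  have h := (hw.add_const z₀).div ((hw.const_mul (conj z₀)).const_add 1) h0
  refine HasDerivAt.congr_deriv h ?_
  rw [geod', defect]
  field_simp
  ring

/-- The transformation rule of 1 - |w|² under the Möbius map that sends 0 to z₀. -/
theorem defect_geod (hz : z₀ ∈ disk) (hζ : ‖ζ‖ = 1) (t : ℝ) :
    defect (geod z₀ ζ t) * ((1 + conj z₀ * (tanhHalf t * ζ)) * (1 + z₀ * (tanhHalf t * conj ζ))) =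
      defect z₀ * (1 - tanhHalf t ^ 2) := by
  have h0 := geod_denom_ne_zero hz hζ t
  have h0' : 1 + z₀ * (tanhHalf t * conj ζ) ≠ 0 := by
    have := (map_ne_zero (starRingEnd ℂ)).2 h0
    simpa using this
  have hn : ζ * conj ζ = 1 := by rw [Complex.mul_conj', hζ]; simp
  rw [defect, geod, defect]
  simp only [map_div₀, map_add, map_mul, map_one, Complex.conj_conj, Complex.conj_ofReal]
  generalize hA : 1 + conj z₀ * (tanhHalf t * ζ) = A at *
  generalize hB : 1 + z₀ * (tanhHalf t * conj ζ) = B at *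
  field_simp
  subst hA hB
  linear_combination ((tanhHalf t : ℂ) ^ 2 * (z₀ * conj z₀ - 1)) * hn

theorem geod_mem_disk (hz : z₀ ∈ disk) (hζ : ‖ζ‖ = 1) (t : ℝ) : geod z₀ ζ t ∈ disk := by
  have h0 := geod_denom_ne_zero hz hζ t
  have h := defect_geod hz hζ t
  have hc : 1 + z₀ * (tanhHalf t * conj ζ) = conj (1 + conj z₀ * (tanhHalf t * ζ)) := by simp
  rw [hc, Complex.mul_conj', defect_eq, defect_eq] at h
  have h2 : (1 - ‖geod z₀ ζ t‖ ^ 2) * ‖1 + conj z₀ * (tanhHalf t * ζ)‖ ^ 2 =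
      (1 - ‖z₀‖ ^ 2) * (1 - tanhHalf t ^ 2) := by exact_mod_cast h
  have h3 : 0 < ‖1 + conj z₀ * (tanhHalf t * ζ)‖ ^ 2 := by positivity
  have h4 : 0 < (1 - ‖z₀‖ ^ 2) * (1 - tanhHalf t ^ 2) := by
    refine mul_pos (one_sub_sq_pos hz) ?_
    nlinarith [tanhHalf_lt_one t, neg_one_lt_tanhHalf t]
  have h5 : 0 < 1 - ‖geod z₀ ζ t‖ ^ 2 := by
    by_contra! hc
    nlinarith
  rw [mem_disk]
  nlinarith [norm_nonneg (geod z₀ ζ t)]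

/-- Unit speed: the hyperbolic norm of v is 2|v|/D. -/
theorem geod'_mul_conj (hz : z₀ ∈ disk) (hζ : ‖ζ‖ = 1) (t : ℝ) :
    geod' z₀ ζ t * conj (geod' z₀ ζ t) = defect (geod z₀ ζ t) ^ 2 / 4 := by
  have h0 := geod_denom_ne_zero hz hζ t
  have h0' : 1 + z₀ * (tanhHalf t * conj ζ) ≠ 0 := by
    have := (map_ne_zero (starRingEnd ℂ)).2 h0
    simpa using this
  have hn : ζ * conj ζ = 1 := by rw [Complex.mul_conj', hζ]; simp
  have h1 : defect (geod z₀ ζ t) = defect z₀ * (1 - tanhHalf t ^ 2) /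
      ((1 + conj z₀ * (tanhHalf t * ζ)) * (1 + z₀ * (tanhHalf t * conj ζ))) := by
    rw [eq_div_iff (mul_ne_zero h0 h0'), defect_geod hz hζ t]
  rw [h1, geod']
  simp only [map_div₀, map_add, map_sub, map_mul, map_one, map_pow, Complex.conj_conj,
    Complex.conj_ofReal, conj_defect, map_ofNat]
  generalize hA : 1 + conj z₀ * (tanhHalf t * ζ) = A at *
  generalize hB : 1 + z₀ * (tanhHalf t * conj ζ) = B at *
  field_simp
  linear_combination (4 * defect z₀ ^ 2 * (1 - (tanhHalf t : ℂ) ^ 2) ^ 2) * hn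

/-- The geodesic equation, with the Christoffel term of `christoffel_hyp`. -/
theorem hasDerivAt_geod' (hz : z₀ ∈ disk) (hζ : ‖ζ‖ = 1) (t : ℝ) :
    HasDerivAt (geod' z₀ ζ)
      (-(2 * conj (geod z₀ ζ t) / defect (geod z₀ ζ t)) * geod' z₀ ζ t ^ 2) t := by
  have h0 := geod_denom_ne_zero hz hζ t
  have h0' : 1 + z₀ * (tanhHalf t * conj ζ) ≠ 0 := by
    have := (map_ne_zero (starRingEnd ℂ)).2 h0
    simpa using this
  have hn : ζ * conj ζ = 1 := by rw [Complex.mul_conj', hζ]; simp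
  have hτ : (1 - (tanhHalf t : ℂ) ^ 2) ≠ 0 := by
    have : (1 - tanhHalf t ^ 2) ≠ 0 := by
      nlinarith [tanhHalf_lt_one t, neg_one_lt_tanhHalf t]
    exact_mod_cast this
  have hD := defect_ne_zero hz
  have hτd := hasDerivAt_ofReal_tanhHalf t
  have hw := ((hτd.mul_const ζ).const_mul (conj z₀)).const_add 1
  have h := ((((hτd.pow 2).const_sub 1).div_const 2).const_mul (defect z₀ * ζ)).div (hw.pow 2)
    (pow_ne_zero 2 h0)
  have h1 : defect (geod z₀ ζ t) = defect z₀ * (1 - tanhHalf t ^ 2) /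
      ((1 + conj z₀ * (tanhHalf t * ζ)) * (1 + z₀ * (tanhHalf t * conj ζ))) := by
    rw [eq_div_iff (mul_ne_zero h0 h0'), defect_geod hz hζ t]
  refine HasDerivAt.congr_deriv h ?_
  rw [h1, geod', geod]
  simp only [map_div₀, map_add, map_mul, map_one, Complex.conj_conj, Complex.conj_ofReal,
    Nat.cast_ofNat, Nat.add_one_sub_one, pow_one, Pi.pow_apply]
  generalize hA : 1 + conj z₀ * (tanhHalf t * ζ) = A at *
  generalize hB : 1 + z₀ * (tanhHalf t * conj ζ) = B at *
  field_simp
  subst hA hB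
  linear_combination (ζ * (tanhHalf t : ℂ)) * hn

/-- A Möbius map moves z₀ to the origin, where the geodesics are radii; the image w of z is written
in polar form. -/
theorem exists_geod_eq (hz : z₀ ∈ disk) {z : ℂ} (hz' : z ∈ disk) :
    ∃ ζ t, ‖ζ‖ = 1 ∧ 0 ≤ t ∧ geod z₀ ζ t = z := by
  have hd : 1 - conj z₀ * z ≠ 0 := by
    intro h
    have h1 : ‖conj z₀ * z‖ = 1 := by
      have : conj z₀ * z = 1 := by linear_combination -h
      rw [this]; simp
    rw [norm_mul, Complex.norm_conj] at h1
    have := mem_disk.1 hz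
    have := mem_disk.1 hz'
    nlinarith [norm_nonneg z₀, norm_nonneg z]
  set w := (z - z₀) / (1 - conj z₀ * z) with hw
  have hwn : ‖w‖ < 1 := by
    rw [hw, norm_div, div_lt_one (norm_pos_iff.2 hd)]
    refine lt_of_pow_lt_pow_left₀ 2 (norm_nonneg _) ?_
    have h1 := one_sub_sq_pos hz
    have h2 := one_sub_sq_pos hz'
    have h3 : ‖1 - conj z₀ * z‖ ^ 2 - ‖z - z₀‖ ^ 2 = (1 - ‖z₀‖ ^ 2) * (1 - ‖z‖ ^ 2) := by
      simp only [← Complex.normSq_eq_norm_sq, Complex.normSq_apply]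
      simp; ring
    nlinarith [mul_pos h1 h2]
  obtain ⟨ζ, hζ, hwζ⟩ : ∃ ζ : ℂ, ‖ζ‖ = 1 ∧ w = ‖w‖ * ζ := by
    by_cases h0 : w = 0
    · exact ⟨1, by simp, by simp [h0]⟩
    · have h1 : (‖w‖ : ℂ) ≠ 0 := by simpa using h0
      exact ⟨w / ‖w‖, by simp [h0], by field_simp⟩
  obtain ⟨t, ht, hτ⟩ := exists_tanhHalf_eq (norm_nonneg w) hwn
  refine ⟨ζ, t, hζ, ht, ?_⟩
  have h0 := geod_denom_ne_zero hz hζ t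
  rw [geod, div_eq_iff h0, hτ, ← hwζ, hw]
  generalize hN : 1 - conj z₀ * z = N at hd
  field_simp
  subst hN
  ring

end Geodesic


/-! ### Supporting affine functions. -/

section Support

variable {z₀ : ℂ}

theorem conj_dzb_dzb_cx {g : ℂ → ℝ} {z : ℂ} (hg : ContDiffOn ℝ ∞ g disk) (hz : z ∈ disk) :
    conj (dzb (dzb (cx g)) z) = dz (dz (cx g)) z := by
  have h1 := (hasWirt_of_disk (contDiffOn_dzb (contDiffOn_cx hg)) hz).conj
  have h2 : HasWirt (dz (cx g)) _ _ z := h1.congr_of_eventuallyEq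
    (eventually_of_mem (disk_mem_nhds hz) fun w hw =>
      (conj_dzb_cx (differentiableAt_of_disk hg hw)).symm)
  rw [h2.dz_eq]

/-- Affine functions have three real parameters, as many as a 1-jet. The formula for β solves
`dzb_ell` for the derivative, and α then fixes the value. -/
theorem exists_ell_jet (hz : z₀ ∈ disk) (v : ℝ) (e : ℂ) :
    ∃ α β, ell α β z₀ = v ∧ dzb (cx (ell α β)) z₀ = e := by
  have h0 := one_sub_sq_pos hz
  have hD := defect_ne_zero hz
  set α : ℝ := v - 2 * inner ℝ e z₀ + 2 * ‖z₀‖ ^ 2 * v / (1 - ‖z₀‖ ^ 2) with hα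
  set β : ℂ := defect z₀ * e - z₀ * v - α * z₀ with hβ
  have h1 : ell α β z₀ = v := by
    have hi : inner ℝ β z₀ = (1 - ‖z₀‖ ^ 2) * inner ℝ e z₀ - v * ‖z₀‖ ^ 2 - α * ‖z₀‖ ^ 2 := by
      have : β = (1 - ‖z₀‖ ^ 2 : ℝ) • e - v • z₀ - α • z₀ := by
        rw [hβ, defect_eq]; simp only [Complex.real_smul]; ring
      rw [this, inner_sub_left, inner_sub_left, real_inner_smul_left, real_inner_smul_left,
        real_inner_smul_left, real_inner_self_eq_norm_sq]
    rw [ell, hi, hα]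
    field_simp
    ring
  refine ⟨α, β, h1, ?_⟩
  rw [dzb_ell α β hz, h1, hβ]
  field_simp
  ring

/-- At every point, a solution whose `∂̄` is bounded by `c` has a supporting affine solution. -/
theorem IsSol.exists_ell_ge {u : ℂ → ℝ} (hu : IsSol u) {c : ℝ}
    (hc : ∀ z ∈ disk, ‖dzb (grad Complex.basisOneI hyp u) z‖ ≤ c) (hz : z₀ ∈ disk) :
    ∃ α β, ell α β z₀ = u z₀ + c ∧ ∀ z ∈ disk, u z + c ≤ ell α β z := by
  obtain ⟨α, β, h1, h2⟩ := exists_ell_jet hz (u z₀ + c) (dzb (cx u) z₀)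
  refine ⟨α, β, h1, fun z hz' => ?_⟩
  have hl := isSol_ell α β
  have hg := hu.sub hl
  set g : ℂ → ℝ := fun z => u z - ell α β z with hgdef
  obtain ⟨ζ, t, hζ, ht, rfl⟩ := exists_geod_eq hz hz'
  have hmem := geod_mem_disk hz hζ
  have hbound : ∀ w ∈ disk, ‖dzb (grad Complex.basisOneI hyp g) w‖ ≤ c := fun w hw => by
    rw [hgdef, dzb_grad_sub hu.1 hl.1 hw, dzb_grad_ell α β hw, sub_zero]; exact hc w hw
  have hd1 : ∀ t, HasDerivAt (fun s => g (geod z₀ ζ s) + c) _ t := fun t =>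
    (hasDerivAt_curve hg.1 (hmem t) (hasDerivAt_geod hz hζ t)).add_const c
  have hd2 : ∀ t, HasDerivAt _ _ t := fun t =>
    hasDerivAt_deriv_curve hg.1 (hmem t) (hasDerivAt_geod hz hζ t) (hasDerivAt_geod' hz hζ t)
  have hτ0 : tanhHalf 0 = 0 := by simp [tanhHalf]; norm_num
  have hγ0 : geod z₀ ζ 0 = z₀ := by simp [geod, hτ0]
  have hdz0 : dz (cx g) z₀ = 0 := by
    have he : cx g = fun z => cx u z - cx (ell α β) z := by ext z; simp [cx, hgdef]
    have h3 : dzb (cx g) z₀ = 0 := by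
      rw [he, ((hasWirt_of_disk (contDiffOn_cx hu.1) hz).sub
        (hasWirt_of_disk (contDiffOn_cx hl.1) hz)).dzb_eq, h2, sub_self]
    rw [← conj_dzb_cx (differentiableAt_of_disk hg.1 hz), h3, map_zero]
  -- The function y = g + c along the geodesic vanishes to first order at z₀ by the choice of the
  -- jet, so only y'' ≤ y remains.
  have hfin := nonpos_of_deriv_deriv_le hd1 hd2 (fun s => ?_) ?_ ?_ ht
  · simp only [hgdef] at hfin
    linarith
  · have hw := hmem s
    have hD := defect_ne_zero hw
    have hspeed := geod'_mul_conj hz hζ s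
    have hb := hbound _ hw
    rw [(hasWirt_grad hg.1 hw).dzb_eq] at hb
    have hcj := conj_dzb_dzb_cx hg.1 hw
    have hcj1 := conj_dzb_cx (differentiableAt_of_disk hg.1 hw)
    have hlap := hg.2 _ hw
    rw [dz_dzb_comm (contDiffOn_cx hg.1) hw] at hlap
    rw [hlap]
    have hsp : ‖geod' z₀ ζ s‖ ^ 2 = ‖defect (geod z₀ ζ s)‖ ^ 2 / 4 := by
      have h3 := congrArg norm hspeed
      rw [norm_mul, Complex.norm_conj, norm_div, norm_pow] at h3
      rw [sq, h3]; norm_num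
    generalize geod z₀ ζ s = w at *
    generalize geod' z₀ ζ s = v at *
    set Q := defect w ^ 2 / 2 * dzb (dzb (cx g)) w - defect w * w * dzb (cx g) w with hQ
    have hQc : conj Q = defect w ^ 2 / 2 * dz (dz (cx g)) w
        - defect w * conj w * dz (cx g) w := by
      rw [hQ]
      simp only [map_sub, map_mul, map_div₀, map_pow, conj_defect, map_ofNat, hcj, hcj1]
    -- Half the Hessian on the unit vector v: the trace part g/2, and a trace-free part carried by
    -- Q, the ∂̄ of the gradient, with real part at most c/2. Doubling gives y'' ≤ g + c = y.
    have hexp : (dz (dz (cx g)) w * v + 2 * (g w : ℂ) / defect w ^ 2 * conj v) * v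
        + dz (cx g) w * (-(2 * conj w / defect w) * v ^ 2) =
        2 / defect w ^ 2 * conj Q * v ^ 2 + ((g w / 2 : ℝ) : ℂ) := by
      have h4 : conj v * v = defect w ^ 2 / 4 := by rw [mul_comm]; exact hspeed
      rw [hQc]
      push_cast
      field_simp
      linear_combination (4 * (g w : ℂ)) * h4
    rw [hexp, Complex.add_re, Complex.ofReal_re]
    have hre : (2 / defect w ^ 2 * conj Q * v ^ 2).re ≤ c / 2 := by
      refine (Complex.re_le_norm _).trans ?_
      have hDn : 0 < ‖defect w‖ := norm_pos_iff.2 hD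
      have h5 : ‖2 / defect w ^ 2 * conj Q * v ^ 2‖ = ‖Q‖ / 2 := by
        rw [norm_mul, norm_mul, norm_div, norm_pow, norm_pow, Complex.norm_conj, hsp]
        rw [Complex.norm_ofNat]
        field_simp
        ring
      rw [h5]; linarith
    linarith
  · simp only [hγ0, hgdef, h1]; ring
  · simp only [hγ0, hdz0]; simp

theorem nhdsWithin_disk_neBot (ζ : Circle) : (𝓝[disk] (ζ : ℂ)).NeBot := by
  rw [← mem_closure_iff_nhdsWithin_neBot, disk, closure_ball (0 : ℂ) one_ne_zero,
    mem_closedBall_zero_iff, Circle.norm_coe]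

/-- The supporting inequality passes to the circle after multiplication by D/(1 + |z|²); as c ≥ 0,
the shift by c may be dropped in the comparison. -/
theorem exists_affine_ge {φ : Circle → ℝ} (hφ : Continuous φ) {c : ℝ}
    (hc : ∀ z ∈ disk, ‖dzb (grad Complex.basisOneI hyp (pois φ)) z‖ ≤ c) (hz : z₀ ∈ disk) :
    ∃ a : ℂ →ᵃ[ℝ] ℝ, (∀ ζ : Circle, φ ζ ≤ a ζ) ∧
      a (toKlein z₀) = (1 - ‖z₀‖ ^ 2) / (1 + ‖z₀‖ ^ 2) * (pois φ z₀ + c) := by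
  obtain ⟨α, β, h1, h2⟩ := (isSol_pois hφ).exists_ell_ge hc hz
  refine ⟨aff α β, fun ζ => ?_, by rw [← ell_eq_aff α β hz, h1]⟩
  have hne := nhdsWithin_disk_neBot ζ
  have hc0 : 0 ≤ c := (norm_nonneg _).trans (hc z₀ hz)
  refine le_of_tendsto_of_tendsto (tendsto_pois hφ ζ)
    (tendsto_ubar_iff.1 ((isMeanGraph_iff.1 (isMeanGraph_ell α β)).2 ζ)) ?_
  filter_upwards [self_mem_nhdsWithin] with z hz'
  exact mul_le_mul_of_nonneg_left (by linarith [h2 z hz'])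
    (div_nonneg (one_sub_sq_pos hz').le (by positivity))

theorem pois_neg (φ : Circle → ℝ) (z : ℂ) : pois (fun ζ => -φ ζ) z = -pois φ z := by
  rw [pois, pois, ← neg_one_mul, ← avg_real_const_mul]
  congr 1; ext ζ; ring

theorem width_le {X : Circle → ℂ} (hX : Continuous X) : width X ≤ 2 * dbarNorm (HL X) := by
  by_cases htop : dbarNorm (HL X) = ⊤
  · rw [htop]; simp
  have hφ := continuous_supportFun hX
  set φ := supportFun X
  set c := (dbarNorm (HL X)).toReal with hcdef
  have hc : ∀ z ∈ disk, ‖dzb (grad Complex.basisOneI hyp (pois φ)) z‖ ≤ c := by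
    intro z hz
    rw [← norm_dzb_HL hX hz]
    rw [← ENNReal.ofReal_le_iff_le_toReal htop]
    conv_rhs => rw [dbarNorm_eq]
    exact le_iSup₂_of_le z hz le_rfl
  have hc' : ∀ z ∈ disk, ‖dzb (grad Complex.basisOneI hyp (pois fun ζ => -φ ζ)) z‖ ≤ c := by
    intro z hz
    -- `ell 0 0` is the zero function, so negation is a case of subtraction.
    have h0 : IsSol (ell 0 0) := isSol_ell 0 0
    have he : EqOn (pois fun ζ => -φ ζ) (fun z => ell 0 0 z - pois φ z) disk := fun w _ => by
      simp [pois_neg, ell]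
    rw [dzb_grad_congr he hz, dzb_grad_sub h0.1 (isSol_pois hφ).1 hz, dzb_grad_ell 0 0 hz,
      zero_sub, norm_neg]
    exact hc z hz
  refine iSup₂_le fun η hη => ?_
  have hz := ofKlein_mem_disk hη
  obtain ⟨a, ha, ha2⟩ := exists_affine_ge hφ hc hz
  obtain ⟨b, hb, hb2⟩ := exists_affine_ge hφ.neg hc' hz
  have hs : √(1 - ‖η‖ ^ 2) = (1 - ‖ofKlein η‖ ^ 2) / (1 + ‖ofKlein η‖ ^ 2) := by
    rw [← sqrt_toKlein hz, toKlein_ofKlein hη]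
  have hs0 : 0 < √(1 - ‖η‖ ^ 2) := Real.sqrt_pos.2 (one_sub_sq_pos hη)
  rw [toKlein_ofKlein hη, ← hs] at ha2 hb2
  rw [show pois (-φ) (ofKlein η) = -pois φ (ofKlein η) from pois_neg φ _] at hb2
  have h1 := upperHull_le hφ ha hη
  have h2 : (-b) η ≤ lowerHull φ η := le_lowerHull hφ (a := -b) (fun ζ => by
    have := hb ζ
    simp only [Pi.neg_apply] at this
    simp only [AffineMap.coe_neg, Pi.neg_apply]; linarith) hη
  simp only [AffineMap.coe_neg, Pi.neg_apply] at h2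
  have h3 : (upperHull φ η - lowerHull φ η) / √(1 - ‖η‖ ^ 2) ≤ 2 * c := by
    rw [div_le_iff₀ hs0]
    nlinarith
  calc _ ≤ ENNReal.ofReal (2 * c) := ENNReal.ofReal_le_ofReal h3
    _ = 2 * dbarNorm (HL X) := by
      rw [ENNReal.ofReal_mul (by norm_num), hcdef, ENNReal.ofReal_toReal htop]; norm_num

end Support


/-! ### Zygmund fields and width -/

/-- The Zygmund condition on the line controls a function up to an affine one. -/
theorem abs_le_of_secondDiff_le {g : ℝ → ℝ} (hg : Continuous g) {N : ℝ}
    (h : ∀ x s, 0 < s → |g (x + s) + g (x - s) - 2 * g x| ≤ N * s) (h1 : g 1 = 0)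
    (h2 : g (-1) = 0) (x : ℝ) : |g x| ≤ 5 * N * (1 + x ^ 2) := by
  have hN : 0 ≤ N := by
    have := (abs_nonneg _).trans (h 0 1 one_pos)
    linarith
  -- A maximum point y of |g| on [-1, 1] is the midpoint between its nearer endpoint, where g = 0,
  -- and another point of the interval. The second difference then gives 2|g y| ≤ |g y| + N.
  have hin : ∀ x, |x| ≤ 1 → |g x| ≤ N := by
    obtain ⟨y, hy, hmax⟩ := (isCompact_Icc (a := (-1 : ℝ)) (b := 1)).exists_isMaxOn
      ⟨0, by norm_num, by norm_num⟩ hg.abs.continuousOn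
    have hle : ∀ x, |x| ≤ 1 → |g x| ≤ |g y| := fun x hx => hmax (abs_le.1 hx)
    suffices |g y| ≤ N from fun x hx => (hle x hx).trans this
    rcases eq_or_lt_of_le hy.1 with h3 | h3
    · rw [← h3, h2, abs_zero]; exact hN
    rcases eq_or_lt_of_le hy.2 with h4 | h4
    · rw [h4, h1, abs_zero]; exact hN
    have key : ∀ a b s, |a| ≤ |g y| → s ≤ 1 → |a + b - 2 * g y| ≤ N * s → b = 0 → |g y| ≤ N := by
      intro a b s h5 h6 h7 h8
      have h9 : N * s ≤ N := by nlinarith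
      subst h8
      rw [abs_le] at h7
      rcases abs_cases (g y) with h10 | h10 <;> rcases abs_cases a with h11 | h11 <;> linarith
    rcases le_total 0 y with h5 | h5
    · have h6 := h y (1 - y) (by linarith)
      refine key (g (y - (1 - y))) (g (y + (1 - y))) (1 - y) (hle _ ?_) (by linarith) ?_ ?_
      · rw [abs_le]; constructor <;> linarith
      · rwa [add_comm (g (y - (1 - y)))]
      · rw [add_sub_cancel, h1]
    · have h6 := h y (1 + y) (by linarith)
      refine key (g (y + (1 + y))) (g (y - (1 + y))) (1 + y) (hle _ ?_) (by linarith) h6 ?_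
      · rw [abs_le]; constructor <;> linarith
      · rw [show y - (1 + y) = -1 by ring, h2]
  -- Dyadic induction with the second difference at 0, x/2, x. The constant 5 closes it, because 2 +
  -- |x|/2 ≤ (5/2)x² for |x| ≥ 1.
  have hout : ∀ (n : ℕ) (x : ℝ), |x| ≤ 2 ^ n → |g x| ≤ N * (1 + 5 * x ^ 2) := by
    intro n
    induction n with
    | zero =>
      intro x hx
      have := hin x (by simpa using hx)
      nlinarith [mul_nonneg hN (sq_nonneg x)]
    | succ n ih =>
      intro x hx
      rcases le_or_gt |x| 1 with h3 | h3
      · have := hin x h3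
        nlinarith [mul_nonneg hN (sq_nonneg x)]
      have h4 := ih (x / 2) (by rw [abs_div, abs_two]; rw [pow_succ] at hx; linarith)
      have h0 := hin 0 (by simp)
      have h5 : |g x + g 0 - 2 * g (x / 2)| ≤ N * (|x| / 2) := by
        have h6 := h (x / 2) (|x| / 2) (by linarith)
        rcases abs_cases x with ⟨h7, _⟩ | ⟨h7, _⟩ <;> rw [h7] at h6 ⊢
        · rwa [add_halves, sub_self] at h6
        · rwa [show x / 2 + -x / 2 = 0 by ring, show x / 2 - -x / 2 = x by ring,
            add_comm (g 0)] at h6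
      have h6 : |g x| ≤ N * (|x| / 2) + |g 0| + 2 * |g (x / 2)| := by
        calc |g x| = |(g x + g 0 - 2 * g (x / 2)) + (-g 0) + 2 * g (x / 2)| := by
              congr 1; ring
          _ ≤ |g x + g 0 - 2 * g (x / 2)| + |-g 0| + |2 * g (x / 2)| := abs_add_three _ _ _
          _ ≤ _ := by rw [abs_neg, abs_mul, abs_two]; linarith
      have h7 : 2 + |x| / 2 ≤ 5 / 2 * x ^ 2 := by rw [← sq_abs]; nlinarith
      nlinarith [mul_le_mul_of_nonneg_left h7 hN]
  obtain ⟨n, hn⟩ := pow_unbounded_of_one_lt |x| one_lt_two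
  have := hout n x hn.le
  nlinarith

/-! ### Cross-ratio distortion as a second difference on the line. -/

/-- The parametrization of the circle minus the point `-exp (i θ)` by the line. -/
noncomputable def cayley (θ x : ℝ) : Circle := Circle.exp (θ + 2 * Real.arctan x)

theorem continuous_cayley (θ : ℝ) : Continuous (cayley θ) := by
  unfold cayley; fun_prop

theorem one_sub_mul_I_ne_zero (x : ℝ) : (1 - x * Complex.I : ℂ) ≠ 0 := by
  intro h
  have := congrArg Complex.re h
  simp at this

/-- In the variable 1 - xi, this form turns the difference of two points into a single fraction. -/
theorem coe_cayley (θ x : ℝ) :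
    (cayley θ x : ℂ) = Circle.exp θ * (2 / (1 - x * Complex.I) - 1) := by
  have h1 : (Circle.exp (2 * Real.arctan x) : ℂ) = (Real.cos (Real.arctan x)
      + Real.sin (Real.arctan x) * Complex.I) ^ 2 := by
    rw [Circle.coe_exp]
    push_cast
    rw [← Complex.exp_mul_I, ← Complex.exp_nat_mul]
    congr 1
    push_cast
    ring
  have hs : (0 : ℝ) < √(1 + x ^ 2) := Real.sqrt_pos.2 (by positivity)
  have hs' : ((√(1 + x ^ 2) : ℝ) : ℂ) ^ 2 = (1 - x * Complex.I) * (1 + x * Complex.I) := by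
    rw [← Complex.ofReal_pow, Real.sq_sqrt (by positivity)]
    push_cast
    linear_combination (x : ℂ) ^ 2 * Complex.I_sq
  have hs0 : ((√(1 + x ^ 2) : ℝ) : ℂ) ≠ 0 := by exact_mod_cast hs.ne'
  have hd := one_sub_mul_I_ne_zero x
  rw [cayley, Circle.exp_add, Circle.coe_mul, h1, Real.cos_arctan, Real.sin_arctan]
  congr 1
  push_cast
  have h2 : (1 / ((√(1 + x ^ 2) : ℝ) : ℂ) + x / ((√(1 + x ^ 2) : ℝ) : ℂ) * Complex.I) ^ 2
      = (1 + x * Complex.I) ^ 2 / ((√(1 + x ^ 2) : ℝ) : ℂ) ^ 2 := by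
    field_simp
  rw [h2, hs']
  have hd' : (1 + x * Complex.I : ℂ) ≠ 0 := by
    simpa using one_sub_mul_I_ne_zero (-x)
  field_simp
  ring

theorem coe_exp_add_pi (θ : ℝ) : (Circle.exp (θ + Real.pi) : ℂ) = -Circle.exp θ := by
  rw [Circle.exp_add, Circle.coe_mul, Circle.coe_exp Real.pi, Complex.exp_pi_mul_I]
  ring

theorem isCCW_cayley (θ : ℝ) {x y z : ℝ} (hxy : x < y) (hyz : y < z) :
    IsCCW (cayley θ x) (cayley θ y) (cayley θ z) (Circle.exp (θ + Real.pi)) := by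
  refine ⟨_, _, _, _, ?_, ?_, ?_, ?_, rfl, rfl, rfl, rfl⟩
  · linarith [Real.arctan_strictMono hxy]
  · linarith [Real.arctan_strictMono hyz]
  · linarith [Real.arctan_lt_pi_div_two z]
  · linarith [Real.neg_pi_div_two_lt_arctan x]

/-- The point -e plays the role of infinity, which reduces the cross-ratio to a ratio of
differences. -/
theorem crossRatio_eq_div {e α β γ : ℂ} (he : e ≠ 0) (hα : α ≠ 0) (hβ : β ≠ 0) (hγ : γ ≠ 0)
    (hβγ : β - γ ≠ 0) :
    crossRatio (e * (2 / α - 1)) (e * (2 / β - 1)) (e * (2 / γ - 1)) (-e)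
      = (α - β) / (β - γ) := by
  have h1 : ∀ a b : ℂ, a ≠ 0 → b ≠ 0 →
      e * (2 / b - 1) - e * (2 / a - 1) = 2 * e * (a - b) / (a * b) := by
    intro a b ha hb; field_simp; ring
  have h2 : ∀ a : ℂ, a ≠ 0 → -e - e * (2 / a - 1) = -2 * e / a := by
    intro a ha; field_simp; ring
  rw [crossRatio, h1 _ _ hα hβ, h1 _ _ hβ hγ, h2 _ hα, h2 _ hγ]
  field_simp

theorem crossRatio_cayley (θ : ℝ) {x y z : ℝ} (hyz : y < z) :
    crossRatio (cayley θ x) (cayley θ y) (cayley θ z) (Circle.exp (θ + Real.pi))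
      = ((y - x) / (z - y) : ℝ) := by
  have h1 : (z : ℂ) - y ≠ 0 := by
    rw [sub_ne_zero]; exact_mod_cast hyz.ne'
  have h2 : ∀ a b : ℝ, (1 - a * Complex.I : ℂ) - (1 - b * Complex.I) = (b - a) * Complex.I := by
    intro a b; ring
  rw [coe_cayley, coe_cayley, coe_cayley, coe_exp_add_pi, crossRatio_eq_div
    (Circle.exp θ).coe_ne_zero (one_sub_mul_I_ne_zero x) (one_sub_mul_I_ne_zero y)
    (one_sub_mul_I_ne_zero z) (by rw [h2]; exact mul_ne_zero h1 Complex.I_ne_zero), h2, h2,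
    mul_div_mul_right _ _ Complex.I_ne_zero]
  push_cast
  rfl

/-- The function on the line that represents the support function `φ` in the parametrization
`cayley θ`. -/
noncomputable def lineFun (φ : Circle → ℝ) (θ x : ℝ) : ℝ :=
  (φ (cayley θ x) - φ (Circle.exp (θ + Real.pi))) * (1 + x ^ 2) / 2

/-- As dθ/dx = 2/(1 + x²), the field φ ∂θ is φ(1 + x²)/2 ∂x, and β(2 - β) = 1 + x² for β = 1 - xi.
Subtracting the rotation with angular speed P makes the field vanish at infinity, and only the three
finite points contribute. -/
theorem distortion_identity {e α β γ τ : ℂ} (A B C P : ℂ) (he : e ≠ 0) (hα : α ≠ 0) (hβ : β ≠ 0)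
    (hγ : γ ≠ 0) (hτ : τ ≠ 0) (h1 : α = β + τ) (h2 : γ = β - τ) :
    (e * (2 / β - 1) * B - e * (2 / α - 1) * A) / (e * (2 / β - 1) - e * (2 / α - 1))
      - (e * (2 / γ - 1) * C - e * (2 / β - 1) * B) / (e * (2 / γ - 1) - e * (2 / β - 1))
      + (-e * P - e * (2 / γ - 1) * C) / (-e - e * (2 / γ - 1))
      - (e * (2 / α - 1) * A - -e * P) / (e * (2 / α - 1) - -e)
    = (2 * ((B - P) * (β * (2 - β)) / 2) - (A - P) * (α * (2 - α)) / 2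
      - (C - P) * (γ * (2 - γ)) / 2) / τ := by
  have h3 : e * (2 / β - 1) - e * (2 / α - 1) = 2 * e * τ / (α * β) := by
    rw [show τ = α - β by rw [h1]; ring]; field_simp; ring
  have h4 : e * (2 / γ - 1) - e * (2 / β - 1) = 2 * e * τ / (β * γ) := by
    rw [show τ = β - γ by rw [h2]; ring]; field_simp; ring
  have h5 : -e - e * (2 / γ - 1) = -2 * e / γ := by field_simp; ring
  have h6 : e * (2 / α - 1) - -e = 2 * e / α := by field_simp; ring
  rw [h3, h4, h5, h6]
  field_simp
  subst h1 h2
  ring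

theorem distortion_cayley {X : Circle → ℂ} (hXt : IsTangent X) (θ x : ℝ) {t : ℝ} (ht : 0 < t) :
    distortion X (cayley θ (x - t)) (cayley θ x) (cayley θ (x + t)) (Circle.exp (θ + Real.pi))
      = ((2 * lineFun (supportFun X) θ x - lineFun (supportFun X) θ (x - t)
        - lineFun (supportFun X) θ (x + t)) / t : ℝ) := by
  have ht0 : (t : ℂ) ≠ 0 := by exact_mod_cast ht.ne'
  have hsq : ∀ y : ℝ, ((1 + y ^ 2 : ℝ) : ℂ)
      = (1 - y * Complex.I) * (2 - (1 - y * Complex.I)) := by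
    intro y
    push_cast
    linear_combination (y : ℂ) ^ 2 * Complex.I_sq
  have key := distortion_identity (supportFun X (cayley θ (x - t)) : ℂ)
    (supportFun X (cayley θ x)) (supportFun X (cayley θ (x + t)))
    (supportFun X (Circle.exp (θ + Real.pi))) (Circle.exp θ).coe_ne_zero
    (one_sub_mul_I_ne_zero (x - t)) (one_sub_mul_I_ne_zero x) (one_sub_mul_I_ne_zero (x + t))
    (mul_ne_zero ht0 Complex.I_ne_zero) (by push_cast; ring) (by push_cast; ring)
  rw [← coe_cayley, ← coe_cayley, ← coe_cayley, ← coe_exp_add_pi, ← hsq, ← hsq, ← hsq] at key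
  have hfac : ∀ a b c d : ℂ, (Complex.I * a * b - Complex.I * c * d) / (a - c)
      = Complex.I * ((a * b - c * d) / (a - c)) := by
    intro a b c d; rw [← mul_div_assoc]; congr 1; ring
  simp only [distortion, eq_mul_supportFun hXt, lineFun, hfac]
  rw [← mul_sub, ← mul_add, ← mul_sub, key, Complex.ofReal_div]
  simp only [Complex.ofReal_sub, Complex.ofReal_mul, Complex.ofReal_div, Complex.ofReal_ofNat]
  field_simp [Complex.I_ne_zero]

theorem exists_eq_cayley {θ α : ℝ} (h1 : θ - Real.pi < α) (h2 : α < θ + Real.pi) :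
    ∃ x, Real.arctan x = (α - θ) / 2 ∧ Circle.exp α = cayley θ x := by
  have h3 : Real.arctan (Real.tan ((α - θ) / 2)) = (α - θ) / 2 :=
    Real.arctan_tan (by linarith) (by linarith)
  refine ⟨_, h3, ?_⟩
  rw [cayley, h3]; congr 1; ring

/-- The cross-ratio distortion is a second difference quotient. -/
theorem crNorm_lt_top_iff {X : Circle → ℂ} (hXt : IsTangent X) :
    crNorm X < ⊤ ↔ ∃ N : ℝ, ∀ θ x t, 0 < t → |lineFun (supportFun X) θ (x + t)
      + lineFun (supportFun X) θ (x - t) - 2 * lineFun (supportFun X) θ x| ≤ N * t := by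
  have hnorm : ∀ (θ x t : ℝ), 0 < t →
      ‖distortion X (cayley θ (x - t)) (cayley θ x) (cayley θ (x + t))
        (Circle.exp (θ + Real.pi))‖ = |lineFun (supportFun X) θ (x + t)
        + lineFun (supportFun X) θ (x - t) - 2 * lineFun (supportFun X) θ x| / t := by
    intro θ x t ht
    rw [distortion_cayley hXt θ x ht, Complex.norm_real, Real.norm_eq_abs, abs_div, abs_of_pos ht,
      ← abs_neg]
    congr 2; ring
  constructor
  · intro h
    refine ⟨(crNorm X).toReal, fun θ x t ht => ?_⟩
    have hcr : crossRatio (cayley θ (x - t)) (cayley θ x) (cayley θ (x + t))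
        (Circle.exp (θ + Real.pi)) = 1 := by
      rw [crossRatio_cayley θ (by linarith), sub_sub_cancel, add_sub_cancel_left,
        div_self ht.ne', Complex.ofReal_one]
    have h1 : ENNReal.ofReal ‖distortion X (cayley θ (x - t)) (cayley θ x) (cayley θ (x + t))
        (Circle.exp (θ + Real.pi))‖ ≤ crNorm X := by
      unfold crNorm
      refine le_iSup_of_le _ (le_iSup_of_le _ (le_iSup_of_le _ (le_iSup_of_le _
        (le_iSup_of_le (isCCW_cayley θ ?_ ?_) (le_iSup_of_le hcr le_rfl))))) <;> linarith
    rw [hnorm θ x t ht] at h1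
    rw [← div_le_iff₀ ht]
    exact (ENNReal.ofReal_le_iff_le_toReal h.ne).1 h1
  · rintro ⟨N, hN⟩
    refine lt_of_le_of_lt ?_ (ENNReal.ofReal_lt_top (r := N))
    unfold crNorm
    refine iSup_le fun a => iSup_le fun b => iSup_le fun c => iSup_le fun d => iSup_le fun hccw =>
      iSup_le fun hcr => ENNReal.ofReal_le_ofReal ?_
    obtain ⟨α, β, γ, δ, h1, h2, h3, h4, rfl, rfl, rfl, rfl⟩ := hccw
    -- This θ puts d at infinity; the other three points are then on the line, in increasing order.
    obtain ⟨θ, rfl⟩ : ∃ θ, δ = θ + Real.pi := ⟨δ - Real.pi, by ring⟩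
    obtain ⟨x, hx, hx'⟩ := exists_eq_cayley (θ := θ) (α := α) (by linarith) (by linarith)
    obtain ⟨y, hy, hy'⟩ := exists_eq_cayley (θ := θ) (α := β) (by linarith) (by linarith)
    obtain ⟨z, hz, hz'⟩ := exists_eq_cayley (θ := θ) (α := γ) (by linarith) (by linarith)
    have hxy : x < y := Real.arctan_strictMono.lt_iff_lt.1 (by rw [hx, hy]; linarith)
    have hyz : y < z := Real.arctan_strictMono.lt_iff_lt.1 (by rw [hy, hz]; linarith)
    rw [hx', hy', hz'] at hcr ⊢
    -- Cross-ratio 1 says that y is the midpoint of x and z.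
    rw [crossRatio_cayley θ hyz, Complex.ofReal_eq_one, div_eq_one_iff_eq (by linarith)] at hcr
    have hx2 : x = y - (z - y) := by linarith
    have hz2 : z = y + (z - y) := by ring
    have ht : 0 < z - y := by linarith
    generalize z - y = t at *
    subst hx2 hz2
    rw [hnorm θ y t ht, div_le_iff₀ ht]
    exact hN θ y t ht

theorem affineMap_combination (a : ℂ →ᵃ[ℝ] ℝ) {η p q : ℂ} {w r s : ℝ} (hw : r + s = w)
    (h : (w : ℂ) * η = r * p + s * q) : w * a η = r * a p + s * a q := by
  obtain ⟨α, β, rfl⟩ := exists_eq_aff a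
  have h1 : w * inner ℝ β η = r * inner ℝ β p + s * inner ℝ β q := by
    rw [← real_inner_smul_right, ← real_inner_smul_right, ← real_inner_smul_right,
      ← inner_add_right]
    simp only [Complex.real_smul, h]
  simp only [aff_apply]
  rw [← hw] at *
  linear_combination h1

theorem coe_cayley_eq (θ x : ℝ) : ((1 + x ^ 2 : ℝ) : ℂ) * cayley θ x
    = Circle.exp θ * ((1 - x ^ 2 : ℝ) + (2 * x : ℝ) * Complex.I) := by
  have h := one_sub_mul_I_ne_zero x
  have h1 : ((1 + x ^ 2 : ℝ) : ℂ) = (1 - x * Complex.I) * (1 + x * Complex.I) := by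
    push_cast
    linear_combination (x : ℂ) ^ 2 * Complex.I_sq
  have h2 : (2 / (1 - x * Complex.I) - 1 : ℂ) = (1 + x * Complex.I) / (1 - x * Complex.I) := by
    generalize hd : (1 - x * Complex.I : ℂ) = d at *
    rw [show (1 + x * Complex.I : ℂ) = 2 - d by rw [← hd]; ring]
    field_simp
  rw [coe_cayley, h2, h1]
  generalize hd : (1 - x * Complex.I : ℂ) = d at *
  field_simp
  push_cast
  linear_combination (x : ℂ) ^ 2 * Complex.I_sq

/-- The chords AC and BP meet at η. Up to the factor w, the second difference is the gap at η
between the interpolations of φ along the two chords, and both lie between any affine minorant and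
majorant. Since √(1 - |η|²) = 2t/w, the weight cancels. -/
theorem secondDiff_lineFun_le {φ : Circle → ℝ} (hφ : Continuous φ) {W : ℝ}
    (hW : ∀ η ∈ disk, (upperHull φ η - lowerHull φ η) / √(1 - ‖η‖ ^ 2) ≤ W) (θ x : ℝ) {t : ℝ}
    (ht : 0 < t) :
    |lineFun φ θ (x + t) + lineFun φ θ (x - t) - 2 * lineFun φ θ x| ≤ 2 * W * t := by
  -- The common total weight of η as a barycentre of A, C and of B, P.
  set w : ℝ := 1 + x ^ 2 + t ^ 2 with hw
  have hw0 : 0 < w := by positivity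
  have hwC : (w : ℂ) ≠ 0 := by exact_mod_cast hw0.ne'
  set η : ℂ := Circle.exp θ * (((1 - x ^ 2 - t ^ 2) / w : ℝ) + (2 * x / w : ℝ) * Complex.I) with hη
  have hwη : (w : ℂ) * η
      = Circle.exp θ * ((1 - x ^ 2 - t ^ 2 : ℝ) + (2 * x : ℝ) * Complex.I) := by
    rw [hη, Complex.ofReal_div, Complex.ofReal_div]
    field_simp
  have hn : 1 - ‖η‖ ^ 2 = (2 * t / w) ^ 2 := by
    rw [hη, norm_mul, Circle.norm_coe, one_mul, ← Complex.normSq_eq_norm_sq,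
      Complex.normSq_add_mul_I]
    field_simp
    rw [hw]; ring
  have hs : √(1 - ‖η‖ ^ 2) = 2 * t / w := by rw [hn, Real.sqrt_sq (by positivity)]
  have hηd : η ∈ disk := by
    rw [disk, mem_ball_zero_iff]
    have : 0 < (2 * t / w) ^ 2 := by positivity
    nlinarith [norm_nonneg η]
  set A := cayley θ (x - t)
  set B := cayley θ x
  set C := cayley θ (x + t)
  set P := Circle.exp (θ + Real.pi)
  have hAC : (w : ℂ) * η = ((1 + (x - t) ^ 2) / 2 : ℝ) * (A : ℂ)
      + ((1 + (x + t) ^ 2) / 2 : ℝ) * (C : ℂ) := by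
    have h1 := coe_cayley_eq θ (x - t)
    have h2 := coe_cayley_eq θ (x + t)
    rw [hwη]
    push_cast at h1 h2 ⊢
    linear_combination -(h1 + h2) / 2
  have hBP : (w : ℂ) * η = ((1 + x ^ 2 : ℝ) : ℂ) * (B : ℂ) + ((t ^ 2 : ℝ) : ℂ) * (P : ℂ) := by
    rw [hwη, coe_cayley_eq, coe_exp_add_pi]
    push_cast
    ring
  have key : |lineFun φ θ (x + t) + lineFun φ θ (x - t) - 2 * lineFun φ θ x| / w
      ≤ upperHull φ η - lowerHull φ η := by
    refine le_upperHull_sub_lowerHull hφ fun a b ha hb => ?_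
    have ha1 := affineMap_combination a (by rw [hw]; ring) hAC
    have ha2 := affineMap_combination a (by rw [hw]) hBP
    have hb1 := affineMap_combination b (by rw [hw]; ring) hAC
    have hb2 := affineMap_combination b (by rw [hw]) hBP
    have mono : ∀ (ζ : Circle) (r : ℝ), 0 ≤ r → r * a ζ ≤ r * φ ζ ∧ r * φ ζ ≤ r * b ζ :=
      fun ζ r hr => ⟨mul_le_mul_of_nonneg_left (ha ζ) hr, mul_le_mul_of_nonneg_left (hb ζ) hr⟩
    have hA := mono A ((1 + (x - t) ^ 2) / 2) (by positivity)
    have hB := mono B (1 + x ^ 2) (by positivity)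
    have hC := mono C ((1 + (x + t) ^ 2) / 2) (by positivity)
    have hP := mono P (t ^ 2) (by positivity)
    have hD : lineFun φ θ (x + t) + lineFun φ θ (x - t) - 2 * lineFun φ θ x
        = ((1 + (x - t) ^ 2) / 2 * φ A + (1 + (x + t) ^ 2) / 2 * φ C)
          - ((1 + x ^ 2) * φ B + t ^ 2 * φ P) := by
      simp only [lineFun]; ring
    have h3 : |lineFun φ θ (x + t) + lineFun φ θ (x - t) - 2 * lineFun φ θ x|
        ≤ (b η - a η) * w := by
      rw [hD, abs_le]
      constructor <;> linarith
    have := (div_le_iff₀ hw0).2 h3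
    linarith
  have h4 := hW η hηd
  rw [hs, div_le_iff₀ (by positivity)] at h4
  have h5 := key.trans h4
  rw [div_le_iff₀ hw0] at h5
  refine h5.trans (le_of_eq ?_)
  field_simp

/-- Subtract the linear interpolation at ±t and rescale by t, so that the zeros become ±1. -/
theorem abs_lineFun_sub_le {φ : Circle → ℝ} (hφ : Continuous φ) {N : ℝ}
    (hN : ∀ θ x t, 0 < t →
      |lineFun φ θ (x + t) + lineFun φ θ (x - t) - 2 * lineFun φ θ x| ≤ N * t)
    (θ : ℝ) {t : ℝ} (ht : 0 < t) :
    ∃ l₀ l₁ : ℝ, ∀ y, |lineFun φ θ y - l₀ - l₁ * y| ≤ 5 * N * (t + y ^ 2 / t) := by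
  set f := lineFun φ θ with hf
  have hfc : Continuous f := by
    rw [hf]; unfold lineFun
    have := continuous_cayley θ
    fun_prop
  refine ⟨(f t + f (-t)) / 2, (f t - f (-t)) / (2 * t), fun y => ?_⟩
  have h := abs_le_of_secondDiff_le (N := N)
    (g := fun x => (f (t * x) - (f t + f (-t)) / 2 - (f t - f (-t)) / (2 * t) * (t * x)) / t)
    (by fun_prop) ?_ ?_ ?_ (y / t)
  · have h1 : t * (y / t) = y := by field_simp
    simp only [h1] at h
    rw [abs_div, abs_of_pos ht, div_le_iff₀ ht] at h
    refine h.trans (le_of_eq ?_)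
    field_simp
  · intro x s hs
    have h1 := hN θ (t * x) (t * s) (by positivity)
    rw [← hf] at h1
    have h2 : (f (t * (x + s)) - (f t + f (-t)) / 2 - (f t - f (-t)) / (2 * t) * (t * (x + s))) / t
        + (f (t * (x - s)) - (f t + f (-t)) / 2 - (f t - f (-t)) / (2 * t) * (t * (x - s))) / t
        - 2 * ((f (t * x) - (f t + f (-t)) / 2 - (f t - f (-t)) / (2 * t) * (t * x)) / t)
        = (f (t * x + t * s) + f (t * x - t * s) - 2 * f (t * x)) / t := by
      rw [mul_add, mul_sub]; ring
    simp only [h2]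
    rw [abs_div, abs_of_pos ht, div_le_iff₀ ht]
    linarith
  · simp only [mul_one]; field_simp; ring
  · simp only [mul_neg, mul_one]; field_simp; ring

/-- In the coordinate y, 2/(1 + y²) = 1 + Re v and 2y²/(1 + y²) = 1 - Re v. The quadratic error on
the line thus becomes an error that is itself affine on the circle. -/
theorem exists_affine_near {φ : Circle → ℝ} (hφ : Continuous φ) {N : ℝ} (hN0 : 0 ≤ N)
    (hN : ∀ θ x t, 0 < t →
      |lineFun φ θ (x + t) + lineFun φ θ (x - t) - 2 * lineFun φ θ x| ≤ N * t)
    (θ : ℝ) {t : ℝ} (ht : 0 < t) :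
    ∃ c c₁ c₂ : ℝ, ∀ ζ : Circle, ∀ v : ℂ, v = conj (Circle.exp θ : ℂ) * ζ →
      |φ ζ - (c + c₁ * v.re + c₂ * v.im)| ≤ 5 * N * (t * (1 + v.re) + (1 - v.re) / t) := by
  obtain ⟨l₀, l₁, h⟩ := abs_lineFun_sub_le hφ hN θ ht
  have hunit : conj (Circle.exp θ : ℂ) * Circle.exp θ = 1 := by
    rw [mul_comm, Complex.mul_conj, Circle.normSq_coe, Complex.ofReal_one]
  refine ⟨φ (Circle.exp (θ + Real.pi)) + l₀, l₀, l₁, fun ζ v hv => ?_⟩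
  have hζ : ζ = Circle.exp θ * Circle.exp (Complex.arg (ζ * (Circle.exp θ)⁻¹ : Circle)) := by
    rw [Circle.exp_arg, mul_comm, inv_mul_cancel_right]
  have h1 := Complex.neg_pi_lt_arg ((ζ * (Circle.exp θ)⁻¹ : Circle) : ℂ)
  have h2 := Complex.arg_le_pi ((ζ * (Circle.exp θ)⁻¹ : Circle) : ℂ)
  generalize Complex.arg ((ζ * (Circle.exp θ)⁻¹ : Circle) : ℂ) = α at *
  rw [← Circle.exp_add] at hζ
  rcases eq_or_lt_of_le h2 with h3 | h3
  -- The point at infinity, v = -1, is outside the parametrization; there the affine function equals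
  -- φ.
  · rw [hζ, h3, coe_exp_add_pi, mul_neg, hunit] at hv
    rw [hv, hζ, h3]
    simp
    positivity
  obtain ⟨y, -, hy⟩ := exists_eq_cayley (θ := θ) (α := θ + α) (by linarith) (by linarith)
  rw [hy] at hζ
  subst hζ
  have hy0 : (0 : ℝ) < 1 + y ^ 2 := by positivity
  have hve : v = ((1 - y ^ 2) / (1 + y ^ 2) : ℝ) + (2 * y / (1 + y ^ 2) : ℝ) * Complex.I := by
    have h4 := coe_cayley_eq θ y
    have h5 : ((1 + y ^ 2 : ℝ) : ℂ) ≠ 0 := by exact_mod_cast hy0.ne'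
    refine mul_left_cancel₀ h5 ?_
    rw [hv, mul_left_comm, h4, ← mul_assoc, hunit, Complex.ofReal_div, Complex.ofReal_div]
    field_simp
  have hre : v.re = (1 - y ^ 2) / (1 + y ^ 2) := by
    rw [hve, Complex.add_re, Complex.ofReal_re, Complex.re_ofReal_mul, Complex.I_re, mul_zero, add_zero]
  have him : v.im = 2 * y / (1 + y ^ 2) := by
    rw [hve, Complex.add_im, Complex.ofReal_im, Complex.im_ofReal_mul, Complex.I_im, mul_one,
    zero_add]
  have h6 := h y
  have h7 : φ (cayley θ y) - (φ (Circle.exp (θ + Real.pi)) + l₀ + l₀ * v.re + l₁ * v.im)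
      = (lineFun φ θ y - l₀ - l₁ * y) * (2 / (1 + y ^ 2)) := by
    rw [hre, him, lineFun]; field_simp; ring
  rw [h7, abs_mul, abs_of_pos (by positivity : 0 < 2 / (1 + y ^ 2))]
  refine (mul_le_mul_of_nonneg_right h6 (by positivity)).trans (le_of_eq ?_)
  rw [hre]
  field_simp
  ring

/-- Adding and subtracting the affine error gives a majorant and a minorant, whose gap at η is
10N(t(1 + ρ) + (1 - ρ)/t). -/
theorem hull_gap_le {φ : Circle → ℝ} (hφ : Continuous φ) {N : ℝ} (hN0 : 0 ≤ N)
    (hN : ∀ θ x t, 0 < t →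
      |lineFun φ θ (x + t) + lineFun φ θ (x - t) - 2 * lineFun φ θ x| ≤ N * t)
    {η : ℂ} (hη : η ∈ disk) :
    (upperHull φ η - lowerHull φ η) / √(1 - ‖η‖ ^ 2) ≤ 20 * N := by
  obtain ⟨θ, hθ⟩ : ∃ θ : ℝ, η = ‖η‖ * (Circle.exp θ : ℂ) :=
    ⟨Complex.arg η, by rw [Circle.coe_exp, Complex.norm_mul_exp_arg_mul_I]⟩
  have hρ1 : ‖η‖ < 1 := by rwa [disk, mem_ball_zero_iff] at hη
  have hρ0 := norm_nonneg η
  generalize ‖η‖ = ρ at *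
  have h1 : 0 < 1 - ρ := by linarith
  have h2 : 0 < 1 + ρ := by linarith
  set p := √(1 - ρ) with hp
  set q := √(1 + ρ) with hq
  have hp0 : 0 < p := Real.sqrt_pos.2 h1
  have hq0 : 0 < q := Real.sqrt_pos.2 h2
  have hp2 : p ^ 2 = 1 - ρ := Real.sq_sqrt h1.le
  have hq2 : q ^ 2 = 1 + ρ := Real.sq_sqrt h2.le
  have hs : √(1 - ρ ^ 2) = p * q := by
    rw [hp, hq, ← Real.sqrt_mul h1.le]; congr 1; ring
  -- This scale minimizes the gap: both terms become √(1 - ρ²).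
  set t := p / q with ht
  have ht0 : 0 < t := by positivity
  obtain ⟨c, c₁, c₂, h⟩ := exists_affine_near hφ hN0 hN θ ht0
  have haff : ∀ d d₁ d₂ : ℝ, ∃ a : ℂ →ᵃ[ℝ] ℝ, ∀ ζ v : ℂ, v = conj (Circle.exp θ : ℂ) * ζ →
      a ζ = d + d₁ * v.re + d₂ * v.im := by
    intro d d₁ d₂
    refine ⟨aff d (Circle.exp θ * (d₁ + d₂ * Complex.I)), fun ζ v hv => ?_⟩
    have h3 : inner ℝ ((Circle.exp θ : ℂ) * (d₁ + d₂ * Complex.I)) ζ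
        = (conj ((Circle.exp θ : ℂ) * (d₁ + d₂ * Complex.I)) * ζ).re := by
      rw [Complex.inner, mul_comm]
    have h4 : conj ((Circle.exp θ : ℂ) * (d₁ + d₂ * Complex.I)) * ζ
        = (d₁ - d₂ * Complex.I) * v := by
      rw [hv]
      simp only [map_mul, map_add, Complex.conj_ofReal, Complex.conj_I]
      ring
    rw [aff_apply, h3, h4]
    simp
    ring
  obtain ⟨a, ha⟩ := haff (c + 5 * N * (t + 1 / t)) (c₁ + 5 * N * (t - 1 / t)) c₂
  obtain ⟨b, hb⟩ := haff (c - 5 * N * (t + 1 / t)) (c₁ - 5 * N * (t - 1 / t)) c₂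
  have hηv : (ρ : ℂ) = conj (Circle.exp θ : ℂ) * η := by
    have hunit : conj (Circle.exp θ : ℂ) * Circle.exp θ = 1 := by
      rw [mul_comm, Complex.mul_conj, Circle.normSq_coe, Complex.ofReal_one]
    rw [hθ, mul_left_comm, hunit, mul_one]
  have h3 : upperHull φ η ≤ a η := upperHull_le hφ (fun ζ => by
    rw [ha ζ _ rfl]
    have h5 := (abs_le.1 (h ζ _ rfl)).2
    ring_nf at h5 ⊢
    linarith) hη
  have h4 : b η ≤ lowerHull φ η := le_lowerHull hφ (fun ζ => by
    rw [hb ζ _ rfl]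
    have h5 := (abs_le.1 (h ζ _ rfl)).1
    ring_nf at h5 ⊢
    linarith) hη
  rw [ha η _ hηv] at h3
  rw [hb η _ hηv] at h4
  simp only [Complex.ofReal_re, Complex.ofReal_im] at h3 h4
  have h5 : t * (1 + ρ) + (1 - ρ) / t = 2 * (p * q) := by
    rw [← hp2, ← hq2, ht]; field_simp; ring
  rw [hs, div_le_iff₀ (by positivity)]
  have h6 : 10 * N * (t * (1 + ρ) + (1 - ρ) / t) = 20 * N * (p * q) := by rw [h5]; ring
  rw [← h6]
  ring_nf at h3 h4 ⊢
  linarith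

/-- A tangent field is Zygmund exactly when its width is finite. -/
theorem isZygmund_iff_width {X : Circle → ℂ} (hX : Continuous X) (hXt : IsTangent X) :
    IsZygmund X ↔ width X < ⊤ := by
  have hφ := continuous_supportFun hX
  rw [IsZygmund, and_iff_right hX, crNorm_lt_top_iff hXt]
  constructor
  · rintro ⟨N, hN⟩
    have hN0 : 0 ≤ N := by
      have := (abs_nonneg _).trans (hN 0 0 1 one_pos)
      linarith
    refine lt_of_le_of_lt ?_ (ENNReal.ofReal_lt_top (r := 20 * N))
    exact iSup₂_le fun η hη => ENNReal.ofReal_le_ofReal (hull_gap_le hφ hN0 hN hη)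
  · intro h
    refine ⟨2 * (width X).toReal, fun θ x t ht => secondDiff_lineFun_le hφ (fun η hη => ?_) θ x ht⟩
    refine (ENNReal.ofReal_le_iff_le_toReal h.ne).1 ?_
    exact le_iSup₂ (f := fun η (_ : η ∈ disk) => ENNReal.ofReal
      ((upperHull (supportFun X) η - lowerHull (supportFun X) η) / √(1 - ‖η‖ ^ 2))) η hη

end HarmLag

/-! ### The main theorem. -/

theorem theorem1p5 (X : Circle → ℂ) (hX : Continuous X) (hXt : HarmLag.IsTangent X)
    (m : HarmLag.DiskModel) :
    (∃ u, HarmLag.IsMeanGraph (HarmLag.supportFun X) u ∧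
      ∀ u', HarmLag.IsMeanGraph (HarmLag.supportFun X) u' → Set.EqOn u' u HarmLag.disk) ∧
    List.TFAE [
      HarmLag.IsZygmund X,
      ∃ V, HarmLag.IsHarmonicLagrangian V ∧ HarmLag.ExtendsTo m V X ∧ HarmLag.dbarNorm V < ⊤,
      HarmLag.width X < ⊤,
      HarmLag.dbarNorm (HarmLag.HL X) < ⊤] ∧
    (∀ V, HarmLag.IsHarmonicLagrangian V → HarmLag.ExtendsTo m V X → HarmLag.dbarNorm V < ⊤ →
      Set.EqOn V (HarmLag.HL X) HarmLag.disk) ∧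
    1 / 6 * HarmLag.dbarNorm (HarmLag.HL X) ≤ HarmLag.width X ∧
    HarmLag.width X ≤ 2 * HarmLag.dbarNorm (HarmLag.HL X) := by
  have h36 := HarmLag.dbarNorm_HL_le hX
  have h32 := HarmLag.width_le hX
  have hφ := HarmLag.continuous_supportFun hX
  refine ⟨⟨_, HarmLag.isMeanGraph_pois hφ, fun u' hu' => hu'.eqOn (HarmLag.isMeanGraph_pois hφ)⟩,
    ?_, fun V hV hVX _ => hV.eqOn_HL hX hXt hVX, ?_, h32⟩
  · tfae_have 1 ↔ 3 := HarmLag.isZygmund_iff_width hX hXt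
    tfae_have 3 → 4 := fun h => h36.trans_lt (ENNReal.mul_lt_top (by simp) h)
    tfae_have 4 → 3 := fun h => h32.trans_lt (ENNReal.mul_lt_top (by simp) h)
    tfae_have 4 → 2 := fun h =>
      ⟨_, HarmLag.isHarmonicLagrangian_HL hX, HarmLag.extendsTo_HL hX hXt m, h⟩
    tfae_have 2 → 4 := by
      rintro ⟨V, hV, hVX, h⟩
      -- By uniqueness V agrees with `HL X` on the disk, so the norms coincide.
      rwa [HarmLag.dbarNorm_congr (hV.eqOn_HL hX hXt hVX)] at h
    tfae_finish
  · calc 1 / 6 * HarmLag.dbarNorm (HarmLag.HL X) ≤ 1 / 6 * (6 * HarmLag.width X) := by gcongr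
      _ = HarmLag.width X := by
        rw [← mul_assoc, one_div, ENNReal.inv_mul_cancel (by norm_num) (by norm_num), one_mul]
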